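/- Let $A,K\in\mathbb R$, $a>0$. There are $n_0\in\mathbb N$ and $\delta_0,C>0$, depending only on $A,a,K$, such that the following holds for every integer $n\ge n_0$. *Setting.* Let $\mu,\Phi\in C^2(\mathbb R^3)$ satisfy $|\nabla^k\mu(y)|\le A e^{-a|y|}$ and $|\nabla^k\Phi(y)|\le A e^{-a|y|}$ for $k=1,2$, let $\varphi(x)=e^{-|x|}/(4\pi|x|)$, and let $\kappa\in\mathbb R$. Let $(f,X,V)$ be a classical solution on $[0,T]$ of $$\partial_t f+v\cdot\nabla_x f+\big(E(t,x)+\nabla\Phi(x-X(t))\big)\cdot\nabla_v f=0,\quad f(0,x,v)=\mu(v),\quad E=-\nabla(\varphi*\rho),\quad \rho(t,x)=\int_{\mathbb R^3}(f(t,x,v)-\mu(v))\,dv,$$ $$\dot X=V,\qquad \dot V(t)=\kappa\int_{\mathbb R^3}\rho(t,y)\,\nabla\Phi(y-X(t))\,dy,$$ where $f$ is $C^1$ and $\rho,\nabla_x\rho$ exist and are continuous on $[0,T]\times\mathbb R^3$. Let $(X_{s,t},V_{s,t})(x,v)$ be its characteristics: $\partial_sX_{s,t}=V_{s,t}$, $\partial_sV_{s,t}=E(s,X_{s,t})+\nabla\Phi(X_{s,t}-X(s))$,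 $(X_{t,t},V_{t,t})=(x,v)$. Write $x=(x_1,x^\perp)$. Extend $X_1$ beyond $[0,T]$ by uniform motion, let $\tau_{x_1}$ be the time at which $X_1(\tau_{x_1})=x_1$, and put $\check\tau_{t,x_1}=\max(t-\tau_{x_1},0)$, $\check d_{t,x_1}=\max(x_1-X_1(t),0)$. *Bootstrap assumptions.* Let $\delta,V_{\min}>0$ be such that (B1) for all $t\in[0,T]$ and $x\in\mathbb R^3$: $(1+|x^\perp|^2+\check d_{t,x_1}^2+\check\tau_{t,x_1}^2)\,|\rho(t,x)|\le\delta$ and $(1+|x^\perp|^3+\check d_{t,x_1}^3+\check\tau_{t,x_1}^3)\,|\nabla\rho(t,x)|\le\delta$; (B2) $\delta\le\delta_0$, $V_{\min}^{-1}\le\delta$, $\log(2+T)^n\le\delta^{-1}$; (B3) $\mu(v)=0$ for $|v|\ge V_{\min}/4$, and for all $0\le s\le t\le T$: $V_1(t)\ge V_{\min}$, $V_1(t)\le K V_1(s)$, $|X^\perp(t)|\le K$, $|V^\perp(t)|\le K$. *Claim.* For $t\in[0,T]$ and $x\in\mathbb R^3$ let $$S_I(t,x)=-\int_0^t\int_{\mathbb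 R^3}\nabla\Phi(X_{s,t}(x,v)-X(s))\cdot\nabla_v\mu(V_{s,t}(x,v))\,dv\,ds,$$ $$\bar S_I(t,x)=-\int_{-\infty}^t\int_{\mathbb R^3}\nabla\Phi\big(x-(t-s)v-(X(t)-(t-s)V(t))\big)\cdot\nabla_v\mu(v)\,dv\,ds .$$ Then both integrals converge absolutely, $S_I(t,\cdot)$ is differentiable, and for all $t\in[0,T]$, $x\in\mathbb R^3$ $$|S_I(t,x)|+|\bar S_I(t,x)|\le\frac{C}{V_{\min}\,(1+|x^\perp|^2+\check d_{t,x_1}^2+\check\tau_{t,x_1}^2)},$$ $$|\nabla S_I(t,x)|\le\frac{C}{V_{\min}\,(1+|x^\perp|^3+\check d_{t,x_1}^3+\check\tau_{t,x_1}^3)} .$$ -/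

import Mathlib

open MeasureTheory Set
open scoped Gradient RealInnerProductSpace

noncomputable section

namespace FastCharge

/-- Three-dimensional Euclidean space. Coordinate `0` is the direction of motion of the point
charge (called `x_1` on paper); coordinates `1` and `2` are the transversal ones. -/
abbrev E3 : Type := EuclideanSpace ℝ (Fin 3)

/-- Length of the transversal part of a vector. -/
def perpNorm (x : E3) : ℝ := Real.sqrt (x 1 ^ 2 + x 2 ^ 2)

/-- A function of class `C^2` whose first two derivatives are bounded by `A exp (-a |x|)`. -/
structure ExpDecay (A a : ℝ) (g : E3 → ℝ) : Prop where
  contDiff : ContDiff ℝ 2 g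
  bound_one : ∀ x, ‖fderiv ℝ g x‖ ≤ A * Real.exp (-a * ‖x‖)
  bound_two : ∀ x, ‖fderiv ℝ (fderiv ℝ g) x‖ ≤ A * Real.exp (-a * ‖x‖)

/-- The screened Coulomb potential, the decaying solution of `-Δφ + φ = δ₀`. -/
def screenedCoulomb (x : E3) : ℝ := Real.exp (-‖x‖) / (4 * Real.pi * ‖x‖)

/-- The perturbation of the spatial density, `ρ(t,x) = ∫ (f(t,x,v) - μ(v)) dv`. -/
def density (μ : E3 → ℝ) (f : ℝ → E3 → E3 → ℝ) (t : ℝ) (x : E3) : ℝ :=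
  ∫ v, (f t x v - μ v)

/-- The self-consistent field `E(t,·) = -∇(φ * ρ(t,·))`. -/
def electricField (ρ : ℝ → E3 → ℝ) (t : ℝ) (x : E3) : E3 :=
  -∇ (fun y : E3 => ∫ z, screenedCoulomb z * ρ t (y - z)) x

/-- Total force on a plasma particle at `x` at time `t`, the point charge being at `X t`. -/
def force (Φ : E3 → ℝ) (ρ : ℝ → E3 → ℝ) (X : ℝ → E3) (t : ℝ) (x : E3) : E3 :=
  electricField ρ t x + ∇ Φ (x - X t)

/-- `(f, X, V)` is a classical solution on `[0,T]` of the screened Vlasov-Poisson system with a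
point charge, starting from the homogeneous state `μ`. The real number `κ` is the coupling
constant (charge, mass and sign) of the force that the plasma exerts on the point charge. -/
structure IsSolution (μ Φ : E3 → ℝ) (κ T : ℝ) (f : ℝ → E3 → E3 → ℝ) (X V : ℝ → E3) : Prop where
  contDiffOn : ContDiffOn ℝ 1 (fun p : ℝ × E3 × E3 => f p.1 p.2.1 p.2.2) (Icc 0 T ×ˢ univ)
  initial : ∀ x v, f 0 x v = μ v
  integrable : ∀ t ∈ Icc 0 T, ∀ x, Integrable (fun v => f t x v - μ v)
  density_continuousOn :
    ContinuousOn (fun p : ℝ × E3 => density μ f p.1 p.2) (Icc 0 T ×ˢ univ)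
  density_differentiable : ∀ t ∈ Icc 0 T, Differentiable ℝ (density μ f t)
  density_gradient_continuousOn :
    ContinuousOn (fun p : ℝ × E3 => ∇ (density μ f p.1) p.2) (Icc 0 T ×ˢ univ)
  vlasov : ∀ t ∈ Ioo 0 T, ∀ x v,
    deriv (fun s => f s x v) t + ⟪v, ∇ (fun y => f t y v) x⟫
      + ⟪force Φ (density μ f) X t x, ∇ (fun w => f t x w) v⟫ = 0
  position : ∀ t ∈ Icc 0 T, HasDerivWithinAt X (V t) (Icc 0 T) t
  velocity : ∀ t ∈ Icc 0 T,
    HasDerivWithinAt V (κ • ∫ y, density μ f t y • ∇ Φ (y - X t)) (Icc 0 T) t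

/-- `s ↦ (XX s t x v, VV s t x v)` is the characteristic that is at `(x, v)` at time `t`. -/
structure IsCharacteristicFlow (F : ℝ → E3 → E3) (T : ℝ) (XX VV : ℝ → ℝ → E3 → E3 → E3) :
    Prop where
  position_self : ∀ t ∈ Icc 0 T, ∀ x v, XX t t x v = x
  velocity_self : ∀ t ∈ Icc 0 T, ∀ x v, VV t t x v = v
  position : ∀ t ∈ Icc 0 T, ∀ x v, ∀ s ∈ Icc 0 T,
    HasDerivWithinAt (fun r => XX r t x v) (VV s t x v) (Icc 0 T) s
  velocity : ∀ t ∈ Icc 0 T, ∀ x v, ∀ s ∈ Icc 0 T,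
    HasDerivWithinAt (fun r => VV r t x v) (F s (XX s t x v)) (Icc 0 T) s

/-- First coordinate of the trajectory of the point charge, continued by uniform motion
outside `[0,T]`. -/
def extendedFirst (T : ℝ) (X V : ℝ → E3) (s : ℝ) : ℝ :=
  if s < 0 then X 0 0 + s * V 0 0
  else if s ≤ T then X s 0
  else X T 0 + (s - T) * V T 0

/-- The passage time: the time at which the (continued) trajectory of the point charge crosses
the plane of points with first coordinate `r`. It is the unique such time as soon as the first
component of the velocity is bounded below by a positive number on `[0,T]`. -/
def passageTime (T : ℝ) (X V : ℝ → E3) (r : ℝ) : ℝ :=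
  sInf {s : ℝ | r ≤ extendedFirst T X V s}

/-- The time elapsed at time `t` since the passage of the charge (zero before the passage). -/
def elapsed (T : ℝ) (X V : ℝ → E3) (t r : ℝ) : ℝ := max (t - passageTime T X V r) 0

/-- The distance ahead of the charge at time `t` (zero behind the charge). -/
def ahead (X : ℝ → E3) (t r : ℝ) : ℝ := max (r - X t 0) 0

/-- The weight `1 + |x^⊥|^k + ď^k + τ̌^k`. -/
def weight (k : ℕ) (T : ℝ) (X V : ℝ → E3) (t : ℝ) (x : E3) : ℝ :=
  1 + perpNorm x ^ k + ahead X t (x 0) ^ k + elapsed T X V t (x 0) ^ k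

/-- First bootstrap assumption: the weighted norm of the density on `[0,T]` is at most `δ`. -/
def BootstrapDensity (δ T : ℝ) (ρ : ℝ → E3 → ℝ) (X V : ℝ → E3) : Prop :=
  ∀ t ∈ Icc 0 T, ∀ x,
    weight 2 T X V t x * |ρ t x| ≤ δ ∧ weight 3 T X V t x * ‖∇ (ρ t) x‖ ≤ δ

/-- Second bootstrap assumption: relations between the parameters. -/
structure BootstrapParameters (δ₀ : ℝ) (n : ℕ) (δ T Vmin : ℝ) : Prop where
  delta_pos : 0 < δ
  delta_le : δ ≤ δ₀
  Vmin_pos : 0 < Vmin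
  inv_Vmin_le : Vmin⁻¹ ≤ δ
  log_le : Real.log (2 + T) ^ n ≤ δ⁻¹

/-- Third bootstrap assumption: the charge is fast compared with the plasma, essentially does not
accelerate (`V_1(t) ≤ K V_1(s)` for `s ≤ t`; `K = 1` means that it decelerates), and essentially
moves along the first axis (no transversal motion at all is included). -/
structure BootstrapCharge (K T Vmin : ℝ) (μ : E3 → ℝ) (X V : ℝ → E3) : Prop where
  support : ∀ v, Vmin / 4 ≤ ‖v‖ → μ v = 0
  Vmin_le : ∀ t ∈ Icc 0 T, Vmin ≤ V t 0
  almost_decreasing : ∀ t ∈ Icc 0 T, ∀ s ∈ Icc 0 t, V t 0 ≤ K * V s 0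
  perp_position : ∀ t ∈ Icc 0 T, perpNorm (X t) ≤ K
  perp_velocity : ∀ t ∈ Icc 0 T, perpNorm (V t) ≤ K

/-- Integrand of the source `S_I`, as a function of `(s, v)`. -/
def sourceIntegrand (μ Φ : E3 → ℝ) (X : ℝ → E3) (XX VV : ℝ → ℝ → E3 → E3 → E3)
    (t : ℝ) (x : E3) (s : ℝ) (v : E3) : ℝ :=
  ⟪∇ Φ (XX s t x v - X s), ∇ μ (VV s t x v)⟫

/-- The contribution `S_I` of the point charge to the source. -/
def source (μ Φ : E3 → ℝ) (X : ℝ → E3) (XX VV : ℝ → ℝ → E3 → E3 → E3)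
    (t : ℝ) (x : E3) : ℝ :=
  -∫ s in (0 : ℝ)..t, ∫ v, sourceIntegrand μ Φ X XX VV t x s v

/-- Integrand of the linearized source, as a function of `(s, v)`. -/
def linearSourceIntegrand (μ Φ : E3 → ℝ) (X V : ℝ → E3)
    (t : ℝ) (x : E3) (s : ℝ) (v : E3) : ℝ :=
  ⟪∇ Φ (x - (t - s) • v - (X t - (t - s) • V t)), ∇ μ v⟫

/-- The source with linearized characteristics and linearized trajectory of the point charge,
extended to all negative times. -/
def linearSource (μ Φ : E3 → ℝ) (X V : ℝ → E3) (t : ℝ) (x : E3) : ℝ :=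
  -∫ s in Iic t, ∫ v, linearSourceIntegrand μ Φ X V t x s v

end FastCharge

end

/-! Where ∇μ does not vanish, the particle is slow at time s while the charge has speed at least
Vmin, so the two meet essentially once and briefly. For free characteristics the integrand is
bounded by a multiple of exp(-a(|v| + |x-(t-s)v-X(s)|)). Dispersion in the two transversal velocity
components gives (1+t-s)^(-2). For a fixed longitudinal velocity of modulus at most Vmin/2, the
longitudinal distance to the charge varies with s at speed at least Vmin/2, so the time integral
gives 1/Vmin (`integrableOn_of_bound`). Geometrically, the weight of order k is at most a multiple
of ((1+t-s)(1+|v|+|x-(t-s)v-X(s)|))^k (`weight_le`, and `weight_le_linear` for the linearized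
trajectory). The exponential pays for the last bracket and dispersion pays for (1+t-s)^2, which is
exactly the quadratic weight.

The cubic weight of the gradient requires another factor (1+t-s)^(-1). Before differentiating in y
at y = x, the velocity is translated by (y-x)/(1+t-s), which does not change the integral. The flow
is then differentiated in the direction (h, h/(1+t-s)), which free transport maps at time s to (h,
h)/(1+t-s). This yields the gain while using no more than two derivatives of μ and Φ.

For the true characteristics, E = -φ*∇ρ and DE = -∇φ*∇ρ both inherit the cubic decay of ∇ρ
(`DensityBound.regularForce`). A particle that is slow at time s has a passing time σ, around which
the weight grows like |r-σ|^3 and the distance to the charge like Vmin|r-σ|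
(`FastMotion.exists_isPassing`). Hence the force and its derivative along the trajectory have zeroth
and first moments about σ of size O(δ), while the second moment is O(δ log(2+T)) + O(1/Vmin), which
is bounded by (B2). Small moments keep the trajectory close to free transport, and a weighted
Grönwall argument (`ForceSetting.linearized_le`) preserves the gain up to a factor of order
(1+L)exp(2L), where L = σ-s. That loss is harmless: at time s the particle is still at distance at
least Vmin L/2 from the charge, so the decay of ∇Φ absorbs it once a Vmin is large
(`ForceSetting.exists_delay`, `ForceSetting.exists_integrand_deriv`). -/

namespace FastCharge

/-! ### Linear differential equations on a compact interval. -/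

section LinearODE

variable {F : Type*} [NormedAddCommGroup F] [NormedSpace ℝ F]

/-- Radial truncation at radius `R`. -/
noncomputable def truncate (R : ℝ) (x : F) : F := (R / max R ‖x‖) • x

lemma norm_truncate_le {R : ℝ} (hR : 0 < R) (x : F) : ‖truncate R x‖ ≤ R := by
  have h : 0 < max R ‖x‖ := lt_max_of_lt_left hR
  rw [truncate, norm_smul, Real.norm_of_nonneg (by positivity), div_mul_eq_mul_div, div_le_iff₀ h]
  gcongr
  exact le_max_right _ _

lemma norm_truncate_le_norm {R : ℝ} (hR : 0 < R) (x : F) : ‖truncate R x‖ ≤ ‖x‖ := by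
  have h : 0 < max R ‖x‖ := lt_max_of_lt_left hR
  rw [truncate, norm_smul, Real.norm_of_nonneg (by positivity)]
  exact mul_le_of_le_one_left (norm_nonneg _) ((div_le_one h).2 (le_max_left _ _))

lemma truncate_of_norm_le {R : ℝ} (hR : 0 < R) {x : F} (hx : ‖x‖ ≤ R) : truncate R x = x := by
  rw [truncate, max_eq_left hx, div_self hR.ne', one_smul]

/-- The factor 2 comes from treating separately the change of the vector and the change of the
scale. Only the existence of some Lipschitz constant matters later. -/
lemma norm_truncate_sub_le {R : ℝ} (hR : 0 < R) (x y : F) :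
    ‖truncate R x - truncate R y‖ ≤ 2 * ‖x - y‖ := by
  have hx : 0 < max R ‖x‖ := lt_max_of_lt_left hR
  have hy : 0 < max R ‖y‖ := lt_max_of_lt_left hR
  have e : truncate R x - truncate R y
      = (R / max R ‖x‖) • (x - y) + (R / max R ‖x‖ - R / max R ‖y‖) • y := by
    simp only [truncate, smul_sub, sub_smul]; abel
  have h1 : ‖(R / max R ‖x‖) • (x - y)‖ ≤ ‖x - y‖ := by
    rw [norm_smul, Real.norm_of_nonneg (by positivity)]
    exact mul_le_of_le_one_left (norm_nonneg _) ((div_le_one hx).2 (le_max_left _ _))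
  have h2 : ‖(R / max R ‖x‖ - R / max R ‖y‖) • y‖ ≤ ‖x - y‖ := by
    have e2 : R / max R ‖x‖ - R / max R ‖y‖
        = (R / max R ‖x‖) * ((max R ‖y‖ - max R ‖x‖) / max R ‖y‖) := by
      field_simp
    have h3 : |max R ‖y‖ - max R ‖x‖| ≤ ‖x - y‖ := by
      have h6 : |max R ‖y‖ - max R ‖x‖| ≤ |‖y‖ - ‖x‖| := by
        simpa using abs_max_sub_max_le_max R ‖y‖ R ‖x‖
      rw [norm_sub_rev]
      exact h6.trans (abs_norm_sub_norm_le _ _)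
    rw [norm_smul, e2, norm_mul, Real.norm_of_nonneg (by positivity : 0 ≤ R / max R ‖x‖), norm_div,
      Real.norm_of_nonneg hy.le, Real.norm_eq_abs]
    have h4 : R / max R ‖x‖ ≤ 1 := (div_le_one hx).2 (le_max_left _ _)
    have h5 : ‖y‖ / max R ‖y‖ ≤ 1 := (div_le_one hy).2 (le_max_right _ _)
    calc R / max R ‖x‖ * (|max R ‖y‖ - max R ‖x‖| / max R ‖y‖) * ‖y‖
        = (R / max R ‖x‖) * (‖y‖ / max R ‖y‖) * |max R ‖y‖ - max R ‖x‖| := by ring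
      _ ≤ 1 * 1 * ‖x - y‖ := by gcongr
      _ = ‖x - y‖ := by ring
  rw [e]
  linarith [norm_add_le ((R / max R ‖x‖) • (x - y)) ((R / max R ‖x‖ - R / max R ‖y‖) • y)]

lemma hasDerivWithinAt_Ici_of_Icc {f : ℝ → F} {f' : F} {a b x : ℝ} (hx : x ∈ Ico a b)
    (h : HasDerivWithinAt f f' (Icc a b) x) : HasDerivWithinAt f f' (Ici x) x :=
  h.mono_of_mem_nhdsWithin (Icc_mem_nhdsGE_of_mem hx)

/-- Global existence for linear differential equations on a compact interval. -/
theorem exists_linear_ODE_solution [CompleteSpace F] {A : ℝ → F →L[ℝ] F} {τ L : ℝ} (hτ : 0 ≤ τ)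
    (hA : ContinuousOn A (Icc 0 τ)) (hL : ∀ s ∈ Icc 0 τ, ‖A s‖ ≤ L) (y₀ : F) :
    ∃ y : ℝ → F, y 0 = y₀ ∧
      ∀ s ∈ Icc 0 τ, HasDerivWithinAt y (A s (y s)) (Icc 0 τ) s := by
  have hL0 : 0 ≤ L := (norm_nonneg _).trans (hL 0 ⟨le_rfl, hτ⟩)
  -- The truncated field is bounded by L R, so Picard–Lindelöf yields a solution on all of [0, τ].
  -- This R exceeds the Grönwall bound of the truncated equation, so the truncation is never active.
  set R : ℝ := ‖y₀‖ * Real.exp (L * τ) + 1 with hR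
  have hR0 : 0 < R := by positivity
  have hpl : IsPicardLindelof (fun s y => A s (truncate R y)) (⟨0, ⟨le_rfl, hτ⟩⟩ : Icc 0 τ) y₀
      ⟨L * R * τ, by positivity⟩ 0 ⟨L * R, by positivity⟩ ⟨L * 2, by positivity⟩ := by
    refine ⟨fun s hs => LipschitzOnWith.of_dist_le_mul fun x _ y _ => ?_, fun x _ => ?_,
      fun s hs x _ => ?_, ?_⟩
    · rw [dist_eq_norm, dist_eq_norm, ← map_sub]
      calc ‖A s (truncate R x - truncate R y)‖ ≤ ‖A s‖ * ‖truncate R x - truncate R y‖ :=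
            (A s).le_opNorm _
        _ ≤ L * (2 * ‖x - y‖) := by
            gcongr
            · exact hL s hs
            · exact norm_truncate_sub_le hR0 x y
        _ = L * 2 * ‖x - y‖ := by ring
    · exact hA.clm_apply continuousOn_const
    · exact ((A s).le_opNorm _).trans
        (mul_le_mul (hL s hs) (norm_truncate_le hR0 x) (norm_nonneg _) hL0)
    · simp only [sub_zero, sub_self, max_eq_left hτ, NNReal.coe_zero]
      exact le_rfl
  obtain ⟨y, hy0, hy⟩ := hpl.exists_eq_forall_mem_Icc_hasDerivWithinAt₀
  have hcont : ContinuousOn y (Icc 0 τ) := fun s hs => (hy s hs).continuousWithinAt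
  have hbound : ∀ s ∈ Icc 0 τ, ‖y s‖ ≤ R := by
    intro s hs
    have := norm_le_gronwallBound_of_norm_deriv_right_le (δ := ‖y₀‖) (K := L) (ε := 0) hcont
      (fun x hx => hasDerivWithinAt_Ici_of_Icc hx (hy x ⟨hx.1, hx.2.le⟩))
      (by simpa using (congrArg norm hy0).le)
      (fun x hx => by
        rw [add_zero]
        exact ((A x).le_opNorm _).trans (mul_le_mul (hL x ⟨hx.1, hx.2.le⟩)
          (norm_truncate_le_norm hR0 _) (norm_nonneg _) hL0)) s hs
    rw [gronwallBound_ε0, sub_zero] at this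
    refine this.trans ?_
    have : Real.exp (L * s) ≤ Real.exp (L * τ) := Real.exp_le_exp.2 (by gcongr; exact hs.2)
    rw [hR]
    nlinarith [norm_nonneg y₀, mul_le_mul_of_nonneg_left this (norm_nonneg y₀)]
  refine ⟨y, hy0, fun s hs => ?_⟩
  have := hy s hs
  simpa only [truncate_of_norm_le hR0 (hbound s hs)] using this

end LinearODE

/-! ### Differentiability of flows in the initial datum. -/

section Flow

variable {E : Type*} [NormedAddCommGroup E] [NormedSpace ℝ E]

/-- Trajectories of an ODE with bounded spatial derivative depend on the initial datum in a
Lipschitz way. -/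
theorem norm_flow_sub_le {G : ℝ → E → E} {A : ℝ → E → E →L[ℝ] E} {τ L : ℝ} {z : ℝ → E → E}
    (hG : ∀ s ∈ Icc 0 τ, ∀ x, HasFDerivAt (G s) (A s x) x)
    (hL : ∀ s ∈ Icc 0 τ, ∀ x, ‖A s x‖ ≤ L) (hz0 : ∀ x, z 0 x = x)
    (hz : ∀ x, ∀ s ∈ Icc 0 τ, HasDerivWithinAt (fun r => z r x) (G s (z s x)) (Icc 0 τ) s)
    {s : ℝ} (hs : s ∈ Icc 0 τ) (x y : E) :
    ‖z s x - z s y‖ ≤ ‖x - y‖ * Real.exp (L * s) := by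
  have hd : ∀ r ∈ Icc 0 τ, HasDerivWithinAt (fun r => z r x - z r y)
      (G r (z r x) - G r (z r y)) (Icc 0 τ) r := fun r hr => (hz x r hr).sub (hz y r hr)
  have := norm_le_gronwallBound_of_norm_deriv_right_le (δ := ‖x - y‖) (K := L) (ε := 0)
    (fun r hr => (hd r hr).continuousWithinAt)
    (fun r hr => hasDerivWithinAt_Ici_of_Icc hr (hd r ⟨hr.1, hr.2.le⟩))
    (by simp [hz0])
    (fun r hr => by
      rw [add_zero]
      exact Convex.norm_image_sub_le_of_norm_hasFDerivWithin_le (s := univ)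
        (fun w _ => (hG r ⟨hr.1, hr.2.le⟩ w).hasFDerivWithinAt)
        (fun w _ => hL r ⟨hr.1, hr.2.le⟩ w) convex_univ (mem_univ _) (mem_univ _)) s hs
  rwa [gronwallBound_ε0, sub_zero] at this

/-- Differentiable dependence of the solution of an ODE on the initial datum. -/
theorem exists_flow_hasFDerivAt [CompleteSpace E] {G : ℝ → E → E} {A : ℝ → E → E →L[ℝ] E}
    {τ L : ℝ} {z : ℝ → E → E} (hτ : 0 ≤ τ)
    (hG : ∀ s ∈ Icc 0 τ, ∀ x, HasFDerivAt (G s) (A s x) x)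
    (hAc : ContinuousOn (fun p : ℝ × E => A p.1 p.2) (Icc 0 τ ×ˢ univ))
    (hL : ∀ s ∈ Icc 0 τ, ∀ x, ‖A s x‖ ≤ L) (hz0 : ∀ x, z 0 x = x)
    (hz : ∀ x, ∀ s ∈ Icc 0 τ, HasDerivWithinAt (fun r => z r x) (G s (z s x)) (Icc 0 τ) s)
    (x : E) :
    ∃ Y : ℝ → E →L[ℝ] E, Y 0 = ContinuousLinearMap.id ℝ E ∧
      (∀ s ∈ Icc 0 τ, HasDerivWithinAt Y ((A s (z s x)).comp (Y s)) (Icc 0 τ) s) ∧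
      ∀ s ∈ Icc 0 τ, HasFDerivAt (z s) (Y s) x := by
  have hzc : ContinuousOn (fun r => z r x) (Icc 0 τ) := fun s hs => (hz x s hs).continuousWithinAt
  have hAx : ContinuousOn (fun r => A r (z r x)) (Icc 0 τ) :=
    hAc.comp (continuousOn_id.prodMk hzc) (fun r hr => ⟨hr, mem_univ _⟩)
  have hL0 : 0 ≤ L := (norm_nonneg _).trans (hL 0 ⟨le_rfl, hτ⟩ x)
  obtain ⟨Y, hY0, hY⟩ := exists_linear_ODE_solution (F := E →L[ℝ] E) (τ := τ) (L := L)
    (A := fun s => ContinuousLinearMap.compL ℝ E E E (A s (z s x))) hτ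
    ((ContinuousLinearMap.compL ℝ E E E).continuous.comp_continuousOn hAx)
    (fun s hs => by
      refine ContinuousLinearMap.opNorm_le_bound _ hL0 fun B => ?_
      exact (ContinuousLinearMap.opNorm_comp_le _ _).trans (by gcongr; exact hL s hs _))
    (ContinuousLinearMap.id ℝ E)
  refine ⟨Y, hY0, hY, fun s hs => ?_⟩
  -- uniform continuity of `A` along the compact trajectory
  set A' : ℝ × E → E →L[ℝ] E := fun p => A (projIcc 0 τ hτ p.1) p.2 with hA'
  have hA'c : Continuous A' := by
    have := hAc.comp_continuous (f := fun p : ℝ × E => ((projIcc 0 τ hτ p.1 : ℝ), p.2))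
      (by fun_prop) (fun p => ⟨(projIcc 0 τ hτ p.1).2, mem_univ _⟩)
    exact this
  have hK : IsCompact ((fun r => (r, z r x)) '' Icc 0 τ) :=
    isCompact_Icc.image_of_continuousOn (continuousOn_id.prodMk hzc)
  have huc : ∀ ε > 0, ∃ η > 0, ∀ r ∈ Icc 0 τ, ∀ w, ‖w - z r x‖ < η →
      ‖A r w - A r (z r x)‖ ≤ ε := by
    intro ε hε
    have := hK.uniformContinuousAt_of_continuousAt A' (fun a _ => hA'c.continuousAt)
      (Metric.dist_mem_uniformity hε)
    obtain ⟨η, hη, h⟩ := Metric.mem_uniformity_dist.1 this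
    refine ⟨η, hη, fun r hr w hw => ?_⟩
    have := h (a := (r, z r x)) (b := (r, w)) (by
      rw [Prod.dist_eq]; simp only [dist_self]
      rw [max_eq_right dist_nonneg, dist_comm, dist_eq_norm]; exact hw) (mem_image_of_mem _ hr)
    simp only [mem_ofPred_eq, hA', projIcc_of_mem hτ hr] at this
    rw [dist_comm, dist_eq_norm] at this
    exact this.le
  rw [hasFDerivAt_iff_isLittleO_nhds_zero, Asymptotics.isLittleO_iff]
  intro c hc
  -- constant in Grönwall's inequality for the remainder
  set M : ℝ := Real.exp (L * τ) with hM
  have hM1 : 0 < M := Real.exp_pos _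
  -- With zero initial value the Grönwall bound is continuous in the forcing and vanishes with it.
  obtain ⟨ε, hε, hεc⟩ : ∃ ε > 0, gronwallBound 0 L (ε * M) s ≤ c := by
    have h1 : Filter.Tendsto (fun ε => gronwallBound 0 L (ε * M) s) (nhdsWithin 0 (Ioi 0))
        (nhds 0) := by
      have := ((gronwallBound_continuous_ε 0 L s).comp
        (by fun_prop : Continuous fun ε : ℝ => ε * M)).tendsto 0
      simp only [Function.comp_def, zero_mul, gronwallBound_ε0_δ0] at this
      exact this.mono_left nhdsWithin_le_nhds
    obtain ⟨ε, h2, h3⟩ := ((h1.eventually (eventually_le_nhds hc)).and self_mem_nhdsWithin).exists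
    exact ⟨ε, h3, h2⟩
  obtain ⟨η, hη, hηA⟩ := huc ε hε
  have hball : ∀ᶠ h : E in nhds 0, ‖h‖ < η / M := by
    have := Metric.ball_mem_nhds (0 : E) (div_pos hη hM1)
    filter_upwards [this] with h hh
    simpa using hh
  filter_upwards [hball] with h hh
  have hflow : ∀ r ∈ Icc 0 τ, ‖z r (x + h) - z r x‖ ≤ ‖h‖ * M := by
    intro r hr
    refine (norm_flow_sub_le hG hL hz0 hz hr _ _).trans ?_
    rw [add_sub_cancel_left]
    have := hr.2
    rw [hM]
    gcongr
  have hd : ∀ r ∈ Icc 0 τ, HasDerivWithinAt (fun r => z r (x + h) - z r x - Y r h)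
      (G r (z r (x + h)) - G r (z r x) - A r (z r x) (Y r h)) (Icc 0 τ) r := fun r hr =>
    ((hz _ r hr).sub (hz x r hr)).sub ((hY r hr).clm_apply (hasDerivWithinAt_const r _ h) |>.congr_deriv (by simp))
  -- The remainder solves the linearized equation up to the Taylor error of `G`, which is at most ε
  -- times the displacement, because the perturbed trajectory stays in the tube of radius η where
  -- `A` oscillates by at most ε.
  have hb : ∀ r ∈ Ico 0 τ, ‖G r (z r (x + h)) - G r (z r x) - A r (z r x) (Y r h)‖
      ≤ L * ‖z r (x + h) - z r x - Y r h‖ + (ε * M) * ‖h‖ := by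
    intro r hr
    have hr' : r ∈ Icc 0 τ := ⟨hr.1, hr.2.le⟩
    have h1 : ‖G r (z r (x + h)) - G r (z r x) - A r (z r x) (z r (x + h) - z r x)‖
        ≤ ε * ‖z r (x + h) - z r x‖ := by
      refine (convex_ball (z r x) η).norm_image_sub_le_of_norm_hasFDerivWithin_le'
        (f' := fun w => A r w) (fun w _ => (hG r hr' w).hasFDerivWithinAt) (fun w hw => ?_) ?_ ?_
      · exact hηA r hr' w (by simpa [dist_eq_norm] using hw)
      · exact Metric.mem_ball_self hη
      · rw [Metric.mem_ball, dist_eq_norm]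
        exact (hflow r hr').trans_lt ((lt_div_iff₀ hM1).1 hh)
    have e : G r (z r (x + h)) - G r (z r x) - A r (z r x) (Y r h)
        = (G r (z r (x + h)) - G r (z r x) - A r (z r x) (z r (x + h) - z r x))
          + A r (z r x) (z r (x + h) - z r x - Y r h) := by
      simp only [map_sub]; abel
    rw [e]
    refine (norm_add_le _ _).trans ?_
    have h2 : ‖A r (z r x) (z r (x + h) - z r x - Y r h)‖ ≤ L * ‖z r (x + h) - z r x - Y r h‖ :=
      ((A r (z r x)).le_opNorm _).trans (by gcongr; exact hL r hr' _)
    have h3 : ε * ‖z r (x + h) - z r x‖ ≤ ε * (‖h‖ * M) := by gcongr; exact hflow r hr'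
    nlinarith
  have hmain := norm_le_gronwallBound_of_norm_deriv_right_le (δ := 0) (K := L)
    (ε := (ε * M) * ‖h‖) (fun r hr => (hd r hr).continuousWithinAt)
    (fun r hr => hasDerivWithinAt_Ici_of_Icc hr (hd r ⟨hr.1, hr.2.le⟩))
    (by simp [hz0, hY0]) hb s hs
  rw [sub_zero] at hmain
  refine hmain.trans ?_
  -- Linearity of the bound in the forcing turns it into c‖h‖.
  have hscale : gronwallBound 0 L (ε * M * ‖h‖) s = gronwallBound 0 L (ε * M) s * ‖h‖ := by
    by_cases hL' : L = 0
    · simp only [hL', gronwallBound_K0]; ring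
    · simp only [gronwallBound_of_K_ne_0 hL']; ring
  rw [hscale]
  gcongr

end Flow

/-! ### Taylor and Grönwall formulas running backwards from the final time. -/

/-- Second order Taylor formula, based at the right end point. -/
lemma taylor_backward {F : Type*} [NormedAddCommGroup F] [NormedSpace ℝ F] [CompleteSpace F]
    {q u b : ℝ → F} {s t : ℝ} (hst : s ≤ t)
    (hq : ∀ r ∈ Icc s t, HasDerivWithinAt q (u r) (Icc s t) r)
    (hu : ∀ r ∈ Icc s t, HasDerivWithinAt u (b r) (Icc s t) r) (hb : ContinuousOn b (Icc s t)) :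
    q s = q t - (t - s) • u t + ∫ r in s..t, (r - s) • b r := by
  -- An explicit antiderivative replaces the integration by parts.
  have hd : ∀ r ∈ Icc s t, HasDerivWithinAt (fun r => (r - s) • u r - q r) ((r - s) • b r)
      (Icc s t) r := by
    intro r hr
    have h1 : HasDerivWithinAt (fun r : ℝ => r - s) 1 (Icc s t) r :=
      (hasDerivWithinAt_id r _).sub_const s
    have := (h1.smul (hu r hr)).sub (hq r hr)
    refine this.congr_deriv ?_
    simp
  have hcont : ContinuousOn (fun r => (r - s) • b r) (Icc s t) :=
    (continuousOn_id.sub continuousOn_const).smul hb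
  have := intervalIntegral.integral_eq_sub_of_hasDeriv_right_of_le hst
    (fun r hr => (hd r hr).continuousWithinAt)
    (fun r hr => (hasDerivWithinAt_Ici_of_Icc ⟨hr.1.le, hr.2⟩ (hd r ⟨hr.1.le, hr.2.le⟩)).mono
      Ioi_subset_Ici_self)
    (hcont.intervalIntegrable_of_Icc hst)
  rw [this, sub_self, zero_smul]
  abel

lemma velocity_backward {F : Type*} [NormedAddCommGroup F] [NormedSpace ℝ F] [CompleteSpace F]
    {u b : ℝ → F} {s t : ℝ} (hst : s ≤ t)
    (hu : ∀ r ∈ Icc s t, HasDerivWithinAt u (b r) (Icc s t) r) (hb : ContinuousOn b (Icc s t)) :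
    u s = u t - ∫ r in s..t, b r := by
  rw [intervalIntegral.integral_eq_sub_of_hasDeriv_right_of_le hst
    (fun r hr => (hu r hr).continuousWithinAt)
    (fun r hr => (hasDerivWithinAt_Ici_of_Icc ⟨hr.1.le, hr.2⟩ (hu r ⟨hr.1.le, hr.2.le⟩)).mono
      Ioi_subset_Ici_self)
    (hb.intervalIntegrable_of_Icc hst)]
  simp

/-- Grönwall's inequality in integral form, backwards in time. -/
lemma gronwall_backward {Q k : ℝ → ℝ} {s t c : ℝ} (hst : s ≤ t) (hQ : ContinuousOn Q (Icc s t))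
    (hk : ContinuousOn k (Icc s t)) (hk0 : ∀ r ∈ Icc s t, 0 ≤ k r)
    (h : ∀ s' ∈ Icc s t, Q s' ≤ c + ∫ r in s'..t, k r * Q r) :
    Q s ≤ c * Real.exp (∫ r in s..t, k r) := by
  have hkQ : ContinuousOn (fun r => k r * Q r) (Icc s t) := hk.mul hQ
  have hI : ∀ g : ℝ → ℝ, ContinuousOn g (Icc s t) → ∀ r ∈ Icc s t,
      HasDerivWithinAt (fun r => ∫ y in r..t, g y) (-g r) (Icc s t) r := by
    intro g hg r hr
    have hgi : IntervalIntegrable g volume s t := hg.intervalIntegrable_of_Icc hst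
    have hint : IntervalIntegrable g volume r t := by
      refine hgi.mono_set ?_
      rw [uIcc_of_le hst, uIcc_of_le hr.2]; exact Icc_subset_Icc_left hr.1
    have : Fact (r ∈ Icc s t) := ⟨hr⟩
    exact intervalIntegral.integral_hasDerivWithinAt_left hint
      (hg.stronglyMeasurableAtFilter_nhdsWithin measurableSet_Icc r) (hg r hr)
  set R : ℝ → ℝ := fun r => (c + ∫ y in r..t, k y * Q y) * Real.exp (-∫ y in r..t, k y)
  have hR : ∀ r ∈ Icc s t, HasDerivWithinAt R
      ((-(k r * Q r)) * Real.exp (-∫ y in r..t, k y)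
        + (c + ∫ y in r..t, k y * Q y) * (Real.exp (-∫ y in r..t, k y) * (- -k r))) (Icc s t) r :=
    fun r hr => ((hI _ hkQ r hr).const_add c).mul ((hI _ hk r hr).neg.exp)
  -- The derivative of `R` is k times (c + ∫ k Q - Q) times an exponential, which is nonnegative by
  -- hypothesis. Comparing the values at s and t gives the claim.
  have hmono : MonotoneOn R (Icc s t) := by
    refine monotoneOn_of_hasDerivWithinAt_nonneg (convex_Icc s t)
      (fun r hr => (hR r hr).continuousWithinAt)
      (fun r hr => (hR r (interior_subset hr)).mono interior_subset) (fun r hr => ?_)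
    have hr' := interior_subset hr
    have h1 := h r hr'
    have h2 := mul_nonneg (hk0 r hr') (sub_nonneg.2 h1)
    have := mul_nonneg h2 (Real.exp_pos (-∫ y in r..t, k y)).le
    linarith
  have h1 := hmono ⟨le_rfl, hst⟩ ⟨hst, le_rfl⟩ hst
  simp only [R, intervalIntegral.integral_same, add_zero, neg_zero, Real.exp_zero, mul_one] at h1
  have h2 := h s ⟨le_rfl, hst⟩
  rw [Real.exp_neg, ← div_eq_mul_inv, div_le_iff₀ (Real.exp_pos _)] at h1
  exact h2.trans h1

end FastCharge

namespace FastCharge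

/-! ### Convolutions with a singular kernel: continuity, weighted bounds, differentiation. -/

section Convolution

variable {F : Type*} [NormedAddCommGroup F] [NormedSpace ℝ F]

/-- A function whose increments are line integrals of a continuous field is differentiable. -/
lemma hasFDerivAt_of_increment [CompleteSpace F] {f : E3 → F} {k : E3 → E3 →L[ℝ] F} (hk : Continuous k)
    (x : E3) (h : ∀ u, f (x + u) - f x = ∫ θ in (0 : ℝ)..1, k (x + θ • u) u) :
    HasFDerivAt f (k x) x := by
  rw [hasFDerivAt_iff_isLittleO_nhds_zero, Asymptotics.isLittleO_iff]
  intro c hc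
  obtain ⟨η, hη, hb⟩ := Metric.continuousAt_iff.1 (hk.continuousAt (x := x)) c hc
  filter_upwards [Metric.ball_mem_nhds (0 : E3) hη] with u hu
  have hu' : ‖u‖ < η := by simpa using hu
  have hci : ∀ w : E3, IntervalIntegrable (fun θ : ℝ => k (x + θ • w) w) volume 0 1 := fun w =>
    (Continuous.clm_apply (hk.comp (by fun_prop)) continuous_const).intervalIntegrable 0 1
  have e : f (x + u) - f x - k x u = ∫ θ in (0 : ℝ)..1, (k (x + θ • u) - k x) u := by
    rw [h u]
    simp only [_root_.sub_apply]
    rw [intervalIntegral.integral_sub (hci u) intervalIntegrable_const]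
    simp
  rw [e]
  have := intervalIntegral.norm_integral_le_of_norm_le_const (a := (0 : ℝ)) (b := 1)
    (f := fun θ : ℝ => (k (x + θ • u) - k x) u) (C := c * ‖u‖) (fun θ hθ => by
      rw [uIoc_of_le zero_le_one] at hθ
      refine (ContinuousLinearMap.le_opNorm _ _).trans ?_
      gcongr
      rw [← dist_eq_norm]
      refine (hb ?_).le
      rw [dist_eq_norm, add_sub_cancel_left, norm_smul, Real.norm_of_nonneg hθ.1.le]
      exact (mul_le_of_le_one_left (norm_nonneg _) hθ.2).trans_lt hu')
  simpa using this

lemma integrable_bilin_conv {H A : Type*} [NormedAddCommGroup H] [NormedSpace ℝ H]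
    [NormedAddCommGroup A] [NormedSpace ℝ A] (B : A →L[ℝ] F →L[ℝ] H) {κ : E3 → A}
    (hκ : Integrable κ) {g : E3 → F} (hg : Continuous g) {M : ℝ} (hM : ∀ x, ‖g x‖ ≤ M) (x : E3) :
    Integrable fun z => B (κ z) (g (x - z)) := by
  refine ((hκ.norm.const_mul ‖B‖).mul_const M).mono' ?_ (Filter.Eventually.of_forall fun z => ?_)
  · exact B.aestronglyMeasurable_comp₂ hκ.1
      (hg.comp (continuous_const.sub continuous_id)).aestronglyMeasurable
  · exact (B.le_opNorm₂ _ _).trans (by gcongr; exact hM _)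

/-- Joint continuity of a convolution depending on a parameter. -/
lemma continuousOn_bilin_conv {H A : Type*} [NormedAddCommGroup H] [NormedSpace ℝ H]
    [NormedAddCommGroup A] [NormedSpace ℝ A] (B : A →L[ℝ] F →L[ℝ] H) {κ : E3 → A}
    (hκ : Integrable κ) {S : Set ℝ} {g : ℝ → E3 → F}
    (hg : ContinuousOn (fun p : ℝ × E3 => g p.1 p.2) (S ×ˢ univ)) {M : ℝ}
    (hM : ∀ t ∈ S, ∀ x, ‖g t x‖ ≤ M) :
    ContinuousOn (fun p : ℝ × E3 => ∫ z, B (κ z) (g p.1 (p.2 - z))) (S ×ˢ univ) := by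
  have hgt : ∀ t ∈ S, Continuous (g t) := fun t ht =>
    hg.comp_continuous (f := fun x : E3 => (t, x)) (by fun_prop) (fun x => ⟨ht, mem_univ _⟩)
  refine continuousOn_of_dominated (bound := fun z => ‖B‖ * ‖κ z‖ * M)
    (fun p hp => (integrable_bilin_conv B hκ (hgt p.1 hp.1) (hM p.1 hp.1) p.2).1)
    (fun p hp => Filter.Eventually.of_forall fun z => ?_) ((hκ.norm.const_mul ‖B‖).mul_const M)
    (Filter.Eventually.of_forall fun z => ?_)
  · exact (B.le_opNorm₂ _ _).trans (by gcongr; exact hM _ hp.1 _)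
  · exact (B (κ z)).continuous.comp_continuousOn (hg.comp (f := fun p : ℝ × E3 => (p.1, p.2 - z))
      (by fun_prop) (fun p hp => ⟨hp.1, mem_univ _⟩))

/-- Weighted bound for a convolution, for weights that vary polynomially. -/
lemma norm_bilin_conv_le {H A : Type*} [NormedAddCommGroup H] [NormedSpace ℝ H]
    [NormedAddCommGroup A] [NormedSpace ℝ A] (B : A →L[ℝ] F →L[ℝ] H) {κ : E3 → A}
    {g : E3 → F} {w : E3 → ℝ} {k : E3 → ℝ} (hk : Integrable k) {D : ℝ}
    (hw : ∀ x, 0 < w x) (hg : ∀ x, ‖g x‖ ≤ D / w x)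
    (hkw : ∀ᵐ z, ∀ x, ‖κ z‖ / w (x - z) ≤ k z / w x) (x : E3) :
    ‖∫ z, B (κ z) (g (x - z))‖ ≤ ‖B‖ * D / w x * ∫ z, k z := by
  have hD : 0 ≤ D := by
    have := (norm_nonneg _).trans (hg 0)
    by_contra hneg
    exact absurd this (not_le.2 (div_neg_of_neg_of_pos (not_le.1 hneg) (hw 0)))
  rw [← integral_const_mul]
  refine norm_integral_le_of_norm_le (hk.const_mul _) ?_
  filter_upwards [hkw] with z hz
  calc ‖B (κ z) (g (x - z))‖ ≤ ‖B‖ * ‖κ z‖ * ‖g (x - z)‖ := B.le_opNorm₂ _ _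
    _ ≤ ‖B‖ * ‖κ z‖ * (D / w (x - z)) := by gcongr; exact hg _
    _ = ‖B‖ * D * (‖κ z‖ / w (x - z)) := by ring
    _ ≤ ‖B‖ * D * (k z / w x) := mul_le_mul_of_nonneg_left (hz x) (by positivity)
    _ = ‖B‖ * D / w x * k z := by ring

/-- The exceptional y lie on a line, a proper affine subspace and hence a null set. For all other y
the fundamental theorem of calculus applies to a kernel that is smooth only off the origin. -/
lemma ae_segment_ne_zero (x u : E3) : ∀ᵐ y : E3, ∀ θ : ℝ, x + θ • u - y ≠ 0 := by
  have h0 : volume ((AffineSubspace.mk' x (Submodule.span ℝ {u}) : AffineSubspace ℝ E3) : Set E3)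
      = 0 := by
    refine Measure.addHaar_affineSubspace _ _ fun h => ?_
    have h1 := congrArg AffineSubspace.direction h
    rw [AffineSubspace.direction_mk', AffineSubspace.direction_top] at h1
    have h2 : Module.finrank ℝ (Submodule.span ℝ {u}) ≤ 1 := by
      simpa using finrank_span_le_card (R := ℝ) ({u} : Set E3)
    rw [h1, finrank_top] at h2
    simp at h2
  rw [measure_eq_zero_iff_ae_notMem] at h0
  filter_upwards [h0] with y hy θ hθ
  refine hy ?_
  rw [sub_eq_zero] at hθ
  rw [← hθ, SetLike.mem_coe, AffineSubspace.mem_mk']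
  simpa using Submodule.smul_mem _ θ (Submodule.mem_span_singleton_self u)

/-- Differentiation of a convolution whose kernel is differentiable off the origin with integrable
derivative, and whose other factor is only bounded and continuous. -/
theorem hasFDerivAt_conv [CompleteSpace F] {φ : E3 → ℝ} (hφ : ContDiffOn ℝ 1 φ {0}ᶜ) (hi : Integrable φ)
    (hi' : Integrable (fderiv ℝ φ)) {g : E3 → F} (hg : Continuous g) {M : ℝ}
    (hM : ∀ x, ‖g x‖ ≤ M) (x : E3) :
    HasFDerivAt (fun x => ∫ z, φ z • g (x - z))
      (∫ z, (fderiv ℝ φ z).smulRight (g (x - z))) x := by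
  set B := ContinuousLinearMap.smulRightL ℝ E3 F
  set B' := (ContinuousLinearMap.lsmul ℝ ℝ : ℝ →L[ℝ] F →L[ℝ] F)
  have hk : Continuous fun x => ∫ z, B (fderiv ℝ φ z) (g (x - z)) := by
    have := (continuousOn_bilin_conv B hi' (S := univ) (g := fun _ => g)
      (hg.comp continuous_snd).continuousOn (fun _ _ => hM)).comp_continuous
      (f := fun x : E3 => ((0 : ℝ), x)) (by fun_prop) (fun _ => by simp)
    exact this
  refine hasFDerivAt_of_increment hk x fun u => ?_
  -- The change of variables lets the increment fall on the kernel, since the other factor need not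
  -- be differentiable.
  have hshift : ∀ w : E3, (∫ z, φ z • g (w - z)) = ∫ y, φ (w - y) • g y := by
    intro w
    rw [← integral_sub_left_eq_self (fun z => φ z • g (w - z)) volume w]
    simp
  have hshift' : ∀ w : E3, (∫ z, B (fderiv ℝ φ z) (g (w - z))) u
      = ∫ y, fderiv ℝ φ (w - y) u • g y := by
    intro w
    rw [ContinuousLinearMap.integral_apply (integrable_bilin_conv B hi' hg hM w),
      ← integral_sub_left_eq_self _ volume w]
    simp [B]
  have hint : ∀ w : E3, Integrable fun y => φ (w - y) • g y := by
    intro w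
    have := (integrable_bilin_conv B' hi hg hM w).comp_sub_left w
    simpa [B'] using this
  simp only [hshift, hshift']
  rw [← integral_sub (hint _) (hint _), intervalIntegral_integral_swap]
  · refine integral_congr_ae ?_
    filter_upwards [ae_segment_ne_zero x u] with y hy
    have hd : ∀ θ : ℝ, HasDerivAt (fun θ : ℝ => φ (x + θ • u - y))
        (fderiv ℝ φ (x + θ • u - y) u) θ := by
      intro θ
      have h1 : HasFDerivAt φ (fderiv ℝ φ (x + θ • u - y)) (x + θ • u - y) :=
        ((hφ.contDiffAt (isOpen_compl_singleton.mem_nhds (hy θ))).differentiableAt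
          one_ne_zero).hasFDerivAt
      have h2 : HasDerivAt (fun θ : ℝ => x + θ • u - y) u θ := by
        simpa using (((hasDerivAt_id θ).smul_const u).const_add x).sub_const y
      exact h1.comp_hasDerivAt θ h2
    have hc : Continuous fun θ : ℝ => fderiv ℝ φ (x + θ • u - y) u := by
      refine Continuous.clm_apply ?_ continuous_const
      exact (hφ.continuousOn_fderiv_of_isOpen isOpen_compl_singleton le_rfl).comp_continuous
        (by fun_prop) hy
    rw [intervalIntegral.integral_smul_const,
      intervalIntegral.integral_eq_sub_of_hasDerivAt (fun θ _ => hd θ) (hc.intervalIntegrable _ _)]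
    simp [sub_smul]
  · have hmeas : AEStronglyMeasurable
        (Function.uncurry fun (θ : ℝ) (y : E3) => fderiv ℝ φ (x + θ • u - y) u • g y)
        ((volume.restrict (uIoc (0 : ℝ) 1)).prod volume) := by
      refine AEStronglyMeasurable.smul ?_ (hg.comp continuous_snd).aestronglyMeasurable
      have h1 : Measurable fun p : ℝ × E3 => fderiv ℝ φ (x + p.1 • u - p.2) u :=
        ((measurable_fderiv ℝ φ).comp (by fun_prop : Measurable fun p : ℝ × E3 =>
          x + p.1 • u - p.2)).apply_continuousLinearMap u
      exact h1.aestronglyMeasurable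
    have hslice : ∀ θ : ℝ, Integrable fun y => fderiv ℝ φ (x + θ • u - y) u • g y := by
      intro θ
      have := ((integrable_bilin_conv B hi' hg hM (x + θ • u)).comp_sub_left
        (x + θ • u)).apply_continuousLinearMap u
      simpa [B] using this
    refine (integrable_prod_iff hmeas).2 ⟨Filter.Eventually.of_forall hslice, ?_⟩
    have hfin : IsFiniteMeasure (volume.restrict (uIoc (0 : ℝ) 1)) := by
      rw [uIoc_of_le zero_le_one]; infer_instance
    refine Integrable.of_bound hmeas.norm.integral_prod_right' ((∫ z, ‖fderiv ℝ φ z‖) * ‖u‖ * M)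
      (Filter.Eventually.of_forall fun θ => ?_)
    rw [Real.norm_of_nonneg (integral_nonneg fun _ => norm_nonneg _)]
    have : (∫ z, ‖fderiv ℝ φ z‖) = ∫ y, ‖fderiv ℝ φ (x + θ • u - y)‖ :=
      (integral_sub_left_eq_self (fun z => ‖fderiv ℝ φ z‖) volume (x + θ • u)).symm
    rw [this, ← integral_mul_const, ← integral_mul_const]
    refine integral_mono (hslice θ).norm
      (((hi'.norm.comp_sub_left (x + θ • u)).mul_const _).mul_const _) fun y => ?_
    simp only [Function.uncurry]
    rw [norm_smul]
    have h3 := (fderiv ℝ φ (x + θ • u - y)).le_opNorm u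
    exact mul_le_mul h3 (hM y) (norm_nonneg _) (by positivity)

end Convolution

/-! ### The screened Coulomb kernel and its weighted integrability. -/

section Kernel

/-- A radial majorant for the screened Coulomb potential and its derivative, including a cubic
weight. -/
noncomputable def kernelMajorant (r : ℝ) : ℝ := (1 + r) ^ 4 * Real.exp (-r) / r ^ 2

lemma integrable_kernelMajorant : Integrable fun z : E3 => kernelMajorant ‖z‖ := by
  rw [integrable_fun_norm_addHaar]
  have h1 : IntegrableOn (fun r : ℝ => 384 * Real.exp (1 / 2) * Real.exp (-(1 / 2) * r)) (Ioi 0) :=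
    (exp_neg_integrableOn_Ioi 0 (by norm_num : (0 : ℝ) < 1 / 2)).const_mul _
  refine Integrable.mono' h1 ?_ ?_
  · refine Measurable.aestronglyMeasurable ?_
    unfold kernelMajorant
    fun_prop
  · refine (ae_restrict_iff' measurableSet_Ioi).2 (Filter.Eventually.of_forall fun r hr => ?_)
    have hr : 0 < r := hr
    -- In polar coordinates the factor r^2 cancels the singularity. The constant 384 is 4! times
    -- 2^4, from this inequality at (1+r)/2.
    have h2 := Real.pow_div_factorial_le_exp ((1 + r) / 2) (by positivity) 4
    have h3 : (1 + r) ^ 4 ≤ 384 * Real.exp ((1 + r) / 2) := by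
      norm_num [Nat.factorial] at h2
      rw [div_le_iff₀ (by norm_num)] at h2
      have : ((1 + r) / 2) ^ 4 = (1 + r) ^ 4 / 16 := by ring
      linarith
    have h4 : r ^ (Module.finrank ℝ E3 - 1) • kernelMajorant r = (1 + r) ^ 4 * Real.exp (-r) := by
      simp only [kernelMajorant, finrank_euclideanSpace_fin, smul_eq_mul]
      field_simp
    rw [h4, Real.norm_of_nonneg (by positivity)]
    calc (1 + r) ^ 4 * Real.exp (-r) ≤ 384 * Real.exp ((1 + r) / 2) * Real.exp (-r) := by gcongr
      _ = 384 * Real.exp (1 / 2) * Real.exp (-(1 / 2) * r) := by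
        rw [mul_assoc, mul_assoc, ← Real.exp_add, ← Real.exp_add]; ring_nf

lemma contDiffOn_screenedCoulomb : ContDiffOn ℝ 1 screenedCoulomb {0}ᶜ := by
  intro z hz
  have hz' : ‖z‖ ≠ 0 := norm_ne_zero_iff.2 hz
  have hn : ContDiffAt ℝ 1 (fun z : E3 => ‖z‖) z := contDiffAt_norm ℝ hz
  refine ContDiffAt.contDiffWithinAt ?_
  unfold screenedCoulomb
  exact (hn.neg.exp).div (contDiffAt_const.mul hn) (by simp [hz', Real.pi_ne_zero])

/-- Three of the four powers of 1+r in the majorant carry the cubic weight. The fourth compares the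
singularity 1/r with 1/r^2 here, and is the factor 1+r produced by differentiation in the next
estimate. -/
lemma abs_screenedCoulomb_le (z : E3) :
    (1 + ‖z‖) ^ 3 * ‖screenedCoulomb z‖ ≤ kernelMajorant ‖z‖ := by
  rcases eq_or_ne z 0 with rfl | hz
  · simp [screenedCoulomb, kernelMajorant]
  have hz' : 0 < ‖z‖ := norm_pos_iff.2 hz
  rw [screenedCoulomb, kernelMajorant, Real.norm_of_nonneg (by positivity), ← mul_div_assoc,
    div_le_div_iff₀ (by positivity) (by positivity)]
  have hpi : (1 : ℝ) ≤ 4 * Real.pi := by linarith [Real.pi_gt_three]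
  have h1 : ‖z‖ ≤ (1 + ‖z‖) * (4 * Real.pi) := by nlinarith
  calc (1 + ‖z‖) ^ 3 * Real.exp (-‖z‖) * ‖z‖ ^ 2
      = (1 + ‖z‖) ^ 3 * Real.exp (-‖z‖) * ‖z‖ * ‖z‖ := by ring
    _ ≤ (1 + ‖z‖) ^ 3 * Real.exp (-‖z‖) * ‖z‖ * ((1 + ‖z‖) * (4 * Real.pi)) := by gcongr
    _ = _ := by ring

lemma norm_fderiv_screenedCoulomb_le {z : E3} (hz : z ≠ 0) :
    (1 + ‖z‖) ^ 3 * ‖fderiv ℝ screenedCoulomb z‖ ≤ kernelMajorant ‖z‖ := by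
  have hz' : 0 < ‖z‖ := norm_pos_iff.2 hz
  have hdn : DifferentiableAt ℝ (fun z : E3 => ‖z‖) z :=
    (contDiffAt_norm (n := 1) ℝ hz).differentiableAt one_ne_zero
  have hd : HasDerivAt (fun r : ℝ => Real.exp (-r) / (4 * Real.pi * r))
      ((Real.exp (-‖z‖) * (-1) * (4 * Real.pi * ‖z‖) - Real.exp (-‖z‖) * (4 * Real.pi * 1))
        / (4 * Real.pi * ‖z‖) ^ 2) ‖z‖ :=
    ((hasDerivAt_neg ‖z‖).exp).div ((hasDerivAt_id ‖z‖).const_mul _) (by positivity)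
  have hf := hd.comp_hasFDerivAt z hdn.hasFDerivAt
  have he : fderiv ℝ screenedCoulomb z = _ := hf.fderiv
  rw [he, norm_smul, norm_fderiv_norm hdn, mul_one]
  have e : (Real.exp (-‖z‖) * (-1) * (4 * Real.pi * ‖z‖) - Real.exp (-‖z‖) * (4 * Real.pi * 1))
        / (4 * Real.pi * ‖z‖) ^ 2 = -((1 + ‖z‖) * Real.exp (-‖z‖) / (4 * Real.pi * ‖z‖ ^ 2)) := by
    field_simp; ring
  rw [e, norm_neg, Real.norm_of_nonneg (by positivity), kernelMajorant, ← mul_div_assoc]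
  have hpi : (1 : ℝ) ≤ 4 * Real.pi := by linarith [Real.pi_gt_three]
  calc (1 + ‖z‖) ^ 3 * ((1 + ‖z‖) * Real.exp (-‖z‖)) / (4 * Real.pi * ‖z‖ ^ 2)
      ≤ (1 + ‖z‖) ^ 3 * ((1 + ‖z‖) * Real.exp (-‖z‖)) / (1 * ‖z‖ ^ 2) := by gcongr
    _ = _ := by ring

lemma integrable_screenedCoulomb : Integrable screenedCoulomb := by
  refine integrable_kernelMajorant.mono' ?_ (Filter.Eventually.of_forall fun z => ?_)
  · unfold screenedCoulomb
    exact Measurable.aestronglyMeasurable (by fun_prop)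
  · refine le_trans ?_ (abs_screenedCoulomb_le z)
    exact le_mul_of_one_le_left (norm_nonneg _) (one_le_pow₀ (by linarith [norm_nonneg z]))

lemma integrable_fderiv_screenedCoulomb : Integrable (fderiv ℝ screenedCoulomb) := by
  refine integrable_kernelMajorant.mono' (measurable_fderiv ℝ _).aestronglyMeasurable ?_
  filter_upwards [Measure.ae_ne volume (0 : E3)] with z hz
  refine le_trans ?_ (norm_fderiv_screenedCoulomb_le hz)
  exact le_mul_of_one_le_left (norm_nonneg _) (one_le_pow₀ (by linarith [norm_nonneg z]))

end Kernel

end FastCharge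

namespace FastCharge

/-! ### Longitudinal and transversal components. -/

section Coordinates

lemma perpNorm_nonneg (x : E3) : 0 ≤ perpNorm x := Real.sqrt_nonneg _

lemma perpNorm_eq_norm (x : E3) : perpNorm x = ‖(!₂[x 1, x 2] : EuclideanSpace ℝ (Fin 2))‖ := by
  simp [perpNorm, EuclideanSpace.norm_eq, Fin.sum_univ_two]

lemma perpNorm_add_le (x y : E3) : perpNorm (x + y) ≤ perpNorm x + perpNorm y := by
  simp only [perpNorm_eq_norm]
  have e : (!₂[(x + y) 1, (x + y) 2] : EuclideanSpace ℝ (Fin 2)) = !₂[x 1, x 2] + !₂[y 1, y 2] := by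
    ext i; fin_cases i <;> simp
  rw [e]
  exact norm_add_le _ _

lemma perpNorm_smul (c : ℝ) (x : E3) : perpNorm (c • x) = |c| * perpNorm x := by
  simp only [perpNorm_eq_norm]
  have e : (!₂[(c • x) 1, (c • x) 2] : EuclideanSpace ℝ (Fin 2)) = c • !₂[x 1, x 2] := by
    ext i; fin_cases i <;> simp
  rw [e, norm_smul, Real.norm_eq_abs]

lemma perpNorm_le_norm (x : E3) : perpNorm x ≤ ‖x‖ := by
  rw [perpNorm, EuclideanSpace.norm_eq]
  refine Real.sqrt_le_sqrt ?_
  simp only [Fin.sum_univ_three, Real.norm_eq_abs, sq_abs]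
  nlinarith [sq_nonneg (x 0)]

lemma abs_coord_le_norm (x : E3) (i : Fin 3) : |x i| ≤ ‖x‖ := by
  simpa using PiLp.norm_apply_le x i

lemma HasDerivWithinAt.coord {f : ℝ → E3} {f' : E3} {S : Set ℝ} {r : ℝ}
    (h : HasDerivWithinAt f f' S r) (i : Fin 3) :
    HasDerivWithinAt (fun r => f r i) (f' i) S r :=
  (EuclideanSpace.proj (𝕜 := ℝ) i).hasFDerivAt.comp_hasDerivWithinAt r h

end Coordinates

/-! ### The extended trajectory, the passage time, and slow variation of the weight. -/

section PassageTime

variable {T Vmin : ℝ} {X V : ℝ → E3}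

/-- This case-free form, the true motion at the clamped time plus two uniform motions, lets growth
be estimated summand by summand. -/
lemma extendedFirst_eq (hT : 0 ≤ T) (s : ℝ) :
    extendedFirst T X V s
      = X (max 0 (min s T)) 0 + min s 0 * V 0 0 + max (s - T) 0 * V T 0 := by
  unfold extendedFirst
  split_ifs with h1 h2
  · rw [min_eq_left (h1.le.trans hT), max_eq_left h1.le, min_eq_left h1.le,
      max_eq_right (by linarith)]
    ring
  · rw [min_eq_left h2, max_eq_right (not_lt.1 h1), min_eq_right (not_lt.1 h1),
      max_eq_right (by linarith)]
    ring
  · rw [min_eq_right (not_le.1 h2).le, max_eq_right hT, min_eq_right (not_lt.1 h1),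
      max_eq_left (by linarith [not_le.1 h2])]
    ring

lemma extendedFirst_of_mem {s : ℝ} (hs : s ∈ Icc 0 T) : extendedFirst T X V s = X s 0 := by
  rw [extendedFirst, if_neg (not_lt.2 hs.1), if_pos hs.2]

lemma first_growth (hX : ∀ t ∈ Icc 0 T, HasDerivWithinAt X (V t) (Icc 0 T) t) {c a b : ℝ}
    (ha : 0 ≤ a) (hab : a ≤ b) (hb : b ≤ T) (hc : ∀ r ∈ Icc a b, c ≤ V r 0) :
    c * (b - a) ≤ X b 0 - X a 0 := by
  have hsub : Icc a b ⊆ Icc 0 T := Icc_subset_Icc ha hb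
  have hd : ∀ r ∈ Icc a b, HasDerivWithinAt (fun r => X r 0 - c * r) (V r 0 - c * 1) (Icc a b) r :=
    fun r hr => ((HasDerivWithinAt.coord (hX r (hsub hr)) 0).mono hsub).sub
      ((hasDerivWithinAt_id r _).const_mul c)
  have := monotoneOn_of_hasDerivWithinAt_nonneg (convex_Icc a b)
    (fun r hr => (hd r hr).continuousWithinAt)
    (fun r hr => (hd r (interior_subset hr)).mono interior_subset)
    (fun r hr => by linarith [hc r (interior_subset hr)]) ⟨le_rfl, hab⟩ ⟨hab, le_rfl⟩ hab
  simp only at this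
  linarith

/-- The lower speed c is not fixed to be Vmin and is needed only up to time b: the comparison with
the linearized trajectory uses c = V_1(t)/K. The speed at time 0 enters separately because it
governs negative times, also when b < 0. -/
lemma extendedFirst_growth (hT : 0 ≤ T)
    (hX : ∀ t ∈ Icc 0 T, HasDerivWithinAt X (V t) (Icc 0 T) t) {c a b : ℝ} (hab : a ≤ b)
    (h0 : c ≤ V 0 0) (hc : ∀ r ∈ Icc 0 T, r ≤ b → c ≤ V r 0) :
    c * (b - a) ≤ extendedFirst T X V b - extendedFirst T X V a := by
  rw [extendedFirst_eq hT, extendedFirst_eq hT]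
  have h1 : c * (max 0 (min b T) - max 0 (min a T))
      ≤ X (max 0 (min b T)) 0 - X (max 0 (min a T)) 0 := by
    rcases le_or_gt b 0 with hb | hb
    · rw [max_eq_left ((min_le_left _ _).trans hb),
        max_eq_left ((min_le_left _ _).trans (hab.trans hb))]
      simp
    · refine first_growth hX (le_max_left _ _) (max_le_max le_rfl (min_le_min hab le_rfl))
        (max_le hT (min_le_right _ _)) fun r hr => hc r ⟨(le_max_left _ _).trans hr.1,
          hr.2.trans (max_le hT (min_le_right _ _))⟩ (hr.2.trans (max_le hb.le (min_le_left _ _)))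
  have h2 : c * (min b 0 - min a 0) ≤ (min b 0 - min a 0) * V 0 0 := by
    rw [mul_comm]
    exact mul_le_mul_of_nonneg_left h0 (sub_nonneg.2 (min_le_min hab le_rfl))
  have h3 : c * (max (b - T) 0 - max (a - T) 0) ≤ (max (b - T) 0 - max (a - T) 0) * V T 0 := by
    rcases le_or_gt b T with hb | hb
    · rw [max_eq_right (by linarith), max_eq_right (by linarith)]; simp
    · rw [mul_comm]
      exact mul_le_mul_of_nonneg_left (hc T ⟨hT, le_rfl⟩ hb.le)
        (sub_nonneg.2 (max_le_max (by linarith) le_rfl))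
  have h4 : ∀ s : ℝ, max 0 (min s T) + min s 0 + max (s - T) 0 = s := by
    intro s
    rcases le_or_gt s 0 with h | h
    · rw [min_eq_left (h.trans hT), max_eq_left h, min_eq_left h, max_eq_right (by linarith)]; ring
    · rcases le_or_gt s T with h' | h'
      · rw [min_eq_left h', max_eq_right h.le, min_eq_right h.le, max_eq_right (by linarith)]; ring
      · rw [min_eq_right h'.le, max_eq_right hT, min_eq_right h.le, max_eq_left (by linarith)]; ring
  have h5 := h4 a
  have h6 := h4 b
  have e : c * (b - a) = c * (max 0 (min b T) - max 0 (min a T)) + c * (min b 0 - min a 0)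
      + c * (max (b - T) 0 - max (a - T) 0) := by
    rw [← mul_add, ← mul_add]
    congr 1
    linarith
  rw [e]
  linarith

/-- The standing assumptions on the motion of the charge. -/
structure FastMotion (T Vmin : ℝ) (X V : ℝ → E3) : Prop where
  nonneg : 0 ≤ T
  pos : 0 < Vmin
  deriv : ∀ t ∈ Icc 0 T, HasDerivWithinAt X (V t) (Icc 0 T) t
  le : ∀ t ∈ Icc 0 T, Vmin ≤ V t 0

namespace FastMotion

variable (h : FastMotion T Vmin X V)
include h

lemma growth {a b : ℝ} (hab : a ≤ b) :
    Vmin * (b - a) ≤ extendedFirst T X V b - extendedFirst T X V a :=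
  extendedFirst_growth h.nonneg h.deriv hab (h.le 0 ⟨le_rfl, h.nonneg⟩) fun r hr _ => h.le r hr

lemma bddBelow (r : ℝ) : BddBelow {s : ℝ | r ≤ extendedFirst T X V s} := by
  refine ⟨min 0 ((r - extendedFirst T X V 0) / Vmin), fun s hs => ?_⟩
  have hs : r ≤ extendedFirst T X V s := hs
  rcases le_or_gt 0 s with h0 | h0
  · exact (min_le_left _ _).trans h0
  · refine (min_le_right _ _).trans ?_
    have := h.growth h0.le
    rw [div_le_iff₀ h.pos]
    linarith

lemma nonempty (r : ℝ) : {s : ℝ | r ≤ extendedFirst T X V s}.Nonempty := by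
  refine ⟨|r - extendedFirst T X V 0| / Vmin, ?_⟩
  have h1 : (0 : ℝ) ≤ |r - extendedFirst T X V 0| / Vmin :=
    div_nonneg (abs_nonneg _) h.pos.le
  have := h.growth h1
  rw [sub_zero, mul_div_cancel₀ _ h.pos.ne'] at this
  change r ≤ _
  linarith [le_abs_self (r - extendedFirst T X V 0)]

lemma passageTime_le {r s : ℝ} (hs : r ≤ extendedFirst T X V s) : passageTime T X V r ≤ s :=
  csInf_le (h.bddBelow r) hs

lemma le_passageTime {r B : ℝ} (hB : ∀ s, r ≤ extendedFirst T X V s → B ≤ s) :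
    B ≤ passageTime T X V r :=
  le_csInf (h.nonempty r) hB

/-- The extended trajectory covers the distance |r-r'| within time |r-r'|/Vmin, hence a Lipschitz
bound for the passage time. -/
lemma passageTime_le_add (r r' : ℝ) :
    passageTime T X V r ≤ passageTime T X V r' + |r - r'| / Vmin := by
  rw [← sub_le_iff_le_add]
  refine h.le_passageTime fun s hs => ?_
  rw [sub_le_iff_le_add]
  refine h.passageTime_le ?_
  have h1 : (0 : ℝ) ≤ |r - r'| / Vmin := div_nonneg (abs_nonneg _) h.pos.le
  have := h.growth (le_add_of_nonneg_right h1 : s ≤ s + |r - r'| / Vmin)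
  rw [add_sub_cancel_left, mul_div_cancel₀ _ h.pos.ne'] at this
  linarith [le_abs_self (r - r')]

lemma elapsed_le_add (hV : 1 ≤ Vmin) (t r r' : ℝ) :
    elapsed T X V t r ≤ elapsed T X V t r' + |r - r'| := by
  unfold elapsed
  have h1 := h.passageTime_le_add r' r
  have h2 : |r' - r| / Vmin ≤ |r - r'| := by
    rw [abs_sub_comm]; exact div_le_self (abs_nonneg _) hV
  have h3 := le_max_left (t - passageTime T X V r') 0
  have h4 := le_max_right (t - passageTime T X V r') 0
  refine max_le ?_ ?_
  · linarith
  · linarith [abs_nonneg (r - r')]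

end FastMotion

lemma ahead_nonneg (t r : ℝ) : 0 ≤ ahead X t r := le_max_right _ _

lemma elapsed_nonneg (t r : ℝ) : 0 ≤ elapsed T X V t r := le_max_right _ _

lemma ahead_le_add (t r r' : ℝ) : ahead X t r ≤ ahead X t r' + |r - r'| := by
  unfold ahead
  have h3 := le_max_left (r' - X t 0) 0
  have h4 := le_max_right (r' - X t 0) 0
  refine max_le ?_ ?_
  · linarith [le_abs_self (r - r')]
  · linarith [abs_nonneg (r - r')]

lemma one_le_weight (k : ℕ) (t : ℝ) (x : E3) : 1 ≤ weight k T X V t x := by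
  unfold weight
  have h1 := pow_nonneg (perpNorm_nonneg x) k
  have h2 := pow_nonneg (ahead_nonneg (X := X) t (x 0)) k
  have h3 := pow_nonneg (elapsed_nonneg (T := T) (X := X) (V := V) t (x 0)) k
  linarith

lemma weight_pos (k : ℕ) (t : ℝ) (x : E3) : 0 < weight k T X V t x :=
  zero_lt_one.trans_le (one_le_weight k t x)

lemma add_cube_le {b c z : ℝ} (hb : 0 ≤ b) (hc : 0 ≤ c) (hz : 0 ≤ z) (h : b ≤ c + z) :
    b ^ 3 ≤ 4 * c ^ 3 + 4 * z ^ 3 := by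
  have h1 : b ^ 3 ≤ (c + z) ^ 3 := by gcongr
  nlinarith [mul_nonneg (add_nonneg hc hz) (sq_nonneg (c - z))]

/-- The cubic weight varies polynomially. -/
lemma FastMotion.weight_shift (h : FastMotion T Vmin X V) (hV : 1 ≤ Vmin) (t : ℝ) (x z : E3) :
    weight 3 T X V t x ≤ 16 * (1 + ‖z‖) ^ 3 * weight 3 T X V t (x - z) := by
  have hz := norm_nonneg z
  have hp : perpNorm x ≤ perpNorm (x - z) + ‖z‖ := by
    have := perpNorm_add_le (x - z) z
    rw [sub_add_cancel] at this
    linarith [perpNorm_le_norm z]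
  have hx0 : |x 0 - (x - z) 0| ≤ ‖z‖ := by
    have : x 0 - (x - z) 0 = z 0 := by simp
    rw [this]; exact abs_coord_le_norm z 0
  have ha := ahead_le_add (X := X) t (x 0) ((x - z) 0)
  have he := h.elapsed_le_add hV t (x 0) ((x - z) 0)
  have h1 := add_cube_le (perpNorm_nonneg x) (perpNorm_nonneg (x - z)) hz hp
  have h2 := add_cube_le (ahead_nonneg (X := X) t (x 0)) (ahead_nonneg (X := X) t ((x - z) 0)) hz
    (by linarith)
  have h3 := add_cube_le (elapsed_nonneg (T := T) (X := X) (V := V) t (x 0))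
    (elapsed_nonneg (T := T) (X := X) (V := V) t ((x - z) 0)) hz (by linarith)
  set w := weight 3 T X V t (x - z) with hw
  have hw1 : 1 ≤ w := one_le_weight 3 t _
  -- Each of the three cubed terms loses a factor 4. Both the weight and (1+|z|)^3 are at least 1,
  -- so the constants 4 and 12 add up to the final 16.
  have h4 : weight 3 T X V t x ≤ 4 * w + 12 * ‖z‖ ^ 3 := by
    rw [hw]
    unfold weight
    linarith
  have h5 : (1 : ℝ) ≤ (1 + ‖z‖) ^ 3 := one_le_pow₀ (by linarith)
  have h6 : ‖z‖ ^ 3 ≤ (1 + ‖z‖) ^ 3 := by gcongr; linarith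
  nlinarith [mul_le_mul_of_nonneg_right h5 (zero_le_one.trans hw1),
    mul_le_mul_of_nonneg_left hw1 (zero_le_one.trans h5)]

end PassageTime

end FastCharge

namespace FastCharge

/-! ### Gradients as Riesz representatives of derivatives. -/

section Gradient

variable {A a : ℝ} {g : E3 → ℝ}

lemma norm_gradient (g : E3 → ℝ) (x : E3) : ‖∇ g x‖ = ‖fderiv ℝ g x‖ := by
  simp [gradient]

lemma gradient_eq_comp (g : E3 → ℝ) :
    ∇ g = fun x => (InnerProductSpace.toDual ℝ E3).symm (fderiv ℝ g x) := rfl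

lemma contDiff_gradient (hg : ContDiff ℝ 2 g) : ContDiff ℝ 1 (∇ g) := by
  rw [gradient_eq_comp]
  exact (InnerProductSpace.toDual ℝ E3).symm.toContinuousLinearEquiv.contDiff.comp
    (hg.fderiv_right (by norm_num))

lemma norm_fderiv_gradient (g : E3 → ℝ) (x : E3) :
    ‖fderiv ℝ (∇ g) x‖ = ‖fderiv ℝ (fderiv ℝ g) x‖ := by
  have e : ∇ g = (InnerProductSpace.toDual ℝ E3).symm ∘ fderiv ℝ g := rfl
  rw [e, LinearIsometryEquiv.comp_fderiv]
  exact LinearIsometry.norm_toContinuousLinearMap_comp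
    (InnerProductSpace.toDual ℝ E3).symm.toLinearIsometry

lemma ExpDecay.norm_gradient_le (h : ExpDecay A a g) (x : E3) :
    ‖∇ g x‖ ≤ A * Real.exp (-a * ‖x‖) := by
  rw [norm_gradient]; exact h.bound_one x

lemma ExpDecay.norm_fderiv_gradient_le (h : ExpDecay A a g) (x : E3) :
    ‖fderiv ℝ (∇ g) x‖ ≤ A * Real.exp (-a * ‖x‖) := by
  rw [norm_fderiv_gradient]; exact h.bound_two x

lemma ExpDecay.continuous_gradient (h : ExpDecay A a g) : Continuous (∇ g) :=
  (contDiff_gradient h.contDiff).continuous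

lemma ExpDecay.continuous_fderiv_gradient (h : ExpDecay A a g) : Continuous (fderiv ℝ (∇ g)) :=
  (contDiff_gradient h.contDiff).continuous_fderiv one_ne_zero

lemma ExpDecay.hasFDerivAt_gradient (h : ExpDecay A a g) (x : E3) :
    HasFDerivAt (∇ g) (fderiv ℝ (∇ g) x) x :=
  ((contDiff_gradient h.contDiff).differentiable one_ne_zero x).hasFDerivAt

lemma ExpDecay.nonneg (h : ExpDecay A a g) : 0 ≤ A := by
  have := (norm_nonneg _).trans (h.bound_one 0)
  simpa using this

end Gradient

/-! ### Regularity and decay of the self-consistent field. -/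

section Field

variable {T Vmin δ : ℝ} {X V : ℝ → E3} {ρ : ℝ → E3 → ℝ}

/-- The spatial derivative of the self-consistent field. -/
noncomputable def fieldDeriv (ρ : ℝ → E3 → ℝ) (t : ℝ) (x : E3) : E3 →L[ℝ] E3 :=
  -∫ z, (fderiv ℝ screenedCoulomb z).smulRight (∇ (ρ t) (x - z))

/-- The constant in the bound of the field by the density. -/
noncomputable def fieldConst : ℝ := 16 * ∫ z : E3, kernelMajorant ‖z‖

/-- The assumptions on the density that enter the estimates of the field. -/
structure DensityBound (δ T : ℝ) (ρ : ℝ → E3 → ℝ) (X V : ℝ → E3) : Prop where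
  differentiable : ∀ t ∈ Icc 0 T, Differentiable ℝ (ρ t)
  gradient_continuousOn : ContinuousOn (fun p : ℝ × E3 => ∇ (ρ p.1) p.2) (Icc 0 T ×ˢ univ)
  bound : BootstrapDensity δ T ρ X V

namespace DensityBound

variable (h : DensityBound δ T ρ X V)
include h

lemma norm_gradient_le_div {t : ℝ} (ht : t ∈ Icc 0 T) (x : E3) :
    ‖∇ (ρ t) x‖ ≤ δ / weight 3 T X V t x := by
  rw [le_div_iff₀ (weight_pos 3 t x), mul_comm]
  exact (h.bound t ht x).2

lemma norm_gradient_le {t : ℝ} (ht : t ∈ Icc 0 T) (x : E3) : ‖∇ (ρ t) x‖ ≤ δ :=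
  (le_mul_of_one_le_left (norm_nonneg _) (one_le_weight 3 t x)).trans (h.bound t ht x).2

lemma abs_le {t : ℝ} (ht : t ∈ Icc 0 T) (x : E3) : ‖ρ t x‖ ≤ δ :=
  (le_mul_of_one_le_left (abs_nonneg _) (one_le_weight 2 t x)).trans (h.bound t ht x).1

lemma continuous_gradient {t : ℝ} (ht : t ∈ Icc 0 T) : Continuous (∇ (ρ t)) :=
  h.gradient_continuousOn.comp_continuous (f := fun x : E3 => (t, x)) (by fun_prop)
    (fun x => ⟨ht, mem_univ _⟩)

/-- Placing the derivative on the density makes the field inherit the cubic weight of ∇ρ; the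
density itself decays only quadratically. -/
lemma electricField_eq {t : ℝ} (ht : t ∈ Icc 0 T) (x : E3) :
    electricField ρ t x = -∫ z, screenedCoulomb z • ∇ (ρ t) (x - z) := by
  have hint : Integrable fun z => screenedCoulomb z • ∇ (ρ t) (x - z) := by
    have := integrable_bilin_conv (ContinuousLinearMap.lsmul ℝ ℝ : ℝ →L[ℝ] E3 →L[ℝ] E3)
      integrable_screenedCoulomb (h.continuous_gradient ht) (h.norm_gradient_le ht) x
    simpa using this
  have hρi : ∀ y, Integrable fun z => screenedCoulomb z * ρ t (y - z) := by
    intro y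
    have := integrable_bilin_conv (ContinuousLinearMap.lsmul ℝ ℝ : ℝ →L[ℝ] ℝ →L[ℝ] ℝ)
      integrable_screenedCoulomb (h.differentiable t ht).continuous (h.abs_le ht) y
    simpa using this
  have hd : HasFDerivAt (fun y : E3 => ∫ z, screenedCoulomb z * ρ t (y - z))
      (∫ z, InnerProductSpace.toDual ℝ E3 (screenedCoulomb z • ∇ (ρ t) (x - z))) x := by
    refine hasFDerivAt_integral_of_dominated_of_fderiv_le (s := univ)
      (F' := fun y z => InnerProductSpace.toDual ℝ E3 (screenedCoulomb z • ∇ (ρ t) (y - z)))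
      (bound := fun z => ‖screenedCoulomb z‖ * δ) Filter.univ_mem
      (Filter.Eventually.of_forall fun y => (hρi y).1) (hρi x) ?_
      (Filter.Eventually.of_forall fun z y _ => ?_) (integrable_screenedCoulomb.norm.mul_const _)
      (Filter.Eventually.of_forall fun z y _ => ?_)
    · exact (InnerProductSpace.toDual ℝ E3).continuous.comp_aestronglyMeasurable hint.1
    · rw [LinearIsometryEquiv.norm_map, norm_smul]
      gcongr
      exact h.norm_gradient_le ht _
    · have h1 : HasFDerivAt (ρ t) (fderiv ℝ (ρ t) (y - z)) (y - z) :=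
        (h.differentiable t ht _).hasFDerivAt
      have h2 := ((hasFDerivAt_comp_sub z).2 h1).const_mul (screenedCoulomb z)
      refine h2.congr_fderiv ?_
      simp [gradient]
  have e : (∫ z, InnerProductSpace.toDual ℝ E3 (screenedCoulomb z • ∇ (ρ t) (x - z)))
      = InnerProductSpace.toDual ℝ E3 (∫ z, screenedCoulomb z • ∇ (ρ t) (x - z)) :=
    (InnerProductSpace.toDual ℝ E3).toContinuousLinearEquiv.integral_comp_comm _
  rw [electricField, gradient, hd.fderiv, e, LinearIsometryEquiv.symm_apply_apply]

/-- Since ∇ρ is merely continuous, the second derivative has to fall on the kernel, whose derivative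
still has an integrable singularity. -/
lemma hasFDerivAt_electricField {t : ℝ} (ht : t ∈ Icc 0 T) (x : E3) :
    HasFDerivAt (electricField ρ t) (fieldDeriv ρ t x) x := by
  have := (hasFDerivAt_conv contDiffOn_screenedCoulomb integrable_screenedCoulomb
    integrable_fderiv_screenedCoulomb (h.continuous_gradient ht) (h.norm_gradient_le ht) x).neg
  exact this.congr_of_eventuallyEq (Filter.Eventually.of_forall fun y => h.electricField_eq ht y)

lemma continuousOn_electricField :
    ContinuousOn (fun p : ℝ × E3 => electricField ρ p.1 p.2) (Icc 0 T ×ˢ univ) := by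
  have := (continuousOn_bilin_conv (ContinuousLinearMap.lsmul ℝ ℝ : ℝ →L[ℝ] E3 →L[ℝ] E3)
    integrable_screenedCoulomb h.gradient_continuousOn
    (fun t ht x => h.norm_gradient_le ht x)).neg
  exact this.congr fun p hp => h.electricField_eq hp.1 p.2

lemma continuousOn_fieldDeriv :
    ContinuousOn (fun p : ℝ × E3 => fieldDeriv ρ p.1 p.2) (Icc 0 T ×ˢ univ) :=
  (continuousOn_bilin_conv (ContinuousLinearMap.smulRightL ℝ E3 E3)
    integrable_fderiv_screenedCoulomb h.gradient_continuousOn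
    (fun _ ht x => h.norm_gradient_le ht x)).neg

variable (hm : FastMotion T Vmin X V) (hV : 1 ≤ Vmin)
include hm hV

-- The weights at x-z and x differ by a factor of at most 16(1+|z|)^3, which the kernel majorant
-- absorbs. This is the form required by `norm_bilin_conv_le`.
omit h in
lemma kernel_weight (t : ℝ) {c : ℝ} {z : E3} (hc : 0 ≤ c)
    (hz : (1 + ‖z‖) ^ 3 * c ≤ kernelMajorant ‖z‖) (x : E3) :
    c / weight 3 T X V t (x - z) ≤ 16 * kernelMajorant ‖z‖ / weight 3 T X V t x := by
  rw [div_le_div_iff₀ (weight_pos 3 t _) (weight_pos 3 t _)]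
  have h1 := mul_le_mul_of_nonneg_left (hm.weight_shift hV t x z) hc
  have h2 := mul_le_mul_of_nonneg_left hz
    (weight_pos (T := T) (X := X) (V := V) 3 t (x - z)).le
  nlinarith

lemma norm_electricField_le {t : ℝ} (ht : t ∈ Icc 0 T) (x : E3) :
    ‖electricField ρ t x‖ ≤ fieldConst * δ / weight 3 T X V t x := by
  rw [h.electricField_eq ht, norm_neg]
  have := norm_bilin_conv_le (ContinuousLinearMap.lsmul ℝ ℝ : ℝ →L[ℝ] E3 →L[ℝ] E3)
    (κ := screenedCoulomb) (integrable_kernelMajorant.const_mul 16)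
    (fun x => weight_pos (T := T) (X := X) (V := V) 3 t x)
    (fun x => h.norm_gradient_le_div ht x) (Filter.Eventually.of_forall fun z x =>
      kernel_weight hm hV t (norm_nonneg _) (abs_screenedCoulomb_le z) x) x
  refine this.trans ?_
  rw [integral_const_mul, fieldConst]
  have hl : ‖(ContinuousLinearMap.lsmul ℝ ℝ : ℝ →L[ℝ] E3 →L[ℝ] E3)‖ ≤ 1 :=
    ContinuousLinearMap.opNorm_lsmul_le
  have hδ : 0 ≤ δ := (norm_nonneg _).trans (h.abs_le ht x)
  have hk : 0 ≤ ∫ z : E3, kernelMajorant ‖z‖ :=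
    integral_nonneg fun z => by unfold kernelMajorant; positivity
  have hw := weight_pos (T := T) (X := X) (V := V) 3 t x
  calc _ ≤ 1 * δ / weight 3 T X V t x * (16 * ∫ z : E3, kernelMajorant ‖z‖) := by gcongr
    _ = _ := by ring

lemma norm_fieldDeriv_le {t : ℝ} (ht : t ∈ Icc 0 T) (x : E3) :
    ‖fieldDeriv ρ t x‖ ≤ fieldConst * δ / weight 3 T X V t x := by
  rw [fieldDeriv, norm_neg]
  have := norm_bilin_conv_le (ContinuousLinearMap.smulRightL ℝ E3 E3)
    (κ := fderiv ℝ screenedCoulomb) (integrable_kernelMajorant.const_mul 16)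
    (fun x => weight_pos (T := T) (X := X) (V := V) 3 t x)
    (fun x => h.norm_gradient_le_div ht x) (by
      filter_upwards [Measure.ae_ne volume (0 : E3)] with z hz x
      exact kernel_weight hm hV t (norm_nonneg _) (norm_fderiv_screenedCoulomb_le hz) x) x
  refine this.trans ?_
  rw [integral_const_mul, fieldConst]
  have hl : ‖ContinuousLinearMap.smulRightL ℝ E3 E3‖ ≤ 1 :=
    ContinuousLinearMap.norm_smulRightL_le
  have hδ : 0 ≤ δ := (norm_nonneg _).trans (h.abs_le ht x)
  have hk : 0 ≤ ∫ z : E3, kernelMajorant ‖z‖ :=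
    integral_nonneg fun z => by unfold kernelMajorant; positivity
  have hw := weight_pos (T := T) (X := X) (V := V) 3 t x
  calc _ ≤ 1 * δ / weight 3 T X V t x * (16 * ∫ z : E3, kernelMajorant ‖z‖) := by gcongr
    _ = _ := by ring

end DensityBound

/-- A force field that is continuously differentiable in space and, together with its derivative,
is the sum of a small part that decays away from the region just visited by the charge and of a
part that decays exponentially away from the charge. -/
structure RegularForce (c A a T : ℝ) (X V : ℝ → E3) (F : ℝ → E3 → E3)
    (DF : ℝ → E3 → E3 →L[ℝ] E3) : Prop where
  hasFDerivAt : ∀ t ∈ Icc 0 T, ∀ x, HasFDerivAt (F t) (DF t x) x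
  continuousOn : ContinuousOn (fun p : ℝ × E3 => F p.1 p.2) (Icc 0 T ×ˢ univ)
  continuousOn_deriv : ContinuousOn (fun p : ℝ × E3 => DF p.1 p.2) (Icc 0 T ×ˢ univ)
  norm_le : ∀ t ∈ Icc 0 T, ∀ x,
    ‖F t x‖ ≤ c / weight 3 T X V t x + A * Real.exp (-a * ‖x - X t‖)
  norm_deriv_le : ∀ t ∈ Icc 0 T, ∀ x,
    ‖DF t x‖ ≤ c / weight 3 T X V t x + A * Real.exp (-a * ‖x - X t‖)

theorem DensityBound.regularForce {A a : ℝ} {Φ : E3 → ℝ} (h : DensityBound δ T ρ X V)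
    (hm : FastMotion T Vmin X V) (hV : 1 ≤ Vmin) (hΦ : ExpDecay A a Φ) :
    RegularForce (fieldConst * δ) A a T X V (force Φ ρ X)
      (fun t x => fieldDeriv ρ t x + fderiv ℝ (∇ Φ) (x - X t)) := by
  have hXc : ContinuousOn X (Icc 0 T) := fun t ht => (hm.deriv t ht).continuousWithinAt
  have hXc' : ContinuousOn (fun p : ℝ × E3 => p.2 - X p.1) (Icc 0 T ×ˢ univ) :=
    continuousOn_snd.sub (hXc.comp continuousOn_fst fun p hp => hp.1)
  refine ⟨fun t ht x => ?_, ?_, ?_, fun t ht x => ?_, fun t ht x => ?_⟩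
  · exact (h.hasFDerivAt_electricField ht x).add
      ((hasFDerivAt_comp_sub (X t)).2 (hΦ.hasFDerivAt_gradient (x - X t)))
  · exact h.continuousOn_electricField.add (hΦ.continuous_gradient.comp_continuousOn hXc')
  · exact h.continuousOn_fieldDeriv.add (hΦ.continuous_fderiv_gradient.comp_continuousOn hXc')
  · exact (norm_add_le _ _).trans
      (add_le_add (h.norm_electricField_le hm hV ht x) (hΦ.norm_gradient_le _))
  · exact (norm_add_le _ _).trans
      (add_le_add (h.norm_fieldDeriv_le hm hV ht x) (hΦ.norm_fderiv_gradient_le _))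

end Field

end FastCharge

namespace FastCharge

/-! ### Moments of the force about the passing time. -/

section Moments

lemma integral_exp_neg_abs {k : ℝ} (hk : 0 < k) (y : ℝ) :
    ∫ x : ℝ, Real.exp (-(k * |x - y|)) = 2 / k := by
  rw [integral_sub_right_eq_self (fun x : ℝ => Real.exp (-(k * |x|))) y,
    integral_comp_abs (f := fun x => Real.exp (-(k * x)))]
  have := integral_exp_mul_Ioi (neg_lt_zero.2 hk) 0
  simp only [neg_mul] at this
  rw [this]
  simp
  ring

/-- A non-integrable function has Bochner integral zero, whereas the integral has just been computed
to be positive. -/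
lemma integrable_exp_neg_abs {k : ℝ} (hk : 0 < k) (y : ℝ) :
    Integrable fun x : ℝ => Real.exp (-(k * |x - y|)) := by
  by_contra h
  have h1 := integral_undef h
  rw [integral_exp_neg_abs hk] at h1
  have : 0 < 2 / k := by positivity
  linarith

/-- The majorant of the force along a trajectory that meets the charge at time `σ`. -/
noncomputable def forceMajorant (c A b σ r : ℝ) : ℝ :=
  32 * c / (1 + |r - σ|) ^ 3 + A * Real.exp (-(b * |r - σ|))

variable {c A b σ s t : ℝ}

lemma continuous_forceMajorant (c A b σ : ℝ) : Continuous (forceMajorant c A b σ) := by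
  unfold forceMajorant
  refine Continuous.add (continuous_const.div (by fun_prop) fun r => ?_) (by fun_prop)
  positivity

lemma forceMajorant_nonneg (hc : 0 ≤ c) (hA : 0 ≤ A) (r : ℝ) : 0 ≤ forceMajorant c A b σ r := by
  unfold forceMajorant; positivity

/-- Half of the exponential rate pays for the polynomial, with a constant independent of the rate
because b ≥ 1. -/
lemma one_add_sq_mul_exp_le (hb : 1 ≤ b) {u : ℝ} (hu : 0 ≤ u) :
    (1 + u) ^ 2 * Real.exp (-(b * u)) ≤ 8 * Real.exp (-(b / 2 * u)) := by
  have h1 : (1 + u) ^ 2 ≤ 8 * Real.exp (b / 2 * u) := by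
    have h2 := Real.quadratic_le_exp_of_nonneg (show 0 ≤ u / 2 by positivity)
    have h3 : Real.exp (u / 2) ≤ Real.exp (b / 2 * u) := Real.exp_le_exp.2 (by nlinarith)
    nlinarith
  calc (1 + u) ^ 2 * Real.exp (-(b * u)) ≤ 8 * Real.exp (b / 2 * u) * Real.exp (-(b * u)) := by
        gcongr
    _ = 8 * Real.exp (-(b / 2 * u)) := by
        rw [mul_assoc, ← Real.exp_add]; ring_nf

lemma integral_le_of_le_integrable {f g : ℝ → ℝ} (hst : s ≤ t) (hf : Continuous f)
    (hg : Integrable g) (hg0 : ∀ r, 0 ≤ g r) (hfg : ∀ r, f r ≤ g r) :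
    ∫ r in s..t, f r ≤ ∫ r, g r := by
  rw [intervalIntegral.integral_of_le hst]
  exact (setIntegral_mono (hf.integrableOn_Icc.mono_set Ioc_subset_Icc_self) hg.integrableOn
    hfg).trans (setIntegral_le_integral hg (Filter.Eventually.of_forall hg0))

/-- A bound for the first two moments of the majorant. -/
lemma moment_le (hc : 0 ≤ c) (hA : 0 ≤ A) (hb : 1 ≤ b) (hst : s ≤ t) {j : ℕ} (hj : j ≤ 1) :
    ∫ r in s..t, |r - σ| ^ j * forceMajorant c A b σ r ≤ 32 * Real.pi * c + 32 * A / b := by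
  have hb0 : 0 < b := zero_lt_one.trans_le hb
  have h1 : Integrable fun r : ℝ => (1 + (r - σ) ^ 2)⁻¹ :=
    integrable_inv_one_add_sq.comp_sub_right σ
  have h2 := integrable_exp_neg_abs (half_pos hb0) σ
  -- For j ≤ 1 the quotient u^j/(1+u)^3 is at most 1/(1+u^2), whose integral is π. The exponential
  -- at half the rate contributes 8A · 4/b.
  refine (integral_le_of_le_integrable (g := fun r => 32 * c * (1 + (r - σ) ^ 2)⁻¹
    + 8 * A * Real.exp (-(b / 2 * |r - σ|))) hst
    ((by fun_prop : Continuous fun r : ℝ => |r - σ| ^ j).mul (continuous_forceMajorant c A b σ))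
    ((h1.const_mul _).add (h2.const_mul _)) (fun r => by positivity) fun r => ?_).trans ?_
  · change |r - σ| ^ j * forceMajorant c A b σ r ≤ _
    unfold forceMajorant
    rw [mul_add]
    have hu := abs_nonneg (r - σ)
    have e : (r - σ) ^ 2 = |r - σ| ^ 2 := (sq_abs _).symm
    rw [e]
    set u := |r - σ|
    have hj2 : u ^ j ≤ 1 + u := by
      interval_cases j
      · simp [hu]
      · simp
    refine add_le_add ?_ ?_
    · rw [← mul_div_assoc, ← div_eq_mul_inv, div_le_div_iff₀ (by positivity) (by positivity)]
      have h3 : u ^ j * (1 + u ^ 2) ≤ (1 + u) ^ 3 := by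
        calc u ^ j * (1 + u ^ 2) ≤ (1 + u) * (1 + u ^ 2) := by gcongr
          _ ≤ (1 + u) ^ 3 := by nlinarith
      nlinarith [mul_le_mul_of_nonneg_left h3 hc]
    · have h4 := one_add_sq_mul_exp_le hb hu
      have h5 : u ^ j ≤ (1 + u) ^ 2 := hj2.trans (by nlinarith)
      have h6 : u ^ j * Real.exp (-(b * u)) ≤ 8 * Real.exp (-(b / 2 * u)) :=
        (mul_le_mul_of_nonneg_right h5 (Real.exp_pos _).le).trans h4
      nlinarith [mul_le_mul_of_nonneg_left h6 hA]
  · rw [integral_add (h1.const_mul _) (h2.const_mul _), integral_const_mul, integral_const_mul,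
      integral_exp_neg_abs (half_pos hb0), integral_sub_right_eq_self (fun r : ℝ => (1 + r ^ 2)⁻¹),
      integral_univ_inv_one_add_sq]
    refine le_of_eq ?_
    field_simp
    ring

lemma integral_inv_one_add_abs_le {T : ℝ} (hσ : σ ∈ Icc s t) (hT : t - s ≤ T) :
    ∫ r in s..t, (1 + |r - σ|)⁻¹ ≤ 2 * Real.log (2 + T) := by
  have hci : ∀ x y : ℝ, IntervalIntegrable (fun r : ℝ => (1 + |r - σ|)⁻¹) volume x y := fun x y =>
    Continuous.intervalIntegrable
      (Continuous.inv₀ (by fun_prop) fun r => by positivity) x y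
  rw [← intervalIntegral.integral_add_adjacent_intervals (hci s σ) (hci σ t)]
  have hright : ∫ r in σ..t, (1 + |r - σ|)⁻¹ ≤ Real.log (2 + T) := by
    have e : ∫ r in σ..t, (1 + |r - σ|)⁻¹ = Real.log (1 + (t - σ)) := by
      rw [intervalIntegral.integral_eq_sub_of_hasDerivAt (f := fun r => Real.log (1 + (r - σ)))]
      · simp
      · intro r hr
        rw [uIcc_of_le hσ.2] at hr
        have h1 : 0 ≤ r - σ := sub_nonneg.2 hr.1
        rw [abs_of_nonneg h1]
        have := (((hasDerivAt_id r).sub_const σ).const_add 1).log (by positivity)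
        simpa using this
      · exact hci _ _
    rw [e]
    exact Real.log_le_log (by linarith [hσ.2]) (by linarith [hσ.1])
  have hleft : ∫ r in s..σ, (1 + |r - σ|)⁻¹ ≤ Real.log (2 + T) := by
    have e : ∫ r in s..σ, (1 + |r - σ|)⁻¹ = Real.log (1 + (σ - s)) := by
      rw [intervalIntegral.integral_eq_sub_of_hasDerivAt (f := fun r => -Real.log (1 + (σ - r)))]
      · simp
      · intro r hr
        rw [uIcc_of_le hσ.1] at hr
        have h1 : r - σ ≤ 0 := sub_nonpos.2 hr.2
        rw [abs_of_nonpos h1]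
        have := ((((hasDerivAt_id r).const_sub σ).const_add 1).log (by
          simp only [id]; linarith)).neg
        refine this.congr_deriv ?_
        rw [id, neg_div, neg_neg, one_div]
        congr 1
        ring
      · exact hci _ _
    rw [e]
    exact Real.log_le_log (by linarith [hσ.1]) (by linarith [hσ.2])
  linarith

/-- A bound for the second moment of the majorant. -/
lemma second_moment_le {T : ℝ} (hc : 0 ≤ c) (hA : 0 ≤ A) (hb : 1 ≤ b) (hσ : σ ∈ Icc s t)
    (hT : t - s ≤ T) :
    ∫ r in s..t, |r - σ| ^ 2 * forceMajorant c A b σ r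
      ≤ 64 * c * Real.log (2 + T) + 32 * A / b := by
  have hb0 : 0 < b := zero_lt_one.trans_le hb
  have hst : s ≤ t := hσ.1.trans hσ.2
  have h2 := integrable_exp_neg_abs (half_pos hb0) σ
  have c1 : Continuous fun r : ℝ => 32 * c * (1 + |r - σ|)⁻¹ :=
    continuous_const.mul (Continuous.inv₀ (by fun_prop) fun r => by positivity)
  have c2 : Continuous fun r : ℝ => 8 * A * Real.exp (-(b / 2 * |r - σ|)) := by fun_prop
  -- At second order only u^2/(1+u)^3 ≤ 1/(1+u) remains, which is the origin of the logarithm in T.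
  have hle : ∫ r in s..t, |r - σ| ^ 2 * forceMajorant c A b σ r
      ≤ ∫ r in s..t, (32 * c * (1 + |r - σ|)⁻¹ + 8 * A * Real.exp (-(b / 2 * |r - σ|))) := by
    refine intervalIntegral.integral_mono_on hst
      (((by fun_prop : Continuous fun r : ℝ => |r - σ| ^ 2).mul
        (continuous_forceMajorant c A b σ)).intervalIntegrable _ _)
      ((c1.add c2).intervalIntegrable _ _) fun r _ => ?_
    unfold forceMajorant
    rw [mul_add]
    have hu := abs_nonneg (r - σ)
    set u := |r - σ|
    refine add_le_add ?_ ?_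
    · rw [← mul_div_assoc, ← div_eq_mul_inv, div_le_div_iff₀ (by positivity) (by positivity)]
      have h3 : u ^ 2 * (1 + u) ≤ (1 + u) ^ 3 := by nlinarith
      nlinarith [mul_le_mul_of_nonneg_left h3 hc]
    · have h4 := one_add_sq_mul_exp_le hb hu
      have h5 : u ^ 2 ≤ (1 + u) ^ 2 := by nlinarith
      have h6 : u ^ 2 * Real.exp (-(b * u)) ≤ 8 * Real.exp (-(b / 2 * u)) :=
        (mul_le_mul_of_nonneg_right h5 (Real.exp_pos _).le).trans h4
      nlinarith [mul_le_mul_of_nonneg_left h6 hA]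
  refine hle.trans ?_
  rw [intervalIntegral.integral_add (c1.intervalIntegrable _ _) (c2.intervalIntegrable _ _),
    intervalIntegral.integral_const_mul, intervalIntegral.integral_const_mul]
  have h7 := integral_inv_one_add_abs_le hσ hT
  have h8 : ∫ r in s..t, Real.exp (-(b / 2 * |r - σ|)) ≤ 2 / (b / 2) := by
    rw [← integral_exp_neg_abs (half_pos hb0) σ]
    exact integral_le_of_le_integrable hst (by fun_prop) h2 (fun r => (Real.exp_pos _).le)
      fun r => le_rfl
  have h9 : 8 * A * (2 / (b / 2)) = 32 * A / b := by field_simp; ring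
  have h10 := mul_le_mul_of_nonneg_left h7 (by positivity : 0 ≤ 32 * c)
  have h11 := mul_le_mul_of_nonneg_left h8 (by positivity : 0 ≤ 8 * A)
  linarith

end Moments

end FastCharge

namespace FastCharge

/-! ### Trajectories of slow particles and the linearized flow along them. -/

section Trajectory

variable {T Vmin c A a : ℝ} {X V : ℝ → E3} {F : ℝ → E3 → E3} {DF : ℝ → E3 → E3 →L[ℝ] E3}

/-- `p` is a trajectory with velocity `w` of a particle in the force field `F` during `[s, t]`. -/
structure IsTrajectory (F : ℝ → E3 → E3) (T s t : ℝ) (p w : ℝ → E3) : Prop where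
  nonneg : 0 ≤ s
  le : s ≤ t
  le_end : t ≤ T
  position : ∀ r ∈ Icc s t, HasDerivWithinAt p (w r) (Icc s t) r
  velocity : ∀ r ∈ Icc s t, HasDerivWithinAt w (F r (p r)) (Icc s t) r

namespace IsTrajectory

variable {s t : ℝ} {p w : ℝ → E3}

lemma subset (h : IsTrajectory F T s t p w) : Icc s t ⊆ Icc 0 T :=
  Icc_subset_Icc h.nonneg h.le_end

lemma mono (h : IsTrajectory F T s t p w) {s' t' : ℝ} (hs : s ≤ s') (hst : s' ≤ t')
    (ht : t' ≤ t) : IsTrajectory F T s' t' p w :=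
  have hsub : Icc s' t' ⊆ Icc s t := Icc_subset_Icc hs ht
  ⟨h.nonneg.trans hs, hst, ht.trans h.le_end, fun r hr => (h.position r (hsub hr)).mono hsub,
    fun r hr => (h.velocity r (hsub hr)).mono hsub⟩

lemma continuousOn_position (h : IsTrajectory F T s t p w) : ContinuousOn p (Icc s t) :=
  fun r hr => (h.position r hr).continuousWithinAt

lemma continuousOn_velocity (h : IsTrajectory F T s t p w) : ContinuousOn w (Icc s t) :=
  fun r hr => (h.velocity r hr).continuousWithinAt

end IsTrajectory

/-- `σ` is the time in `[s, t]` at which the charge and the particle are closest to passing each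
other; before and after it they separate at least linearly in time. -/
structure IsPassing (T Vmin : ℝ) (X V : ℝ → E3) (s t : ℝ) (p : ℝ → E3) (σ : ℝ) : Prop where
  mem : σ ∈ Icc s t
  delay_le : Vmin / 2 * (σ - s) ≤ ‖p s - X s‖
  distance : ∀ r ∈ Icc s t, Vmin / 2 * |r - σ| ≤ ‖p r - X r‖
  weight : ∀ r ∈ Icc s t, (1 + |r - σ|) ^ 3 ≤ 32 * weight 3 T X V r (p r)

/-- The longitudinal distance p_1 - X_1 decreases at rate at least Vmin/2. Before its zero σ the
particle is ahead of the charge by at least Vmin(σ-r)/2; after it the charge crossed the plane of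
the particle at least (r-σ)/2 earlier. Either way the weight contains (|r-σ|/2)^3. -/
lemma FastMotion.exists_isPassing (hm : FastMotion T Vmin X V) (hV : 1 ≤ Vmin) {s t : ℝ}
    {p w : ℝ → E3} (hs : 0 ≤ s) (hst : s ≤ t) (ht : t ≤ T)
    (hp : ∀ r ∈ Icc s t, HasDerivWithinAt p (w r) (Icc s t) r)
    (hw : ∀ r ∈ Icc s t, |w r 0| ≤ Vmin / 2) : ∃ σ, IsPassing T Vmin X V s t p σ := by
  have hsub : Icc s t ⊆ Icc 0 T := Icc_subset_Icc hs ht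
  set m : ℝ → ℝ := fun r => p r 0 - X r 0 with hmdef
  have hmd : ∀ r ∈ Icc s t, HasDerivWithinAt m (w r 0 - V r 0) (Icc s t) r := fun r hr =>
    (HasDerivWithinAt.coord (hp r hr) 0).sub
      ((HasDerivWithinAt.coord (hm.deriv r (hsub hr)) 0).mono hsub)
  have hmc : ContinuousOn m (Icc s t) := fun r hr => (hmd r hr).continuousWithinAt
  have hdec : ∀ r₁ ∈ Icc s t, ∀ r₂ ∈ Icc s t, r₁ ≤ r₂ →
      m r₂ ≤ m r₁ - Vmin / 2 * (r₂ - r₁) := by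
    intro r₁ h₁ r₂ h₂ h12
    have hanti := antitoneOn_of_hasDerivWithinAt_nonpos (convex_Icc s t)
      (f := fun r => m r + Vmin / 2 * r) (f' := fun r => w r 0 - V r 0 + Vmin / 2 * 1)
      (fun r hr => ((hmd r hr).add ((hasDerivWithinAt_id r _).const_mul _)).continuousWithinAt)
      (fun r hr => ((hmd r (interior_subset hr)).add
        ((hasDerivWithinAt_id r _).const_mul _)).mono interior_subset)
      (fun r hr => by
        have hr' := interior_subset hr
        have h1 := hm.le r (hsub hr')
        have h2 := (le_abs_self _).trans (hw r hr')
        linarith) h₁ h₂ h12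
    simp only at hanti
    linarith
  have hpos : ∀ r₁ ∈ Icc s t, ∀ r₂ ∈ Icc s t, r₁ ≤ r₂ →
      p r₂ 0 ≤ p r₁ 0 + Vmin / 2 * (r₂ - r₁) := by
    intro r₁ h₁ r₂ h₂ h12
    have hd : ∀ r ∈ Icc s t, HasDerivWithinAt (fun r => p r 0 - Vmin / 2 * r)
        (w r 0 - Vmin / 2 * 1) (Icc s t) r := fun r hr =>
      (HasDerivWithinAt.coord (hp r hr) 0).sub ((hasDerivWithinAt_id r _).const_mul _)
    have hanti := antitoneOn_of_hasDerivWithinAt_nonpos (convex_Icc s t)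
      (fun r hr => (hd r hr).continuousWithinAt)
      (fun r hr => (hd r (interior_subset hr)).mono interior_subset)
      (fun r hr => by
        have h2 := (le_abs_self _).trans (hw r (interior_subset hr))
        linarith) h₁ h₂ h12
    simp only at hanti
    linarith
  -- If the distance does not change sign, σ is an end point. There is nothing before s and nothing
  -- after t, so each sign is needed only when σ is not the corresponding end point.
  obtain ⟨σ, hσ, h1, h2⟩ : ∃ σ ∈ Icc s t, (σ = s ∨ 0 ≤ m σ) ∧ (σ = t ∨ m σ ≤ 0) := by
    by_cases hs0 : m s ≤ 0
    · exact ⟨s, ⟨le_rfl, hst⟩, Or.inl rfl, Or.inr hs0⟩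
    by_cases ht0 : 0 ≤ m t
    · exact ⟨t, ⟨hst, le_rfl⟩, Or.inr ht0, Or.inl rfl⟩
    · obtain ⟨σ, hσ, h0⟩ := intermediate_value_Icc' hst hmc
        (show (0 : ℝ) ∈ Icc (m t) (m s) from ⟨(not_le.1 ht0).le, (not_le.1 hs0).le⟩)
      exact ⟨σ, hσ, Or.inr h0.ge, Or.inr h0.le⟩
  have hnorm : ∀ r, |m r| ≤ ‖p r - X r‖ := fun r => by
    simpa [hmdef] using abs_coord_le_norm (p r - X r) 0
  have hbefore : ∀ r ∈ Icc s t, r ≤ σ → Vmin / 2 * (σ - r) ≤ max (m r) 0 := by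
    intro r hr hrσ
    rcases h1 with h1 | h1
    · have : σ - r ≤ 0 := by linarith [hr.1]
      exact (mul_nonpos_of_nonneg_of_nonpos (by linarith) this).trans (le_max_right _ _)
    · exact le_trans (by linarith [hdec r hr σ hσ hrσ]) (le_max_left _ _)
  have hafter : ∀ r ∈ Icc s t, σ < r → m r ≤ -(Vmin / 2 * (r - σ)) ∧ m σ ≤ 0 := by
    intro r hr hrσ
    rcases h2 with h2 | h2
    · exact absurd hr.2 (not_le.2 (h2 ▸ hrσ))
    · exact ⟨by linarith [hdec σ hσ r hr hrσ.le], h2⟩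
  have hmax : ∀ r, max (m r) 0 ≤ ‖p r - X r‖ := fun r =>
    max_le ((le_abs_self _).trans (hnorm r)) (norm_nonneg _)
  refine ⟨σ, hσ, (hbefore s ⟨le_rfl, hst⟩ hσ.1).trans (hmax s), fun r hr => ?_, fun r hr => ?_⟩
  · rcases le_or_gt r σ with hrσ | hrσ
    · rw [abs_of_nonpos (by linarith), neg_sub]
      exact (hbefore r hr hrσ).trans (hmax r)
    · rw [abs_of_pos (by linarith)]
      refine le_trans ?_ (hnorm r)
      rw [le_abs]
      right
      linarith [(hafter r hr hrσ).1]
  · have hwt : (|r - σ| / 2) ^ 3 ≤ weight 3 T X V r (p r) - 1 := by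
      have hp0 := pow_nonneg (perpNorm_nonneg (p r)) 3
      have ha0 := pow_nonneg (ahead_nonneg (X := X) r (p r 0)) 3
      have he0 := pow_nonneg (elapsed_nonneg (T := T) (X := X) (V := V) r (p r 0)) 3
      unfold FastCharge.weight
      rcases le_or_gt r σ with hrσ | hrσ
      · have h3 : |r - σ| / 2 ≤ ahead X r (p r 0) := by
          rw [abs_of_nonpos (by linarith), neg_sub]
          refine le_trans ?_ (hbefore r hr hrσ)
          nlinarith
        have : (|r - σ| / 2) ^ 3 ≤ ahead X r (p r 0) ^ 3 := by gcongr
        linarith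
      · have h3 : |r - σ| / 2 ≤ elapsed T X V r (p r 0) := by
          rw [abs_of_pos (by linarith)]
          refine le_trans ?_ (le_max_left _ _)
          have h4 := (hafter r hr hrσ).2
          have h5 := hpos σ hσ r hr hrσ.le
          have h6 := hm.growth (show σ ≤ σ + (r - σ) / 2 by linarith)
          rw [extendedFirst_of_mem (hsub hσ)] at h6
          have h7 : passageTime T X V (p r 0) ≤ σ + (r - σ) / 2 := by
            refine hm.passageTime_le ?_
            simp only [hmdef] at h4
            linarith
          linarith
        have : (|r - σ| / 2) ^ 3 ≤ elapsed T X V r (p r 0) ^ 3 := by gcongr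
        linarith
    have hu := abs_nonneg (r - σ)
    set u := |r - σ|
    -- Since u^3 ≤ 8(W-1) for the weight W, this convexity inequality produces the constant 32.
    have h8 : (1 + u) ^ 3 ≤ 4 + 4 * u ^ 3 := by
      nlinarith [mul_nonneg (add_nonneg zero_le_one hu) (sq_nonneg (1 - u))]
    nlinarith

namespace IsPassing

variable {s t σ : ℝ} {p : ℝ → E3}

lemma majorant (h : IsPassing T Vmin X V s t p σ) (hc : 0 ≤ c) (hA : 0 ≤ A) (ha : 0 ≤ a) {r : ℝ}
    (hr : r ∈ Icc s t) :
    c / FastCharge.weight 3 T X V r (p r) + A * Real.exp (-a * ‖p r - X r‖)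
      ≤ forceMajorant c A (a * Vmin / 2) σ r := by
  unfold forceMajorant
  refine add_le_add ?_ ?_
  · rw [div_le_div_iff₀ (weight_pos 3 r _) (by positivity)]
    nlinarith [mul_le_mul_of_nonneg_left (h.weight r hr) hc]
  · gcongr
    nlinarith [mul_le_mul_of_nonneg_left (h.distance r hr) ha]

end IsPassing

/-- The bound for the zeroth and first moment of the force along a trajectory. -/
noncomputable def momentBound (c A a Vmin : ℝ) : ℝ := 32 * Real.pi * c + 32 * A / (a * Vmin / 2)

/-- The bound for the second moment of the force along a trajectory. -/
noncomputable def secondMomentBound (c A a Vmin T : ℝ) : ℝ :=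
  64 * c * Real.log (2 + T) + 32 * A / (a * Vmin / 2)

/-- Standing assumptions for the estimates along trajectories. -/
structure ForceSetting (T Vmin c A a : ℝ) (X V : ℝ → E3) (F : ℝ → E3 → E3)
    (DF : ℝ → E3 → E3 →L[ℝ] E3) : Prop where
  motion : FastMotion T Vmin X V
  force : RegularForce c A a T X V F DF
  c_nonneg : 0 ≤ c
  A_nonneg : 0 ≤ A
  a_pos : 0 < a
  Vmin_large : 8 ≤ Vmin
  rate_large : 1 ≤ a * Vmin / 2
  moment_small : momentBound c A a Vmin ≤ 1 / 2

namespace ForceSetting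

variable {s t σ : ℝ} {p w : ℝ → E3}

lemma one_le_Vmin (H : ForceSetting T Vmin c A a X V F DF) : 1 ≤ Vmin := by
  linarith [H.Vmin_large]

lemma momentBound_nonneg (H : ForceSetting T Vmin c A a X V F DF) :
    0 ≤ momentBound c A a Vmin := by
  have h1 := H.c_nonneg
  have h2 := H.A_nonneg
  have h3 := H.rate_large
  unfold momentBound
  positivity

lemma zeroth_moment_le (H : ForceSetting T Vmin c A a X V F DF) (hst : s ≤ t) :
    ∫ r in s..t, forceMajorant c A (a * Vmin / 2) σ r ≤ momentBound c A a Vmin := by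
  have := moment_le (σ := σ) (j := 0) H.c_nonneg H.A_nonneg H.rate_large hst zero_le_one
  simp only [pow_zero, one_mul] at this
  exact this

lemma first_moment_le (H : ForceSetting T Vmin c A a X V F DF) (hst : s ≤ t) :
    ∫ r in s..t, |r - σ| * forceMajorant c A (a * Vmin / 2) σ r ≤ momentBound c A a Vmin := by
  have := moment_le (σ := σ) (j := 1) H.c_nonneg H.A_nonneg H.rate_large hst le_rfl
  simp only [pow_one] at this
  exact this

lemma norm_force_le (H : ForceSetting T Vmin c A a X V F DF)
    (htr : IsTrajectory F T s t p w) (hσ : IsPassing T Vmin X V s t p σ) {r : ℝ}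
    (hr : r ∈ Icc s t) : ‖F r (p r)‖ ≤ forceMajorant c A (a * Vmin / 2) σ r :=
  (H.force.norm_le r (htr.subset hr) _).trans (hσ.majorant H.c_nonneg H.A_nonneg H.a_pos.le hr)

lemma norm_deriv_le (H : ForceSetting T Vmin c A a X V F DF)
    (htr : IsTrajectory F T s t p w) (hσ : IsPassing T Vmin X V s t p σ) {r : ℝ}
    (hr : r ∈ Icc s t) : ‖DF r (p r)‖ ≤ forceMajorant c A (a * Vmin / 2) σ r :=
  (H.force.norm_deriv_le r (htr.subset hr) _).trans
    (hσ.majorant H.c_nonneg H.A_nonneg H.a_pos.le hr)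

lemma continuousOn_force (H : ForceSetting T Vmin c A a X V F DF)
    (htr : IsTrajectory F T s t p w) : ContinuousOn (fun r => F r (p r)) (Icc s t) :=
  H.force.continuousOn.comp (continuousOn_id.prodMk htr.continuousOn_position)
    fun _ hr => ⟨htr.subset hr, mem_univ _⟩

lemma norm_velocity_sub_le (H : ForceSetting T Vmin c A a X V F DF)
    (htr : IsTrajectory F T s t p w) (hσ : IsPassing T Vmin X V s t p σ) :
    ‖w s - w t‖ ≤ momentBound c A a Vmin := by
  have h1 := velocity_backward htr.le htr.velocity (H.continuousOn_force htr)
  have h2 : w s - w t = -∫ r in s..t, F r (p r) := by rw [h1]; abel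
  rw [h2, norm_neg]
  refine (intervalIntegral.norm_integral_le_of_norm_le htr.le
    (Filter.Eventually.of_forall fun r hr => H.norm_force_le htr hσ (Ioc_subset_Icc_self hr))
    ((continuous_forceMajorant _ _ _ _).intervalIntegrable _ _)).trans ?_
  exact H.zeroth_moment_le htr.le

/-- In the Taylor remainder r-s is at most |r-σ| + (σ-s): the first moment bounds the first part,
and the zeroth moment times the delay bounds the second. -/
lemma norm_position_sub_le (H : ForceSetting T Vmin c A a X V F DF)
    (htr : IsTrajectory F T s t p w) (hσ : IsPassing T Vmin X V s t p σ) :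
    ‖p s - (p t - (t - s) • w t)‖ ≤ momentBound c A a Vmin * (1 + (σ - s)) := by
  have h1 := taylor_backward htr.le htr.position htr.velocity (H.continuousOn_force htr)
  have h2 : p s - (p t - (t - s) • w t) = ∫ r in s..t, (r - s) • F r (p r) := by rw [h1]; abel
  set β := forceMajorant c A (a * Vmin / 2) σ with hβ
  have hβc : Continuous β := continuous_forceMajorant _ _ _ _
  have hβ0 : ∀ r, 0 ≤ β r := fun r => forceMajorant_nonneg H.c_nonneg H.A_nonneg r
  have hM0 : ∫ r in s..t, β r ≤ momentBound c A a Vmin := H.zeroth_moment_le htr.le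
  have hM1 : ∫ r in s..t, |r - σ| * β r ≤ momentBound c A a Vmin := H.first_moment_le htr.le
  have hi0 : IntervalIntegrable β volume s t := hβc.intervalIntegrable _ _
  have hi1 : IntervalIntegrable (fun r => |r - σ| * β r) volume s t :=
    Continuous.intervalIntegrable (by fun_prop) _ _
  rw [h2]
  refine (intervalIntegral.norm_integral_le_of_norm_le (g := fun r => |r - σ| * β r
    + (σ - s) * β r) htr.le (Filter.Eventually.of_forall fun r hr => ?_)
    (hi1.add (hi0.const_mul _))).trans ?_
  · have hr' := Ioc_subset_Icc_self hr
    rw [norm_smul, Real.norm_of_nonneg (sub_nonneg.2 hr'.1), ← add_mul]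
    exact mul_le_mul (by linarith [le_abs_self (r - σ)]) (H.norm_force_le htr hσ hr')
      (norm_nonneg _) (add_nonneg (abs_nonneg _) (sub_nonneg.2 hσ.mem.1))
  · rw [intervalIntegral.integral_add hi1 (hi0.const_mul _), intervalIntegral.integral_const_mul]
    nlinarith [mul_le_mul_of_nonneg_left hM0 (sub_nonneg.2 hσ.mem.1)]

/-- A particle that is slow at time `s` remains slow afterwards. -/
lemma velocity_stays (H : ForceSetting T Vmin c A a X V F DF)
    (htr : IsTrajectory F T s t p w) (hw : ‖w s‖ ≤ Vmin / 4) :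
    ∀ r ∈ Icc s t, ‖w r - w s‖ < 1 := by
  by_contra! hcon
  obtain ⟨r₀, hr₀, h₀⟩ := hcon
  set g : ℝ → ℝ := fun r => ‖w r - w s‖ with hg
  have hgc : ContinuousOn g (Icc s t) := (htr.continuousOn_velocity.sub continuousOn_const).norm
  have hivt : ∀ r ∈ Icc s t, 1 ≤ g r → ∃ r' ∈ Icc s r, g r' = 1 := by
    intro r hr h1
    have hc' : ContinuousOn g (Icc s r) := hgc.mono (Icc_subset_Icc_right hr.2)
    obtain ⟨r', hr', h2⟩ := intermediate_value_Icc hr.1 hc'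
      (show (1 : ℝ) ∈ Icc (g s) (g r) from ⟨by simp [hg], h1⟩)
    exact ⟨r', hr', h2⟩
  -- Continuity argument: let r₁ be the first time at which the deviation equals 1. Up to r₁ the
  -- speed is at most Vmin/4 + 1 ≤ Vmin/2, so a passing time exists and the deviation is bounded by
  -- the zeroth moment, hence by 1/2, a contradiction.
  have hcl : IsCompact (Icc s t ∩ g ⁻¹' {1}) :=
    isCompact_Icc.of_isClosed_subset (hgc.preimage_isClosed_of_isClosed isClosed_Icc
      isClosed_singleton) inter_subset_left
  obtain ⟨r₁, ⟨hr₁, h1⟩, hleast⟩ := hcl.exists_isLeast (by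
    obtain ⟨r', hr', h2⟩ := hivt r₀ hr₀ h₀
    exact ⟨r', ⟨hr'.1, hr'.2.trans hr₀.2⟩, h2⟩)
  have h1 : g r₁ = 1 := h1
  have hle : ∀ r ∈ Icc s r₁, g r ≤ 1 := by
    intro r hr
    by_contra! hgt
    have hr' : r ∈ Icc s t := ⟨hr.1, hr.2.trans hr₁.2⟩
    obtain ⟨r', hr'', h2⟩ := hivt r hr' hgt.le
    have h3 : r₁ ≤ r' := hleast ⟨⟨hr''.1, hr''.2.trans hr'.2⟩, h2⟩
    have h4 : r = r₁ := le_antisymm hr.2 (h3.trans hr''.2)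
    rw [h4, h1] at hgt
    exact lt_irrefl _ hgt
  have htr' := htr.mono le_rfl hr₁.1 hr₁.2
  obtain ⟨σ, hσ⟩ := H.motion.exists_isPassing H.one_le_Vmin htr'.nonneg htr'.le htr'.le_end
    htr'.position (fun r hr => by
      have h2 : ‖w r‖ ≤ ‖w s‖ + ‖w r - w s‖ := by
        have := norm_add_le (w s) (w r - w s)
        rwa [add_sub_cancel] at this
      have h3 := hle r hr
      have h4 := abs_coord_le_norm (w r) 0
      have h5 := H.Vmin_large
      simp only [hg] at h3
      linarith)
  have h6 := H.norm_velocity_sub_le htr' hσ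
  rw [norm_sub_rev] at h6
  have h7 := H.moment_small
  simp only [hg] at h1
  linarith

lemma exists_isPassing (H : ForceSetting T Vmin c A a X V F DF)
    (htr : IsTrajectory F T s t p w) (hw : ‖w s‖ ≤ Vmin / 4) :
    ∃ σ, IsPassing T Vmin X V s t p σ := by
  refine H.motion.exists_isPassing H.one_le_Vmin htr.nonneg htr.le htr.le_end
    htr.position (fun r hr => ?_)
  have h2 : ‖w r‖ ≤ ‖w s‖ + ‖w r - w s‖ := by
    have := norm_add_le (w s) (w r - w s)
    rwa [add_sub_cancel] at this
  have h3 := H.velocity_stays htr hw r hr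
  have h4 := abs_coord_le_norm (w r) 0
  have h5 := H.Vmin_large
  linarith

/-- Estimate of the linearized flow along a slow trajectory, for data that focus at time `s`. -/
lemma linearized_le (H : ForceSetting T Vmin c A a X V F DF)
    (htr : IsTrajectory F T s t p w) (hσ : IsPassing T Vmin X V s t p σ)
    {G : Type*} [NormedAddCommGroup G] [NormedSpace ℝ G] [CompleteSpace G] {q u b : ℝ → G}
    (hq : ∀ r ∈ Icc s t, HasDerivWithinAt q (u r) (Icc s t) r)
    (hu : ∀ r ∈ Icc s t, HasDerivWithinAt u (b r) (Icc s t) r) (hb : ContinuousOn b (Icc s t))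
    (hbq : ∀ r ∈ Icc s t, ‖b r‖ ≤ ‖DF r (p r)‖ * ‖q r‖) (hq1 : ‖q t‖ ≤ 1)
    (hut : u t = (1 + (t - s))⁻¹ • q t) :
    ‖q s‖ + ‖u s‖ ≤ (1 + (t - s))⁻¹ * (4 * (1 + (σ - s)) * Real.exp
      (2 * (momentBound c A a Vmin * (1 + 2 * (σ - s)) + secondMomentBound c A a Vmin T))) := by
  set β := forceMajorant c A (a * Vmin / 2) σ with hβ
  set ε := momentBound c A a Vmin with hε
  set N := secondMomentBound c A a Vmin T with hN
  set L := σ - s with hL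
  have hL0 : 0 ≤ L := sub_nonneg.2 hσ.mem.1
  have hε0 : 0 ≤ ε := H.momentBound_nonneg
  have hε1 : ε ≤ 1 / 2 := H.moment_small
  have hβc : Continuous β := continuous_forceMajorant _ _ _ _
  have hβ0 : ∀ r, 0 ≤ β r := fun r => forceMajorant_nonneg H.c_nonneg H.A_nonneg r
  have hM0 : ∫ r in s..t, β r ≤ ε := H.zeroth_moment_le htr.le
  have hM1 : ∫ r in s..t, |r - σ| * β r ≤ ε := H.first_moment_le htr.le
  have hM2 : ∫ r in s..t, |r - σ| ^ 2 * β r ≤ N :=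
    second_moment_le (T := T) H.c_nonneg H.A_nonneg H.rate_large hσ.mem
      (by linarith [htr.nonneg, htr.le_end])
  have hi0 : IntervalIntegrable β volume s t := hβc.intervalIntegrable _ _
  have hi1 : IntervalIntegrable (fun r => |r - σ| * β r) volume s t :=
    Continuous.intervalIntegrable (by fun_prop) _ _
  have hi2 : IntervalIntegrable (fun r => |r - σ| ^ 2 * β r) volume s t :=
    Continuous.intervalIntegrable (by fun_prop) _ _
  set η := (1 + (t - s))⁻¹ with hη
  have hts : 0 ≤ t - s := sub_nonneg.2 htr.le
  have hη0 : 0 < η := by positivity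
  have hη1 : η * (1 + (t - s)) = 1 := inv_mul_cancel₀ (by positivity)
  -- For free motion ‖q r‖ = η(1+(r-s))‖q t‖. Adding the delay L to this growth bounds the ratio
  -- ω(r)/ω(s') by 2(1+|r-σ|), uniformly in s'.
  set ω : ℝ → ℝ := fun r => 1 + (r - s) + L with hω
  have hω0 : ∀ r ∈ Icc s t, 0 < ω r := fun r hr => by
    have := hr.1
    simp only [hω]; linarith
  -- The Grönwall kernel for ‖q‖/(ηω): L+|r-σ| bounds the Taylor factor r-s', and 2(1+|r-σ|) the
  -- ratio of weights. Expanding the product uses exactly the moments of order 0, 1 and 2.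
  set k : ℝ → ℝ := fun r => 2 * (L + |r - σ|) * (1 + |r - σ|) * β r with hk
  have hkc : Continuous k := by simp only [hk]; fun_prop
  have hk0 : ∀ r, 0 ≤ k r := fun r => by
    have := hβ0 r
    simp only [hk]; positivity
  set Λ := 2 * (ε * (1 + 2 * L) + N) with hΛ
  have hkΛ : ∫ r in s..t, k r ≤ Λ := by
    have e : ∀ r, k r = 2 * L * β r + (2 * (L + 1)) * (|r - σ| * β r) + 2 * (|r - σ| ^ 2 * β r) :=
      fun r => by simp only [hk]; ring
    simp only [e]
    rw [intervalIntegral.integral_add ((hi0.const_mul _).add (hi1.const_mul _)) (hi2.const_mul _),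
      intervalIntegral.integral_add (hi0.const_mul _) (hi1.const_mul _),
      intervalIntegral.integral_const_mul, intervalIntegral.integral_const_mul,
      intervalIntegral.integral_const_mul]
    have h1 := mul_le_mul_of_nonneg_left hM0 (by positivity : 0 ≤ 2 * L)
    have h2 := mul_le_mul_of_nonneg_left hM1 (by positivity : 0 ≤ 2 * (L + 1))
    rw [hΛ]
    linarith
  set Q : ℝ → ℝ := fun r => ‖q r‖ / (η * ω r) with hQ
  have hqc : ContinuousOn q (Icc s t) := fun r hr => (hq r hr).continuousWithinAt
  have hQc : ContinuousOn Q (Icc s t) := by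
    refine hqc.norm.div (by simp only [hω]; fun_prop) fun r hr => ?_
    exact (mul_pos hη0 (hω0 r hr)).ne'
  have hqQ : ∀ r ∈ Icc s t, ‖q r‖ = η * ω r * Q r := fun r hr => by
    simp only [hQ]
    rw [mul_div_cancel₀ _ (mul_pos hη0 (hω0 r hr)).ne']
  have hineq : ∀ s' ∈ Icc s t, Q s' ≤ 1 + ∫ r in s'..t, k r * Q r := by
    intro s' hs'
    have hsub : Icc s' t ⊆ Icc s t := Icc_subset_Icc_left hs'.1
    have h1 := taylor_backward hs'.2 (fun r hr => (hq r (hsub hr)).mono hsub)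
      (fun r hr => (hu r (hsub hr)).mono hsub) (hb.mono hsub)
    have hω' := hω0 s' hs'
    have hden : 0 < η * ω s' := mul_pos hη0 hω'
    -- With final data u = ηq, the free solution at s' is η(1+(s'-s)) times q t, because η(1+(t-s))
    -- = 1.
    have hfree : ‖q t - (t - s') • u t‖ ≤ η * ω s' := by
      have e : q t - (t - s') • u t = (η * (1 + (s' - s))) • q t := by
        rw [hut, smul_smul]
        nth_rw 1 [← one_smul ℝ (q t)]
        rw [← sub_smul]
        congr 1
        linear_combination -hη1
      rw [e, norm_smul, Real.norm_of_nonneg (mul_nonneg hη0.le (by linarith [hs'.1]))]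
      have h2 : η * (1 + (s' - s)) ≤ η * ω s' := by
        refine mul_le_mul_of_nonneg_left ?_ hη0.le
        simp only [hω]
        linarith
      have h3 : 0 ≤ η * (1 + (s' - s)) := mul_nonneg hη0.le (by linarith [hs'.1])
      nlinarith
    have hint : ‖∫ r in s'..t, (r - s') • b r‖ ≤ ∫ r in s'..t, η * ω s' * (k r * Q r) := by
      refine intervalIntegral.norm_integral_le_of_norm_le hs'.2
        (Filter.Eventually.of_forall fun r hr => ?_) ?_
      · have hr' : r ∈ Icc s' t := Ioc_subset_Icc_self hr
        have hr'' := hsub hr'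
        rw [norm_smul, Real.norm_of_nonneg (sub_nonneg.2 hr'.1)]
        have h2 : ‖b r‖ ≤ β r * (η * ω r * Q r) := by
          refine (hbq r hr'').trans ?_
          rw [← hqQ r hr'']
          gcongr
          exact H.norm_deriv_le htr hσ hr''
        have hQ0 : 0 ≤ Q r := div_nonneg (norm_nonneg _) (mul_pos hη0 (hω0 r hr'')).le
        have hu0 := abs_nonneg (r - σ)
        have h3 : r - s' ≤ L + |r - σ| := by
          have := le_abs_self (r - σ)
          linarith [hs'.1]
        have h4 : ω r ≤ 2 * (1 + |r - σ|) * ω s' := by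
          have h5 : ω r ≤ 1 + 2 * L + |r - σ| := by
            have := le_abs_self (r - σ)
            simp only [hω]; linarith
          have h6 : 1 + L ≤ ω s' := by
            have := hs'.1
            simp only [hω]; linarith
          nlinarith [mul_nonneg hu0 hL0]
        calc (r - s') * ‖b r‖ ≤ (L + |r - σ|) * (β r * (η * (2 * (1 + |r - σ|) * ω s') * Q r)) := by
              refine mul_le_mul h3 (h2.trans ?_) (norm_nonneg _) (by positivity)
              have := hβ0 r
              gcongr
          _ = η * ω s' * (k r * Q r) := by simp only [hk]; ring
      · refine ContinuousOn.intervalIntegrable_of_Icc hs'.2 ?_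
        exact continuousOn_const.mul (hkc.continuousOn.mul (hQc.mono hsub))
    rw [intervalIntegral.integral_const_mul] at hint
    have h7 : ‖q s'‖ ≤ η * ω s' + η * ω s' * ∫ r in s'..t, k r * Q r := by
      rw [h1]
      exact (norm_add_le _ _).trans (add_le_add hfree hint)
    simp only [hQ]
    rw [div_le_iff₀ hden]
    linarith
  have hQle : ∀ s' ∈ Icc s t, Q s' ≤ Real.exp Λ := by
    intro s' hs'
    have hsub : Icc s' t ⊆ Icc s t := Icc_subset_Icc_left hs'.1
    have h1 := gronwall_backward hs'.2 (hQc.mono hsub) hkc.continuousOn (fun r _ => hk0 r)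
      (fun r hr => hineq r (hsub hr))
    rw [one_mul] at h1
    refine h1.trans (Real.exp_le_exp.2 (le_trans ?_ hkΛ))
    rw [← intervalIntegral.integral_add_adjacent_intervals (hkc.intervalIntegrable s s')
      (hkc.intervalIntegrable s' t)]
    have := intervalIntegral.integral_nonneg hs'.1 (fun r _ => hk0 r) (μ := volume)
    linarith
  have hqle : ∀ r ∈ Icc s t, ‖q r‖ ≤ η * Real.exp Λ * (1 + 2 * L + |r - σ|) := by
    intro r hr
    rw [hqQ r hr]
    have h5 : ω r ≤ 1 + 2 * L + |r - σ| := by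
      have := le_abs_self (r - σ)
      simp only [hω]; linarith
    have hQ0 : 0 ≤ Q r := div_nonneg (norm_nonneg _) (mul_pos hη0 (hω0 r hr)).le
    calc η * ω r * Q r ≤ η * (1 + 2 * L + |r - σ|) * Real.exp Λ := by
          gcongr
          · exact hQle r hr
      _ = _ := by ring
  have hΛ1 : 1 ≤ Real.exp Λ := by
    refine Real.one_le_exp ?_
    have hN0 : 0 ≤ N := le_trans (intervalIntegral.integral_nonneg htr.le fun r _ =>
      mul_nonneg (by positivity) (hβ0 r)) hM2
    positivity
  have hqs : ‖q s‖ ≤ η * Real.exp Λ * (1 + L) := by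
    have hsmem : s ∈ Icc s t := ⟨le_rfl, htr.le⟩
    rw [hqQ s hsmem]
    have e : ω s = 1 + L := by simp [hω]
    rw [e]
    calc η * (1 + L) * Q s ≤ η * (1 + L) * Real.exp Λ := by gcongr; exact hQle s hsmem
      _ = _ := by ring
  have hus : ‖u s‖ ≤ η + η * Real.exp Λ * ((1 + 2 * L) * ε + ε) := by
    rw [velocity_backward htr.le hu hb]
    refine (norm_sub_le _ _).trans (add_le_add ?_ ?_)
    · rw [hut, norm_smul, Real.norm_of_nonneg hη0.le]
      exact mul_le_of_le_one_right hη0.le hq1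
    · refine (intervalIntegral.norm_integral_le_of_norm_le (g := fun r => η * Real.exp Λ *
        ((1 + 2 * L) * β r + |r - σ| * β r)) htr.le (Filter.Eventually.of_forall fun r hr => ?_)
        (((hi0.const_mul _).add hi1).const_mul _)).trans ?_
      · have hr' := Ioc_subset_Icc_self hr
        calc ‖b r‖ ≤ β r * (η * Real.exp Λ * (1 + 2 * L + |r - σ|)) :=
              (hbq r hr').trans (mul_le_mul (H.norm_deriv_le htr hσ hr') (hqle r hr')
                (norm_nonneg _) (hβ0 r))
          _ = _ := by ring
      · rw [intervalIntegral.integral_const_mul, intervalIntegral.integral_add (hi0.const_mul _) hi1,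
          intervalIntegral.integral_const_mul]
        gcongr
  have hfin : η ≤ η * Real.exp Λ := le_mul_of_one_le_right hη0.le hΛ1
  -- This is where ε ≤ 1/2 closes the velocity estimate.
  have h9 : (1 + 2 * L) * ε + ε ≤ 1 + L := by nlinarith
  have h10 := mul_le_mul_of_nonneg_left h9 (by positivity : 0 ≤ η * Real.exp Λ)
  have h11 : 0 ≤ η * Real.exp Λ * L := by positivity
  calc ‖q s‖ + ‖u s‖ ≤ η * Real.exp Λ * (1 + L) + (η * Real.exp Λ + η * Real.exp Λ * (1 + L)) := by
        linarith
    _ ≤ η * (4 * (1 + L) * Real.exp Λ) := by linarith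

end ForceSetting

end Trajectory

end FastCharge

namespace FastCharge

/-! ### Dispersion and the gain of 1/Vmin in the time–velocity integral. -/

section Integrals

variable {G : Type*} [NormedAddCommGroup G]

/-- One-dimensional dispersion: free transport during a time `θ` spreads an exponential. -/
lemma integral_exp_mul_exp_le {k θ : ℝ} (hk : 0 < k) (hθ : 0 ≤ θ) (y : ℝ) :
    Integrable (fun v : ℝ => Real.exp (-(k * |v|)) * Real.exp (-(k * |y - θ * v|))) ∧
      ∫ v : ℝ, Real.exp (-(k * |v|)) * Real.exp (-(k * |y - θ * v|)) ≤ 4 / k / (1 + θ) := by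
  have h0 : Integrable fun v : ℝ => Real.exp (-(k * |v|)) := by
    simpa using integrable_exp_neg_abs hk 0
  have h0' : ∫ v : ℝ, Real.exp (-(k * |v|)) = 2 / k := by
    simpa using integral_exp_neg_abs hk 0
  have hint : Integrable (fun v : ℝ => Real.exp (-(k * |v|)) * Real.exp (-(k * |y - θ * v|))) := by
    refine h0.mono' (by fun_prop) (Filter.Eventually.of_forall fun v => ?_)
    rw [Real.norm_of_nonneg (by positivity)]
    refine mul_le_of_le_one_right (Real.exp_pos _).le (Real.exp_le_one_iff.2 ?_)
    have := abs_nonneg (y - θ * v)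
    nlinarith
  refine ⟨hint, ?_⟩
  -- For short times the second exponential is dropped; for long times the first is, and the scaling
  -- v ↦ θv gives the decay.
  rcases le_or_gt θ 1 with h1 | h1
  · have h2 : ∫ v : ℝ, Real.exp (-(k * |v|)) * Real.exp (-(k * |y - θ * v|)) ≤ 2 / k := by
      rw [← h0']
      refine integral_mono hint h0 fun v => ?_
      refine mul_le_of_le_one_right (Real.exp_pos _).le (Real.exp_le_one_iff.2 ?_)
      have := abs_nonneg (y - θ * v)
      nlinarith
    refine h2.trans ?_
    rw [le_div_iff₀ (by positivity)]
    have e : 4 / k = 2 / k * 2 := by ring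
    rw [e]
    gcongr
    linarith
  · have hθ0 : 0 < θ := zero_lt_one.trans h1
    have e1 : ∀ v : ℝ, Real.exp (-(k * |y - θ * v|)) = Real.exp (-((k * θ) * |v - y / θ|)) := by
      intro v
      have : y - θ * v = -(θ * (v - y / θ)) := by field_simp; ring
      rw [this, abs_neg, abs_mul, abs_of_pos hθ0]
      ring_nf
    have h2 : ∫ v : ℝ, Real.exp (-(k * |v|)) * Real.exp (-(k * |y - θ * v|)) ≤ 2 / (k * θ) := by
      rw [← integral_exp_neg_abs (mul_pos hk hθ0) (y / θ)]
      refine integral_mono hint (integrable_exp_neg_abs (mul_pos hk hθ0) _) fun v => ?_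
      simp only [e1]
      refine mul_le_of_le_one_left (Real.exp_pos _).le (Real.exp_le_one_iff.2 ?_)
      have := abs_nonneg v
      nlinarith
    refine h2.trans ?_
    rw [div_div, div_le_div_iff₀ (by positivity) (by positivity)]
    nlinarith

/-- Without continuity g may jump over zero, so the supremum of {g ≤ 0} replaces the root. -/
lemma exists_abs_ge_of_growth {g : ℝ → ℝ} {β : ℝ} (hβ : 0 < β)
    (hg : ∀ r s, r ≤ s → β * (s - r) ≤ g s - g r) : ∃ s₀, ∀ s, β * |s - s₀| ≤ |g s| := by
  set S := {s : ℝ | g s ≤ 0} with hS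
  have hne : S.Nonempty := by
    refine ⟨-(|g 0| / β), ?_⟩
    have h1 : (0 : ℝ) ≤ |g 0| / β := by positivity
    have := hg (-(|g 0| / β)) 0 (by linarith)
    rw [sub_neg_eq_add, zero_add, mul_div_cancel₀ _ hβ.ne'] at this
    change g _ ≤ 0
    linarith [le_abs_self (g 0)]
  have hbd : BddAbove S := by
    refine ⟨|g 0| / β, fun s hs => ?_⟩
    have hs : g s ≤ 0 := hs
    by_contra! hlt
    have h1 : (0 : ℝ) ≤ |g 0| / β := by positivity
    have h2 := hg 0 s (by linarith)
    rw [sub_zero] at h2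
    have h3 : |g 0| < β * s := by rwa [div_lt_iff₀ hβ, mul_comm] at hlt
    linarith [neg_abs_le (g 0)]
  refine ⟨sSup S, fun s => ?_⟩
  rcases le_or_gt s (sSup S) with h | h
  · rw [abs_of_nonpos (by linarith)]
    have h1 : s + |g s| / β ≥ sSup S := by
      refine csSup_le hne fun r hr => ?_
      have hr : g r ≤ 0 := hr
      by_contra! hlt
      have h2 : (0 : ℝ) ≤ |g s| / β := by positivity
      have h3 := hg s r (by linarith)
      have h4 : |g s| < β * (r - s) := by
        have : |g s| / β < r - s := by linarith
        rwa [div_lt_iff₀ hβ, mul_comm] at this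
      linarith [neg_abs_le (g s)]
    have h5 : sSup S - s ≤ |g s| / β := by linarith
    rw [le_div_iff₀ hβ] at h5
    linarith
  · rw [abs_of_pos (by linarith)]
    have h1 : s - |g s| / β ≤ sSup S := by
      by_contra! hlt
      obtain ⟨r, hr1, hr2⟩ := exists_between hlt
      have h2 : (0 : ℝ) ≤ |g s| / β := by positivity
      have h3 := hg r s (by linarith)
      have h4 : 0 < g r := by
        by_contra! hle
        exact absurd (le_csSup hbd hle) (not_le.2 hr1)
      have h5 : |g s| / β < s - r := by linarith
      rw [div_lt_iff₀ hβ, mul_comm] at h5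
      linarith [le_abs_self (g s)]
    have h5 : s - sSup S ≤ |g s| / β := by linarith
    rw [le_div_iff₀ hβ] at h5
    linarith

/-- Factorizes exponentials of the norm over the coordinates, at the price of a third of the rate.
-/
lemma sum_abs_le (v : E3) : |v 0| + |v 1| + |v 2| ≤ 3 * ‖v‖ := by
  linarith [abs_coord_le_norm v 0, abs_coord_le_norm v 1, abs_coord_le_norm v 2]

/-- The velocity integral at a fixed time is controlled by a one-dimensional one. -/
lemma lintegral_velocity_le {c θ b : ℝ} (hc : 0 < c) (hθ : 0 ≤ θ) (y : E3) :
    ∫⁻ v : E3, ENNReal.ofReal ({v : E3 | |v 0| ≤ b}.indicator (fun v => (1 + θ) ^ 2 *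
        (Real.exp (-(c * ‖v‖)) * Real.exp (-(c * ‖y - θ • v‖)))) v)
      ≤ ENNReal.ofReal ((12 / c) ^ 2) * ∫⁻ r : ℝ, ENNReal.ofReal ({r : ℝ | |r| ≤ b}.indicator
        (fun r => Real.exp (-(c / 3 * |r|)) * Real.exp (-(c / 3 * |y 0 - θ * r|))) r) := by
  have hk : 0 < c / 3 := by positivity
  set g : Fin 3 → ℝ → ℝ := fun i r =>
    Real.exp (-(c / 3 * |r|)) * Real.exp (-(c / 3 * |y i - θ * r|)) with hg
  have hgi : ∀ i, Integrable (g i) := fun i => (integral_exp_mul_exp_le hk hθ (y i)).1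
  have hgle : ∀ i, ∫ r, g i r ≤ 12 / c / (1 + θ) := fun i => by
    refine (integral_exp_mul_exp_le hk hθ (y i)).2.trans (le_of_eq ?_)
    field_simp
    norm_num
  have hg0 : ∀ i r, 0 ≤ g i r := fun i r => by simp only [hg]; positivity
  -- The two transversal factors disperse and cancel (1+θ)^2. The longitudinal one keeps its cutoff
  -- and is saved for the time integration.
  set g' : Fin 3 → ℝ → ℝ := ![{r : ℝ | |r| ≤ b}.indicator (g 0), g 1, g 2] with hg'
  have hmb : MeasurableSet {r : ℝ | |r| ≤ b} := measurableSet_le (by fun_prop) (by fun_prop)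
  have hg'i : ∀ i, Integrable (g' i) := by
    intro i
    fin_cases i
    · exact (hgi 0).indicator hmb
    · exact hgi 1
    · exact hgi 2
  have hi0 : 0 ≤ ∫ r, g' 0 r :=
    integral_nonneg fun r => indicator_nonneg (fun r _ => hg0 0 r) r
  have hprod : Integrable fun v : Fin 3 → ℝ => ∏ i, g' i (v i) :=
    Integrable.fintype_prod hg'i
  have hmp := PiLp.volume_preserving_ofLp (Fin 3)
  have hprod' : Integrable fun v : E3 => ∏ i, g' i (v i) :=
    (hmp.integrable_comp_emb (MeasurableEquiv.toLp 2 (Fin 3 → ℝ)).symm.measurableEmbedding).2 hprod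
  have hval : ∫ v : E3, ∏ i, g' i (v i) = ∏ i, ∫ r, g' i r := by
    rw [← integral_fintype_prod_volume_eq_prod]
    exact hmp.integral_comp (MeasurableEquiv.toLp 2 (Fin 3 → ℝ)).symm.measurableEmbedding
      (fun v : Fin 3 → ℝ => ∏ i, g' i (v i))
  have hpoint : ∀ v : E3, {v : E3 | |v 0| ≤ b}.indicator (fun v => (1 + θ) ^ 2 *
      (Real.exp (-(c * ‖v‖)) * Real.exp (-(c * ‖y - θ • v‖)))) v
        ≤ (1 + θ) ^ 2 * ∏ i, g' i (v i) := by
    intro v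
    by_cases hv : |v 0| ≤ b
    · rw [indicator_of_mem (show v ∈ {v : E3 | |v 0| ≤ b} from hv), Fin.prod_univ_three]
      have e0 : g' 0 (v 0) = g 0 (v 0) :=
        indicator_of_mem (f := g 0) (show v 0 ∈ {r : ℝ | |r| ≤ b} from hv)
      have e1 : g' 1 (v 1) = g 1 (v 1) := rfl
      have e2 : g' 2 (v 2) = g 2 (v 2) := rfl
      rw [e0, e1, e2]
      refine mul_le_mul_of_nonneg_left ?_ (by positivity)
      simp only [hg]
      rw [← Real.exp_add, ← Real.exp_add, ← Real.exp_add, ← Real.exp_add, ← Real.exp_add,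
        ← Real.exp_add]
      refine Real.exp_le_exp.2 ?_
      have h1 := sum_abs_le v
      have h2 := sum_abs_le (y - θ • v)
      simp only [PiLp.sub_apply, PiLp.smul_apply, smul_eq_mul] at h2
      nlinarith [mul_le_mul_of_nonneg_left h1 hk.le, mul_le_mul_of_nonneg_left h2 hk.le]
    · rw [indicator_of_notMem (show v ∉ {v : E3 | |v 0| ≤ b} from hv)]
      refine mul_nonneg (by positivity) (Finset.prod_nonneg fun i _ => ?_)
      fin_cases i
      · exact indicator_nonneg (fun r _ => hg0 0 r) _
      · exact hg0 1 _
      · exact hg0 2 _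
  calc _ ≤ ∫⁻ v : E3, ENNReal.ofReal ((1 + θ) ^ 2 * ∏ i, g' i (v i)) :=
        lintegral_mono fun v => ENNReal.ofReal_le_ofReal (hpoint v)
    _ = ENNReal.ofReal (∫ v : E3, (1 + θ) ^ 2 * ∏ i, g' i (v i)) := by
        rw [ofReal_integral_eq_lintegral_ofReal (hprod'.const_mul _)]
        refine Filter.Eventually.of_forall fun v => mul_nonneg (by positivity)
          (Finset.prod_nonneg fun i _ => ?_)
        fin_cases i
        · exact indicator_nonneg (fun r _ => hg0 0 r) _
        · exact hg0 1 _
        · exact hg0 2 _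
    _ ≤ ENNReal.ofReal ((12 / c) ^ 2 * ∫ r, g' 0 r) := by
        refine ENNReal.ofReal_le_ofReal ?_
        rw [integral_const_mul, hval, Fin.prod_univ_three]
        have h1 : ∫ r, g' 1 r ≤ 12 / c / (1 + θ) := hgle 1
        have h2 : ∫ r, g' 2 r ≤ 12 / c / (1 + θ) := hgle 2
        have h2' : 0 ≤ ∫ r, g' 2 r := integral_nonneg fun r => hg0 2 r
        calc (1 + θ) ^ 2 * ((∫ r, g' 0 r) * (∫ r, g' 1 r) * ∫ r, g' 2 r)
            ≤ (1 + θ) ^ 2 * ((∫ r, g' 0 r) * (12 / c / (1 + θ)) * (12 / c / (1 + θ))) := by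
              gcongr
          _ = (12 / c) ^ 2 * ∫ r, g' 0 r := by
              field_simp
    _ = _ := by
        rw [ENNReal.ofReal_mul (by positivity),
          ofReal_integral_eq_lintegral_ofReal (hg'i 0)
            (Filter.Eventually.of_forall fun r => indicator_nonneg (fun r _ => hg0 0 r) r)]
        rfl

/-- The constant in `integrableOn_of_bound`. -/
noncomputable def dispersionConst (c : ℝ) : ℝ := (12 / c) ^ 2 * (6 / c * (12 / c))

/-- By Tonelli the time integral is taken first. For |r| ≤ b the function y₀ s + (t-s)r - x₀ grows
at rate at least 2b - b = b, so its exponential has time integral O(1/b). -/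
lemma lintegral_time_velocity_le {c b t x₀ : ℝ} (hc : 0 < c) (hb : 0 < b) {y₀ : ℝ → ℝ}
    (hy₀ : ∀ r s, r ≤ s → 2 * b * (s - r) ≤ y₀ s - y₀ r) :
    ∫⁻ s : ℝ, ∫⁻ r : ℝ, ENNReal.ofReal ({r : ℝ | |r| ≤ b}.indicator
        (fun r => Real.exp (-(c / 3 * |r|)) * Real.exp (-(c / 3 * |x₀ - y₀ s - (t - s) * r|))) r)
      ≤ ENNReal.ofReal (6 / c * (6 / c / b)) := by
  have hk : 0 < c / 3 := by positivity
  have hmono : Monotone y₀ := fun r s hrs => by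
    have := hy₀ r s hrs
    have h2 : 0 ≤ 2 * b * (s - r) := mul_nonneg (by positivity) (sub_nonneg.2 hrs)
    linarith
  have hmeas : Measurable y₀ := hmono.measurable
  have hmb : MeasurableSet {r : ℝ | |r| ≤ b} := measurableSet_le (by fun_prop) (by fun_prop)
  have hmb' : MeasurableSet {p : ℝ × ℝ | |p.2| ≤ b} := measurableSet_le (by fun_prop) (by fun_prop)
  rw [lintegral_lintegral_swap]
  · have hinner : ∀ r : ℝ, ∫⁻ s : ℝ, ENNReal.ofReal ({r : ℝ | |r| ≤ b}.indicator
        (fun r => Real.exp (-(c / 3 * |r|)) * Real.exp (-(c / 3 * |x₀ - y₀ s - (t - s) * r|))) r)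
        ≤ ENNReal.ofReal (6 / c / b) * ENNReal.ofReal (Real.exp (-(c / 3 * |r|))) := by
      intro r
      by_cases hr : |r| ≤ b
      · obtain ⟨s₀, hs₀⟩ := exists_abs_ge_of_growth (g := fun s => y₀ s + (t - s) * r - x₀) hb
          (fun s₁ s₂ h12 => by
            have h1 := hy₀ s₁ s₂ h12
            have h2 := mul_le_mul_of_nonneg_left ((le_abs_self r).trans hr) (sub_nonneg.2 h12)
            linarith)
        have hle : ∀ s, Real.exp (-(c / 3 * |x₀ - y₀ s - (t - s) * r|))
            ≤ Real.exp (-((c / 3 * b) * |s - s₀|)) := by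
          intro s
          refine Real.exp_le_exp.2 ?_
          have h1 := hs₀ s
          have e : |x₀ - y₀ s - (t - s) * r| = |y₀ s + (t - s) * r - x₀| := by
            rw [← abs_neg]; ring_nf
          rw [e]
          nlinarith [mul_le_mul_of_nonneg_left h1 hk.le]
        simp only [indicator_of_mem (show r ∈ {r : ℝ | |r| ≤ b} from hr)]
        calc _ ≤ ∫⁻ s : ℝ, ENNReal.ofReal (Real.exp (-((c / 3 * b) * |s - s₀|)))
              * ENNReal.ofReal (Real.exp (-(c / 3 * |r|))) := by
              refine lintegral_mono fun s => ?_
              rw [← ENNReal.ofReal_mul (Real.exp_pos _).le, mul_comm (Real.exp (-(c / 3 * |r|)))]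
              exact ENNReal.ofReal_le_ofReal
                (mul_le_mul_of_nonneg_right (hle s) (Real.exp_pos _).le)
          _ = ENNReal.ofReal (6 / c / b) * ENNReal.ofReal (Real.exp (-(c / 3 * |r|))) := by
              rw [lintegral_mul_const _ (by fun_prop), ← ofReal_integral_eq_lintegral_ofReal
                (integrable_exp_neg_abs (by positivity) s₀)
                (Filter.Eventually.of_forall fun s => (Real.exp_pos _).le),
                integral_exp_neg_abs (by positivity)]
              congr 2
              field_simp
              norm_num
      · simp only [indicator_of_notMem (show r ∉ {r : ℝ | |r| ≤ b} from hr)]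
        simp
    refine (lintegral_mono hinner).trans (le_of_eq ?_)
    have h0 : Integrable fun v : ℝ => Real.exp (-(c / 3 * |v|)) := by
      simpa using integrable_exp_neg_abs hk 0
    have h0' : ∫ v : ℝ, Real.exp (-(c / 3 * |v|)) = 2 / (c / 3) := by
      simpa using integral_exp_neg_abs hk 0
    rw [lintegral_const_mul _ (by fun_prop), ← ofReal_integral_eq_lintegral_ofReal h0
      (Filter.Eventually.of_forall fun s => (Real.exp_pos _).le), h0',
      ← ENNReal.ofReal_mul (by positivity)]
    congr 1
    field_simp
    norm_num
  · refine Measurable.aemeasurable (ENNReal.measurable_ofReal.comp ?_)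
    have e : Function.uncurry (fun (s r : ℝ) => {r : ℝ | |r| ≤ b}.indicator
        (fun r => Real.exp (-(c / 3 * |r|)) * Real.exp (-(c / 3 * |x₀ - y₀ s - (t - s) * r|))) r)
        = {p : ℝ × ℝ | |p.2| ≤ b}.indicator (fun p => Real.exp (-(c / 3 * |p.2|)) *
          Real.exp (-(c / 3 * |x₀ - y₀ p.1 - (t - p.1) * p.2|))) := by
      ext p
      simp only [Function.uncurry, indicator]
      rfl
    have hm2 : Measurable fun p : ℝ × ℝ => Real.exp (-(c / 3 * |p.2|)) *
          Real.exp (-(c / 3 * |x₀ - y₀ p.1 - (t - p.1) * p.2|)) := by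
      have := hmeas.comp (measurable_fst : Measurable (Prod.fst : ℝ × ℝ → ℝ))
      fun_prop
    have := hm2.indicator hmb'
    rw [← e] at this
    exact this

/-- Integrability in time and velocity of a function that is concentrated where free transport
meets a fast curve, with a bound that is inversely proportional to the speed of the curve. -/
theorem integrableOn_of_bound {c Vmin t M : ℝ} (hc : 0 < c) (hVmin : 0 < Vmin) (hM : 0 ≤ M)
    {S : Set ℝ} (hS : MeasurableSet S) (hSt : ∀ s ∈ S, s ≤ t) {Y : ℝ → E3} {y₀ : ℝ → ℝ}
    (hY : ∀ s ∈ S, Y s 0 = y₀ s) (hy₀ : ∀ r s, r ≤ s → Vmin * (s - r) ≤ y₀ s - y₀ r) (x : E3)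
    {f : ℝ × E3 → G} (hf : AEStronglyMeasurable f (volume.restrict (S ×ˢ univ)))
    (hbound : ∀ s ∈ S, ∀ v, ‖f (s, v)‖ ≤ M * ((1 + (t - s)) ^ 2 *
      (Real.exp (-(c * ‖v‖)) * Real.exp (-(c * ‖x - (t - s) • v - Y s‖)))))
    (hzero : ∀ s ∈ S, ∀ v, Vmin / 2 < |v 0| → f (s, v) = 0) :
    IntegrableOn f (S ×ˢ univ) ∧
      ∫ p in S ×ˢ univ, ‖f p‖ ≤ M * dispersionConst c / Vmin := by
  have hb : 0 < Vmin / 2 := by positivity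
  -- Working with the Lebesgue integral of the norm gives integrability and the bound at once.
  have hlint : ∫⁻ p in S ×ˢ univ, ‖f p‖ₑ ≤ ENNReal.ofReal (M * dispersionConst c / Vmin) := by
    rw [Measure.volume_eq_prod, ← Measure.prod_restrict, Measure.restrict_univ] at hf ⊢
    rw [lintegral_prod _ hf.enorm]
    calc ∫⁻ s in S, ∫⁻ v, ‖f (s, v)‖ₑ
        ≤ ∫⁻ s in S, ENNReal.ofReal M * (ENNReal.ofReal ((12 / c) ^ 2) *
          ∫⁻ r : ℝ, ENNReal.ofReal ({r : ℝ | |r| ≤ Vmin / 2}.indicator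
          (fun r => Real.exp (-(c / 3 * |r|)) *
            Real.exp (-(c / 3 * |x 0 - y₀ s - (t - s) * r|))) r)) := by
          refine setLIntegral_mono' hS fun s hs => ?_
          have h1 := lintegral_velocity_le (b := Vmin / 2) hc (sub_nonneg.2 (hSt s hs)) (x - Y s)
          simp only [PiLp.sub_apply, hY s hs] at h1
          refine le_trans ?_ (mul_le_mul_right h1 (ENNReal.ofReal M))
          rw [← lintegral_const_mul' _ _ ENNReal.ofReal_ne_top]
          refine lintegral_mono fun v => ?_
          rw [← ENNReal.ofReal_mul hM, ← ofReal_norm]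
          refine ENNReal.ofReal_le_ofReal ?_
          by_cases hv : |v 0| ≤ Vmin / 2
          · rw [indicator_of_mem (show v ∈ {v : E3 | |v 0| ≤ Vmin / 2} from hv)]
            have h2 := hbound s hs v
            rwa [sub_right_comm] at h2
          · rw [indicator_of_notMem (show v ∉ {v : E3 | |v 0| ≤ Vmin / 2} from hv),
              hzero s hs v (not_le.1 hv)]
            simp
      _ ≤ ∫⁻ s, ENNReal.ofReal M * (ENNReal.ofReal ((12 / c) ^ 2) *
          ∫⁻ r : ℝ, ENNReal.ofReal ({r : ℝ | |r| ≤ Vmin / 2}.indicator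
          (fun r => Real.exp (-(c / 3 * |r|)) *
            Real.exp (-(c / 3 * |x 0 - y₀ s - (t - s) * r|))) r)) := setLIntegral_le_lintegral _ _
      _ ≤ ENNReal.ofReal M * (ENNReal.ofReal ((12 / c) ^ 2) *
            ENNReal.ofReal (6 / c * (6 / c / (Vmin / 2)))) := by
          rw [lintegral_const_mul' _ _ ENNReal.ofReal_ne_top,
            lintegral_const_mul' _ _ ENNReal.ofReal_ne_top]
          gcongr
          exact lintegral_time_velocity_le hc hb (fun r s hrs => by
            have := hy₀ r s hrs
            linarith)
      _ = ENNReal.ofReal (M * dispersionConst c / Vmin) := by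
          rw [← ENNReal.ofReal_mul (by positivity), ← ENNReal.ofReal_mul hM]
          congr 1
          unfold dispersionConst
          field_simp
          ring
  have hint : IntegrableOn f (S ×ˢ univ) := ⟨hf, hlint.trans_lt ENNReal.ofReal_lt_top⟩
  refine ⟨hint, ?_⟩
  rw [integral_norm_eq_lintegral_enorm hf]
  refine ENNReal.toReal_le_of_le_ofReal ?_ hlint
  unfold dispersionConst
  positivity

end Integrals

end FastCharge

namespace FastCharge

/-! ### Comparison of the weight with free transport. -/

section WeightComparison

variable {T Vmin K : ℝ} {X V : ℝ → E3}

/-- A weight that is controlled along free transport. -/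
lemma weight_le_of_le {k : ℕ} {t R : ℝ} {x : E3} (hR : 1 ≤ R) (h1 : perpNorm x ≤ R)
    (h2 : ahead X t (x 0) ≤ R) (h3 : elapsed T X V t (x 0) ≤ R) :
    weight k T X V t x ≤ 4 * R ^ k := by
  have h4 : perpNorm x ^ k ≤ R ^ k := pow_le_pow_left₀ (perpNorm_nonneg x) h1 k
  have h5 : ahead X t (x 0) ^ k ≤ R ^ k := pow_le_pow_left₀ (ahead_nonneg _ _) h2 k
  have h6 : elapsed T X V t (x 0) ^ k ≤ R ^ k := pow_le_pow_left₀ (elapsed_nonneg _ _) h3 k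
  have h7 : 1 ≤ R ^ k := one_le_pow₀ hR
  unfold weight
  linarith

/-- Write θ = t-s and let d be the free-transport distance to the charge at time s. The transversal
part of x is at most d + θ|v| + K. As the charge outruns a velocity of at most Vmin/2, the distance
ahead is at most d, and the plane through x is crossed no earlier than s - θ/2 - d. -/
lemma FastMotion.weight_le (hm : FastMotion T Vmin X V) (hV : 1 ≤ Vmin) (hK : 1 ≤ K)
    {s t : ℝ} (hs : 0 ≤ s) (hst : s ≤ t) (ht : t ≤ T) (hXK : perpNorm (X s) ≤ K) (k : ℕ)
    {x v : E3} (hv : |v 0| ≤ Vmin / 2) :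
    weight k T X V t x
      ≤ 4 * (2 * (1 + K) * (1 + (t - s)) * (1 + (‖v‖ + ‖x - (t - s) • v - X s‖))) ^ k := by
  set d := ‖x - (t - s) • v - X s‖ with hd
  set θ := t - s with hθ
  have hθ0 : 0 ≤ θ := sub_nonneg.2 hst
  have hd0 : 0 ≤ d := norm_nonneg _
  have hv0 := norm_nonneg v
  have hdc : |x 0 - θ * v 0 - X s 0| ≤ d := by
    simpa using abs_coord_le_norm (x - θ • v - X s) 0
  have hv1 := abs_le.1 hv
  have hR1 : (1 : ℝ) + (‖v‖ + d) ≤ (1 + θ) * (1 + (‖v‖ + d)) := by nlinarith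
  have hR : d + θ * ‖v‖ + K ≤ 2 * (1 + K) * (1 + θ) * (1 + (‖v‖ + d)) := by
    have h0 : 0 ≤ θ * ‖v‖ := by positivity
    have h1 : 0 ≤ θ * d := by positivity
    have h2 : d + θ * ‖v‖ + 1 ≤ (1 + θ) * (1 + (‖v‖ + d)) := by nlinarith
    nlinarith [mul_le_mul_of_nonneg_left h2 (by linarith : 0 ≤ 1 + K)]
  have hR2 : 2 * θ + d ≤ 2 * (1 + K) * (1 + θ) * (1 + (‖v‖ + d)) := by
    have h0 : 0 ≤ θ * ‖v‖ := by positivity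
    have h1 : 0 ≤ θ * d := by positivity
    have h2 : 2 * θ + d ≤ 2 * ((1 + θ) * (1 + (‖v‖ + d))) := by nlinarith
    nlinarith [mul_le_mul_of_nonneg_left h2 (by linarith : 0 ≤ K)]
  have hX : extendedFirst T X V s = X s 0 := extendedFirst_of_mem ⟨hs, hst.trans ht⟩
  have hXt : extendedFirst T X V t = X t 0 := extendedFirst_of_mem ⟨hs.trans hst, ht⟩
  refine weight_le_of_le ?_ ?_ ?_ ?_
  · nlinarith [mul_nonneg hθ0 hv0, mul_nonneg hθ0 hd0]
  · refine le_trans ?_ hR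
    have h1 := perpNorm_add_le (x - θ • v - X s + θ • v) (X s)
    have h2 := perpNorm_add_le (x - θ • v - X s) (θ • v)
    have e : x - θ • v - X s + θ • v + X s = x := by abel
    rw [e] at h1
    rw [perpNorm_smul, abs_of_nonneg hθ0] at h2
    have h3 := perpNorm_le_norm (x - θ • v - X s)
    have h4 := mul_le_mul_of_nonneg_left (perpNorm_le_norm v) hθ0
    linarith
  · refine le_trans ?_ hR2
    refine max_le ?_ (by positivity)
    have h1 := hm.growth hst
    rw [hX, hXt, ← hθ] at h1
    have h2 := (le_abs_self _).trans hdc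
    nlinarith [mul_le_mul_of_nonneg_left hv1.2 hθ0, mul_le_mul_of_nonneg_left hV hθ0]
  · refine le_trans ?_ hR2
    refine max_le ?_ (by positivity)
    have h1 : t - (2 * θ + d) ≤ passageTime T X V (x 0) := by
      refine hm.le_passageTime fun σ hσ => ?_
      rcases le_or_gt s σ with h | h
      · linarith
      · have h2 := hm.growth h.le
        rw [hX] at h2
        have h3 := (neg_abs_le _).trans' (neg_le_neg hdc)
        have h4 : Vmin * (s - σ) ≤ d + θ * (Vmin / 2) := by
          nlinarith [mul_le_mul_of_nonneg_left hv1.2 hθ0]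
        have h5 : Vmin * (s - σ) ≤ Vmin * (d + θ / 2) := by nlinarith
        have h6 := le_of_mul_le_mul_left h5 hm.pos
        linarith
    linarith

/-- Here d refers to the linearized trajectory, while the passage time belongs to the true one.
Bounding the elapsed time therefore requires the past speed to be at least V_1(t)/K; otherwise a
slow past could make the passage arbitrarily early. The bound on V^⊥ controls the transversal drift.
-/
lemma FastMotion.weight_le_linear (hm : FastMotion T Vmin X V) (hV : 1 ≤ Vmin) (hK : 1 ≤ K)
    {s t : ℝ} (hst : s ≤ t) (ht : t ∈ Icc 0 T)
    (hdec : ∀ r ∈ Icc 0 t, V t 0 ≤ K * V r 0) (hXK : perpNorm (X t) ≤ K)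
    (hVK : perpNorm (V t) ≤ K) (k : ℕ) {x v : E3} (hv : |v 0| ≤ Vmin / 2) :
    weight k T X V t x ≤ 4 * (2 * (1 + K) * (1 + (t - s)) *
      (1 + (‖v‖ + ‖x - (t - s) • v - (X t - (t - s) • V t)‖))) ^ k := by
  set θ := t - s with hθ
  set d := ‖x - θ • v - (X t - θ • V t)‖ with hd
  have hθ0 : 0 ≤ θ := sub_nonneg.2 hst
  have hd0 : 0 ≤ d := norm_nonneg _
  have hv0 := norm_nonneg v
  set ν := V t 0 with hν
  have hνV : Vmin ≤ ν := hm.le t ht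
  have hν0 : 0 < ν := hm.pos.trans_le hνV
  have hdc : |x 0 - θ * v 0 - (X t 0 - θ * ν)| ≤ d := by
    simpa using abs_coord_le_norm (x - θ • v - (X t - θ • V t)) 0
  have hv1 := abs_le.1 hv
  have hR : d + θ * (‖v‖ + K) + K ≤ 2 * (1 + K) * (1 + θ) * (1 + (‖v‖ + d)) := by
    have h0 : 0 ≤ θ * ‖v‖ := by positivity
    have h1 : 0 ≤ θ * d := by positivity
    have h2 : d + θ * ‖v‖ + θ + 1 ≤ (1 + θ) * (1 + (‖v‖ + d)) := by nlinarith
    nlinarith [mul_le_mul_of_nonneg_left h2 (by linarith : 0 ≤ 1 + K), mul_nonneg hθ0 hθ0]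
  have hR2 : K * (2 * θ + d) ≤ 2 * (1 + K) * (1 + θ) * (1 + (‖v‖ + d)) := by
    have h0 : 0 ≤ θ * ‖v‖ := by positivity
    have h1 : 0 ≤ θ * d := by positivity
    have h2 : 2 * θ + d ≤ 2 * ((1 + θ) * (1 + (‖v‖ + d))) := by nlinarith
    nlinarith [mul_le_mul_of_nonneg_left h2 (by linarith : 0 ≤ K)]
  have hXt : extendedFirst T X V t = X t 0 := extendedFirst_of_mem ht
  refine weight_le_of_le ?_ ?_ ?_ ?_
  · nlinarith [mul_nonneg hθ0 hv0, mul_nonneg hθ0 hd0]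
  · refine le_trans ?_ hR
    have h1 := perpNorm_add_le (x - θ • v - (X t - θ • V t) + θ • v) (X t + (-θ) • V t)
    have h2 := perpNorm_add_le (x - θ • v - (X t - θ • V t)) (θ • v)
    have h5 := perpNorm_add_le (X t) ((-θ) • V t)
    have e : x - θ • v - (X t - θ • V t) + θ • v + (X t + (-θ) • V t) = x := by
      rw [neg_smul]; abel
    rw [e] at h1
    rw [perpNorm_smul, abs_of_nonneg hθ0] at h2
    rw [perpNorm_smul, abs_neg, abs_of_nonneg hθ0] at h5
    have h3 := perpNorm_le_norm (x - θ • v - (X t - θ • V t))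
    have h4 := mul_le_mul_of_nonneg_left (perpNorm_le_norm v) hθ0
    have h6 := mul_le_mul_of_nonneg_left hVK hθ0
    linarith
  · refine le_trans ?_ hR2
    refine max_le ?_ (by positivity)
    have h2 := (le_abs_self _).trans hdc
    have h3 : 0 ≤ θ * (ν - v 0) := mul_nonneg hθ0 (by linarith)
    nlinarith
  · refine le_trans ?_ hR2
    refine max_le ?_ (by positivity)
    have h1 : t - K * (2 * θ + d) ≤ passageTime T X V (x 0) := by
      refine hm.le_passageTime fun σ hσ => ?_
      rcases le_or_gt t σ with h | h
      · have : 0 ≤ K * (2 * θ + d) := by positivity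
        linarith
      · have hK0 : 0 < K := by linarith
        have hle : ∀ r ∈ Icc 0 T, r ≤ t → ν / K ≤ V r 0 := fun r hr hrt => by
          rw [div_le_iff₀ hK0, mul_comm]
          exact hdec r ⟨hr.1, hrt⟩
        have h2 := extendedFirst_growth hm.nonneg hm.deriv h.le
          (hle 0 ⟨le_rfl, hm.nonneg⟩ ht.1) hle
        rw [hXt] at h2
        have h3 := (neg_abs_le _).trans' (neg_le_neg hdc)
        have h4 : ν / K * (t - σ) ≤ d + θ * (ν - v 0) := by linarith
        have h5 : θ * (ν - v 0) ≤ θ * (2 * ν) := mul_le_mul_of_nonneg_left (by linarith) hθ0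
        have h6 : d ≤ ν * d := le_mul_of_one_le_left hd0 (hV.trans hνV)
        have h7 : ν * (t - σ) ≤ ν * (K * (2 * θ + d)) := by
          have h8 : K * (ν / K * (t - σ)) ≤ K * (ν * d + θ * (2 * ν)) :=
            mul_le_mul_of_nonneg_left (by linarith) hK0.le
          have e : K * (ν / K * (t - σ)) = ν * (t - σ) := by field_simp
          rw [e] at h8
          linarith
        have h9 := le_of_mul_le_mul_left h7 hν0
        linarith
    linarith

/-- The constant in `weight_mul_exp_le`. -/
noncomputable def weightConst (c K : ℝ) (k : ℕ) : ℝ :=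
  4 * (2 * (1 + K)) ^ k * ((2 / c) ^ k * k.factorial * Real.exp (c / 2))

/-- Exponential decay beats the weight, up to powers of the elapsed time. -/
lemma weight_mul_exp_le {c θ z W : ℝ} (hc : 0 < c) (hK : 0 ≤ K) (hθ : 0 ≤ θ) (hz : 0 ≤ z) {k : ℕ}
    (hW : W ≤ 4 * (2 * (1 + K) * (1 + θ) * (1 + z)) ^ k) :
    W * Real.exp (-(c * z)) ≤ weightConst c K k * (1 + θ) ^ k * Real.exp (-(c / 2 * z)) := by
  have h1 := Real.pow_div_factorial_le_exp (c / 2 * (1 + z)) (by positivity) k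
  rw [div_le_iff₀ (by positivity), mul_pow] at h1
  have h2 : (1 + z) ^ k ≤ (2 / c) ^ k * k.factorial * Real.exp (c / 2) * Real.exp (c / 2 * z) := by
    have e : (1 + z) ^ k = (2 / c) ^ k * ((c / 2) ^ k * (1 + z) ^ k) := by
      rw [← mul_assoc, ← mul_pow]
      have : 2 / c * (c / 2) = 1 := by field_simp
      rw [this, one_pow, one_mul]
    rw [e]
    calc (2 / c) ^ k * ((c / 2) ^ k * (1 + z) ^ k)
        ≤ (2 / c) ^ k * (Real.exp (c / 2 * (1 + z)) * k.factorial) := by gcongr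
      _ = _ := by
        rw [mul_add, mul_one, Real.exp_add]; ring
  calc W * Real.exp (-(c * z))
      ≤ 4 * (2 * (1 + K) * (1 + θ) * (1 + z)) ^ k * Real.exp (-(c * z)) := by gcongr
    _ = 4 * (2 * (1 + K)) ^ k * (1 + θ) ^ k * (1 + z) ^ k * Real.exp (-(c * z)) := by
        rw [mul_pow, mul_pow]; ring
    _ ≤ 4 * (2 * (1 + K)) ^ k * (1 + θ) ^ k *
        ((2 / c) ^ k * k.factorial * Real.exp (c / 2) * Real.exp (c / 2 * z))
          * Real.exp (-(c * z)) := by gcongr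
    _ = weightConst c K k * (1 + θ) ^ k * (Real.exp (c / 2 * z) * Real.exp (-(c * z))) := by
        unfold weightConst; ring
    _ = weightConst c K k * (1 + θ) ^ k * Real.exp (-(c / 2 * z)) := by
        rw [← Real.exp_add]; ring_nf

end WeightComparison

end FastCharge

namespace FastCharge

/-! ### Vanishing of ∇μ at high speed. -/

section Support

variable {A a Vmin : ℝ} {μ : E3 → ℝ}

/-- Vanishing near the point, and not only at it, is what also kills the derivative of ∇μ along the
flow. -/
lemma gradient_eventuallyEq_zero (hμ : ∀ v, Vmin / 4 ≤ ‖v‖ → μ v = 0) {v : E3}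
    (hv : Vmin / 4 < ‖v‖) : ∇ μ =ᶠ[nhds v] fun _ => 0 := by
  have h1 : ∀ᶠ w : E3 in nhds v, Vmin / 4 < ‖w‖ :=
    continuous_norm.continuousAt.eventually (lt_mem_nhds hv)
  filter_upwards [h1] with w hw
  have h2 : μ =ᶠ[nhds w] fun _ => 0 := by
    have : ∀ᶠ z : E3 in nhds w, Vmin / 4 < ‖z‖ :=
      continuous_norm.continuousAt.eventually (lt_mem_nhds hw)
    filter_upwards [this] with z hz
    exact hμ z hz.le
  rw [gradient, h2.fderiv_eq]
  simp

end Support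

/-! ### Weighted integration of exponentially decaying integrands. -/

section Decay

variable {T Vmin K : ℝ} {X V : ℝ → E3}

/-- Integration of a function that decays exponentially in the velocity and in the distance between
free transport and a fast curve. -/
theorem integrableOn_of_decay {G : Type*} [NormedAddCommGroup G] {c t B W : ℝ} {j : ℕ}
    (hc : 0 < c) (hVmin : 0 < Vmin) (hB : 0 ≤ B) (hK : 0 ≤ K) (hW0 : 0 < W)
    {S : Set ℝ} (hS : MeasurableSet S) (hSt : ∀ s ∈ S, s ≤ t) {Y : ℝ → E3} {y₀ : ℝ → ℝ}
    (hY : ∀ s ∈ S, Y s 0 = y₀ s) (hy₀ : ∀ r s, r ≤ s → Vmin * (s - r) ≤ y₀ s - y₀ r) (x : E3)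
    {f : ℝ × E3 → G} (hf : AEStronglyMeasurable f (volume.restrict (S ×ˢ univ)))
    (hW : ∀ s ∈ S, ∀ v : E3, |v 0| ≤ Vmin / 2 →
      W ≤ 4 * (2 * (1 + K) * (1 + (t - s)) * (1 + (‖v‖ + ‖x - (t - s) • v - Y s‖))) ^ (j + 2))
    (hbound : ∀ s ∈ S, ∀ v, |v 0| ≤ Vmin / 2 → ‖f (s, v)‖ * (1 + (t - s)) ^ j
      ≤ B * Real.exp (-(c * (‖v‖ + ‖x - (t - s) • v - Y s‖))))
    (hzero : ∀ s ∈ S, ∀ v, Vmin / 2 < |v 0| → f (s, v) = 0) :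
    IntegrableOn f (S ×ˢ univ) ∧ ∫ p in S ×ˢ univ, ‖f p‖
      ≤ B * weightConst c K (j + 2) * dispersionConst (c / 2) / (Vmin * W) := by
  have hwc : 0 ≤ weightConst c K (j + 2) := by unfold weightConst; positivity
  -- A weight of order j+2 costs (1+t-s)^(j+2). The assumed decay of f pays for j powers, and the
  -- remaining two are those that dispersion admits. The case j = 0 serves the sources, j = 1 the
  -- gradient.
  have h := integrableOn_of_bound (c := c / 2) (M := B * weightConst c K (j + 2) / W)
    (half_pos hc) hVmin (by positivity) hS hSt hY hy₀ x hf (fun s hs v => ?_) hzero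
  · refine ⟨h.1, h.2.trans (le_of_eq ?_)⟩
    field_simp
  · have hθ : 0 ≤ t - s := sub_nonneg.2 (hSt s hs)
    rcases le_or_gt |v 0| (Vmin / 2) with hv | hv
    · have h1 := hbound s hs v hv
      set z := ‖v‖ + ‖x - (t - s) • v - Y s‖ with hz
      have hz0 : 0 ≤ z := by positivity
      have h2 := weight_mul_exp_le hc hK hθ hz0 (hW s hs v hv)
      have e : Real.exp (-(c / 2 * ‖v‖)) * Real.exp (-(c / 2 * ‖x - (t - s) • v - Y s‖))
          = Real.exp (-(c / 2 * z)) := by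
        rw [← Real.exp_add, hz]; ring_nf
      rw [e]
      have hp : 0 < (1 + (t - s)) ^ j := by positivity
      refine le_of_mul_le_mul_right (h1.trans ?_) hp
      calc B * Real.exp (-(c * z)) = B / W * (W * Real.exp (-(c * z))) := by field_simp
        _ ≤ B / W * (weightConst c K (j + 2) * (1 + (t - s)) ^ (j + 2)
            * Real.exp (-(c / 2 * z))) := by gcongr
        _ = _ := by ring
    · rw [hzero s hs v hv, norm_zero]
      positivity

end Decay

/-! ### The linearized source. -/

section LinearSource

variable {A a K T Vmin : ℝ} {μ Φ : E3 → ℝ} {X V : ℝ → E3}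

/-- The linearized trajectory is a uniform motion of speed V_1(t) ≥ Vmin, so the dispersion estimate
applies over all past times without any analysis of characteristics. -/
theorem linearSource_bound (hm : FastMotion T Vmin X V) (hV : 1 ≤ Vmin) (hK : 1 ≤ K) (ha : 0 < a)
    (hμ : ExpDecay A a μ) (hΦ : ExpDecay A a Φ) (hch : BootstrapCharge K T Vmin μ X V)
    {t : ℝ} (ht : t ∈ Icc 0 T) (x : E3) :
    IntegrableOn (fun p : ℝ × E3 => linearSourceIntegrand μ Φ X V t x p.1 p.2)
        (Iic t ×ˢ univ) ∧
      |linearSource μ Φ X V t x| ≤ A ^ 2 * weightConst a K 2 * dispersionConst (a / 2)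
        / (Vmin * weight 2 T X V t x) := by
  set f : ℝ × E3 → ℝ := fun p => linearSourceIntegrand μ Φ X V t x p.1 p.2 with hf
  have hcont : Continuous f := by
    simp only [hf, linearSourceIntegrand]
    have h1 := hΦ.continuous_gradient
    have h2 := hμ.continuous_gradient
    exact (h1.comp (by fun_prop)).inner (h2.comp continuous_snd)
  have hgrow : ∀ r s, r ≤ s → Vmin * (s - r)
      ≤ (X t 0 - (t - s) * V t 0) - (X t 0 - (t - r) * V t 0) := fun r s hrs => by
    have := mul_le_mul_of_nonneg_right (hm.le t ht) (sub_nonneg.2 hrs)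
    linarith
  have h := integrableOn_of_decay (G := ℝ) (c := a) (B := A ^ 2) (j := 0) (K := K)
    (W := weight 2 T X V t x) ha hm.pos (by positivity) (by linarith) (weight_pos 2 t x)
    (measurableSet_Iic (a := t)) (fun s hs => hs) (Y := fun s => X t - (t - s) • V t)
    (y₀ := fun s => X t 0 - (t - s) * V t 0) (fun s _ => by simp) hgrow x
    (f := f) hcont.aestronglyMeasurable
    (fun s hs v hv => hm.weight_le_linear hV hK hs ht
      (fun r hr => hch.almost_decreasing t ht r hr) (hch.perp_position t ht)
      (hch.perp_velocity t ht) 2 hv)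
    (fun s hs v _ => ?_) (fun s hs v hv => ?_)
  · refine ⟨h.1, ?_⟩
    have e : linearSource μ Φ X V t x = -∫ p in Iic t ×ˢ univ, f p := by
      rw [linearSource]
      congr 1
      have h3 := h.1
      unfold IntegrableOn at h3
      rw [Measure.volume_eq_prod, ← Measure.prod_restrict, Measure.restrict_univ] at h3 ⊢
      exact (integral_prod f h3).symm
    rw [e, abs_neg]
    exact (norm_integral_le_integral_norm f).trans h.2
  · rw [pow_zero, mul_one]
    simp only [hf, linearSourceIntegrand]
    refine (norm_inner_le_norm _ _).trans ?_
    refine (mul_le_mul (hΦ.norm_gradient_le _) (hμ.norm_gradient_le v) (norm_nonneg _)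
      (mul_nonneg hΦ.nonneg (Real.exp_pos _).le)).trans (le_of_eq ?_)
    rw [mul_mul_mul_comm, ← Real.exp_add, sq]
    ring_nf
  · simp only [hf, linearSourceIntegrand]
    have h1 : Vmin / 4 < ‖v‖ := by
      have := abs_coord_le_norm v 0
      linarith [hm.pos]
    rw [(gradient_eventuallyEq_zero hch.support h1).self_of_nhds, inner_zero_right]

end LinearSource

/-! ### Differentiability of the characteristic flow. -/

section CharacteristicFlow

variable {T Vmin c A a : ℝ} {X V : ℝ → E3} {F : ℝ → E3 → E3} {DF : ℝ → E3 → E3 →L[ℝ] E3}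
  {XX VV : ℝ → ℝ → E3 → E3 → E3}

lemma IsCharacteristicFlow.isTrajectory (fl : IsCharacteristicFlow F T XX VV) {s t : ℝ}
    (hs : 0 ≤ s) (hst : s ≤ t) (ht : t ≤ T) (x v : E3) :
    IsTrajectory F T s t (fun r => XX r t x v) (fun r => VV r t x v) :=
  have hsub : Icc s t ⊆ Icc 0 T := Icc_subset_Icc hs ht
  ⟨hs, hst, ht,
    fun r hr => (fl.position t ⟨hs.trans hst, ht⟩ x v r (hsub hr)).mono hsub,
    fun r hr => (fl.velocity t ⟨hs.trans hst, ht⟩ x v r (hsub hr)).mono hsub⟩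

/-- The time-reversed phase space vector field. -/
def reversedField (F : ℝ → E3 → E3) (t σ : ℝ) (z : E3 × E3) : E3 × E3 :=
  -(z.2, F (t - σ) z.1)

/-- The derivative of the time-reversed phase space vector field. -/
noncomputable def reversedFieldDeriv (DF : ℝ → E3 → E3 →L[ℝ] E3) (t σ : ℝ) (z : E3 × E3) :
    E3 × E3 →L[ℝ] E3 × E3 :=
  -((ContinuousLinearMap.snd ℝ E3 E3).prod
    ((DF (t - σ) z.1).comp (ContinuousLinearMap.fst ℝ E3 E3)))

/-- The time-reversed flow in phase space. -/
def reversedFlow (XX VV : ℝ → ℝ → E3 → E3 → E3) (t σ : ℝ) (z : E3 × E3) : E3 × E3 :=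
  (XX (t - σ) t z.1 z.2, VV (t - σ) t z.1 z.2)

lemma sub_mem_Icc {t σ : ℝ} (ht : t ∈ Icc 0 T) (hσ : σ ∈ Icc 0 t) : t - σ ∈ Icc 0 T :=
  ⟨by linarith [hσ.2], by linarith [hσ.1, ht.2]⟩

lemma RegularForce.hasFDerivAt_reversedField (hF : RegularForce c A a T X V F DF) {t σ : ℝ}
    (ht : t ∈ Icc 0 T) (hσ : σ ∈ Icc 0 t) (z : E3 × E3) :
    HasFDerivAt (reversedField F t σ) (reversedFieldDeriv DF t σ z) z :=
  (hasFDerivAt_snd.prodMk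
    ((hF.hasFDerivAt _ (sub_mem_Icc ht hσ) z.1).comp z hasFDerivAt_fst)).neg

lemma RegularForce.continuousOn_reversedFieldDeriv (hF : RegularForce c A a T X V F DF) {t : ℝ}
    (ht : t ∈ Icc 0 T) :
    ContinuousOn (fun p : ℝ × E3 × E3 => reversedFieldDeriv DF t p.1 p.2) (Icc 0 t ×ˢ univ) := by
  have h1 : ContinuousOn (fun p : ℝ × E3 × E3 => DF (t - p.1) p.2.1) (Icc 0 t ×ˢ univ) :=
    hF.continuousOn_deriv.comp (f := fun p : ℝ × E3 × E3 => (t - p.1, p.2.1)) (by fun_prop)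
      (fun p hp => ⟨sub_mem_Icc ht hp.1, mem_univ _⟩)
  have h2 : ContinuousOn (fun p : ℝ × E3 × E3 =>
      (DF (t - p.1) p.2.1).comp (ContinuousLinearMap.fst ℝ E3 E3)) (Icc 0 t ×ˢ univ) :=
    h1.clm_comp continuousOn_const
  have h3 : ContinuousOn (fun p : ℝ × E3 × E3 =>
      -((ContinuousLinearMap.inl ℝ E3 E3).comp (ContinuousLinearMap.snd ℝ E3 E3)
        + (ContinuousLinearMap.inr ℝ E3 E3).comp
          ((DF (t - p.1) p.2.1).comp (ContinuousLinearMap.fst ℝ E3 E3)))) (Icc 0 t ×ˢ univ) :=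
    (continuousOn_const.add (continuousOn_const.clm_comp h2)).neg
  refine h3.congr fun p _ => ?_
  ext y <;> simp [reversedFieldDeriv]

/-- A crude bound that serves only the qualitative theory of the flow, its continuity and
differentiability; it does not enter the final constants. -/
lemma RegularForce.norm_reversedFieldDeriv_le (hF : RegularForce c A a T X V F DF) (hc : 0 ≤ c)
    (hA : 0 ≤ A) (ha : 0 ≤ a) {t σ : ℝ} (ht : t ∈ Icc 0 T) (hσ : σ ∈ Icc 0 t) (z : E3 × E3) :
    ‖reversedFieldDeriv DF t σ z‖ ≤ 1 + (c + A) := by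
  have hD : ‖DF (t - σ) z.1‖ ≤ c + A := by
    refine (hF.norm_deriv_le _ (sub_mem_Icc ht hσ) _).trans (add_le_add ?_ ?_)
    · exact div_le_self hc (one_le_weight _ _ _)
    · refine mul_le_of_le_one_right hA (Real.exp_le_one_iff.2 ?_)
      have := norm_nonneg (z.1 - X (t - σ))
      nlinarith
  rw [reversedFieldDeriv, norm_neg]
  refine ContinuousLinearMap.opNorm_le_bound _ (by positivity) fun y => ?_
  rw [ContinuousLinearMap.prod_apply, Prod.norm_def]
  have h1 : ‖y.1‖ ≤ ‖y‖ := norm_fst_le y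
  have h2 : ‖y.2‖ ≤ ‖y‖ := norm_snd_le y
  refine max_le ?_ ?_
  · refine h2.trans (le_mul_of_one_le_left (norm_nonneg _) ?_)
    linarith
  · refine ((DF (t - σ) z.1).le_opNorm y.1).trans ?_
    exact mul_le_mul (by linarith) h1 (norm_nonneg _) (by positivity)

lemma IsCharacteristicFlow.reversedFlow_zero (fl : IsCharacteristicFlow F T XX VV) {t : ℝ}
    (ht : t ∈ Icc 0 T) (z : E3 × E3) : reversedFlow XX VV t 0 z = z := by
  simp [reversedFlow, fl.position_self t ht, fl.velocity_self t ht]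

lemma IsCharacteristicFlow.hasDerivWithinAt_reversedFlow (fl : IsCharacteristicFlow F T XX VV)
    {t : ℝ} (ht : t ∈ Icc 0 T) (z : E3 × E3) {σ : ℝ} (hσ : σ ∈ Icc 0 t) :
    HasDerivWithinAt (fun r => reversedFlow XX VV t r z)
      (reversedField F t σ (reversedFlow XX VV t σ z)) (Icc 0 t) σ := by
  have hmaps : MapsTo (fun r => t - r) (Icc 0 t) (Icc 0 T) := fun r hr => sub_mem_Icc ht hr
  have hr : HasDerivWithinAt (fun r => t - r) (-1) (Icc 0 t) σ :=
    (hasDerivWithinAt_id σ _).const_sub t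
  have h1 := (fl.position t ht z.1 z.2 (t - σ) (sub_mem_Icc ht hσ)).scomp σ hr hmaps
  have h2 := (fl.velocity t ht z.1 z.2 (t - σ) (sub_mem_Icc ht hσ)).scomp σ hr hmaps
  refine (h1.prodMk h2).congr_deriv ?_
  simp [reversedField, reversedFlow]

/-- Joint continuity of the characteristic flow in the time, which is clamped to `[0, t]`, and in
the phase space variables. -/
lemma ForceSetting.continuous_flow (H : ForceSetting T Vmin c A a X V F DF)
    (fl : IsCharacteristicFlow F T XX VV) {t : ℝ} (ht : t ∈ Icc 0 T) :
    Continuous fun p : ℝ × E3 × E3 =>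
      reversedFlow XX VV t (t - projIcc 0 t ht.1 p.1) p.2 := by
  set L := 1 + (c + A)
  have hL0 : 0 ≤ L := by
    have := H.c_nonneg
    have := H.A_nonneg
    positivity
  have hmem : ∀ r : ℝ, t - projIcc 0 t ht.1 r ∈ Icc 0 t := fun r =>
    ⟨by linarith [(projIcc 0 t ht.1 r).2.2], by linarith [(projIcc 0 t ht.1 r).2.1]⟩
  refine continuous_prod_of_continuous_lipschitzWith' _ ⟨Real.exp (L * t), (Real.exp_pos _).le⟩
    (fun r => LipschitzWith.of_dist_le_mul fun y z => ?_) (fun z => ?_)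
  · rw [dist_eq_norm, dist_eq_norm]
    refine (norm_flow_sub_le
      (fun σ hσ z => H.force.hasFDerivAt_reversedField ht hσ z)
      (fun σ hσ z => H.force.norm_reversedFieldDeriv_le H.c_nonneg H.A_nonneg H.a_pos.le ht hσ z)
      (fl.reversedFlow_zero ht) (fun z σ hσ => fl.hasDerivWithinAt_reversedFlow ht z hσ)
      (hmem r) y z).trans ?_
    rw [mul_comm]
    refine mul_le_mul_of_nonneg_right (Real.exp_le_exp.2 ?_) (norm_nonneg _)
    exact mul_le_mul_of_nonneg_left (hmem r).2 hL0
  · have h1 : ContinuousOn (fun σ => reversedFlow XX VV t σ z) (Icc 0 t) := fun σ hσ =>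
      (fl.hasDerivWithinAt_reversedFlow ht z hσ).continuousWithinAt
    exact h1.comp_continuous (by fun_prop) hmem

/-- The derivative of the flow in the direction in which the free flow focuses at time `s`. -/
lemma ForceSetting.exists_flow_derivative (H : ForceSetting T Vmin c A a X V F DF)
    (fl : IsCharacteristicFlow F T XX VV) {s t : ℝ} (hs : 0 ≤ s) (hst : s ≤ t) (ht : t ≤ T)
    (x v : E3) :
    ∃ q u : E3 →L[ℝ] E3,
      HasFDerivAt (fun y => XX s t (x + y) (v + (1 + (t - s))⁻¹ • y)) q 0 ∧
      HasFDerivAt (fun y => VV s t (x + y) (v + (1 + (t - s))⁻¹ • y)) u 0 ∧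
      ∀ σ, IsPassing T Vmin X V s t (fun r => XX r t x v) σ →
        ‖q‖ + ‖u‖ ≤ (1 + (t - s))⁻¹ * (4 * (1 + (σ - s)) * Real.exp
          (2 * (momentBound c A a Vmin * (1 + 2 * (σ - s)) + secondMomentBound c A a Vmin T))) := by
  have ht' : t ∈ Icc 0 T := ⟨hs.trans hst, ht⟩
  obtain ⟨Y, hY0, hY, hYd⟩ := exists_flow_hasFDerivAt ht'.1
    (fun σ hσ z => H.force.hasFDerivAt_reversedField ht' hσ z)
    (H.force.continuousOn_reversedFieldDeriv ht')
    (fun σ hσ z => H.force.norm_reversedFieldDeriv_le H.c_nonneg H.A_nonneg H.a_pos.le ht' hσ z)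
    (fl.reversedFlow_zero ht') (fun z σ hσ => fl.hasDerivWithinAt_reversedFlow ht' z hσ) (x, v)
  set η := (1 + (t - s))⁻¹ with hη
  -- Free transport back to time s maps (y, ηy) to (ηy, ηy), since 1 - (t-s)η = η.
  set J : E3 →L[ℝ] E3 × E3 :=
    (ContinuousLinearMap.id ℝ E3).prod (η • ContinuousLinearMap.id ℝ E3) with hJ
  set q : ℝ → E3 →L[ℝ] E3 := fun r => (ContinuousLinearMap.fst ℝ E3 E3).comp ((Y (t - r)).comp J)
    with hq
  set u : ℝ → E3 →L[ℝ] E3 := fun r => (ContinuousLinearMap.snd ℝ E3 E3).comp ((Y (t - r)).comp J)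
    with hu
  have hJd : HasFDerivAt (fun y : E3 => (x + y, v + η • y)) J 0 :=
    ((hasFDerivAt_id (0 : E3)).const_add x).prodMk
      (((hasFDerivAt_id (0 : E3)).const_smul η).const_add v)
  have hz : HasFDerivAt (fun y : E3 => reversedFlow XX VV t (t - s) (x + y, v + η • y))
      ((Y (t - s)).comp J) 0 := by
    have h1 := hYd (t - s) ⟨by linarith, by linarith⟩
    have h2 : HasFDerivAt (reversedFlow XX VV t (t - s)) (Y (t - s))
        ((fun y : E3 => (x + y, v + η • y)) 0) := by simpa using h1
    exact h2.comp (0 : E3) hJd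
  refine ⟨q s, u s, ?_, ?_, fun σ hσ => ?_⟩
  · have := (hasFDerivAt_fst (𝕜 := ℝ) (E := E3) (F := E3)).comp (0 : E3) hz
    simpa [reversedFlow, Function.comp_def] using this
  · have := (hasFDerivAt_snd (𝕜 := ℝ) (E := E3) (F := E3)).comp (0 : E3) hz
    simpa [reversedFlow, Function.comp_def] using this
  · have htr := fl.isTrajectory hs hst ht x v
    have hmaps : MapsTo (fun r => t - r) (Icc s t) (Icc 0 t) := fun r hr =>
      ⟨by linarith [hr.2], by linarith [hr.1]⟩
    have hYr : ∀ r ∈ Icc s t, HasDerivWithinAt (fun r => Y (t - r))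
        (-((reversedFieldDeriv DF t (t - r) (XX r t x v, VV r t x v)).comp (Y (t - r))))
        (Icc s t) r := by
      intro r hr
      have hr' : HasDerivWithinAt (fun r => t - r) (-1) (Icc s t) r :=
        (hasDerivWithinAt_id r _).const_sub t
      have := (hY (t - r) (hmaps hr)).scomp r hr' hmaps
      refine this.congr_deriv ?_
      simp [reversedFlow]
    have hcomp : ∀ (Λ : E3 × E3 →L[ℝ] E3), ∀ r ∈ Icc s t,
        HasDerivWithinAt (fun r => Λ.comp ((Y (t - r)).comp J))
          (Λ.comp ((-((reversedFieldDeriv DF t (t - r) (XX r t x v, VV r t x v)).comp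
            (Y (t - r)))).comp J)) (Icc s t) r := by
      intro Λ r hr
      have h1 := (hYr r hr).clm_comp (hasDerivWithinAt_const r (Icc s t) J)
      have h2 := (hasDerivWithinAt_const r (Icc s t) Λ).clm_comp h1
      refine h2.congr_deriv ?_
      simp
    have hqd : ∀ r ∈ Icc s t, HasDerivWithinAt q (u r) (Icc s t) r := fun r hr => by
      refine (hcomp _ r hr).congr_deriv ?_
      ext y
      simp [hu, reversedFieldDeriv]
    have hud : ∀ r ∈ Icc s t,
        HasDerivWithinAt u ((DF r (XX r t x v)).comp (q r)) (Icc s t) r := fun r hr => by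
      refine (hcomp _ r hr).congr_deriv ?_
      ext y
      simp [hq, reversedFieldDeriv]
    have hqc : ContinuousOn q (Icc s t) := fun r hr => (hqd r hr).continuousWithinAt
    have hDc : ContinuousOn (fun r => DF r (XX r t x v)) (Icc s t) :=
      H.force.continuousOn_deriv.comp (continuousOn_id.prodMk htr.continuousOn_position)
        fun r hr => ⟨htr.subset hr, mem_univ _⟩
    have hqt : q t = ContinuousLinearMap.id ℝ E3 := by
      ext y; simp [hq, hY0, hJ]
    refine H.linearized_le htr hσ hqd hud (hDc.clm_comp hqc)
      (fun r _ => ContinuousLinearMap.opNorm_comp_le _ _) ?_ ?_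
    · rw [hqt]; exact ContinuousLinearMap.norm_id_le
    · rw [hqt]
      ext y; simp [hu, hY0, hJ, hη]

end CharacteristicFlow

end FastCharge

namespace FastCharge

/-! ### Pointwise bounds of the integrand of the source and of its derivative. -/

/-- The constant in the pointwise bounds of the integrand of the source. -/
noncomputable def integrandConst (A a N : ℝ) : ℝ := 4 * A ^ 2 * Real.exp (1 + 2 * N + a)

section Integrand

variable {T Vmin c A a N : ℝ} {X V : ℝ → E3} {F : ℝ → E3 → E3} {DF : ℝ → E3 → E3 →L[ℝ] E3}
  {XX VV : ℝ → ℝ → E3 → E3 → E3} {μ Φ : E3 → ℝ}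

/-- A particle that is slow at time `s` is compared with free transport. -/
lemma ForceSetting.exists_delay (H : ForceSetting T Vmin c A a X V F DF)
    (fl : IsCharacteristicFlow F T XX VV) (ha : 12 ≤ a * Vmin) {s t : ℝ} (hs : 0 ≤ s)
    (hst : s ≤ t) (ht : t ≤ T) {x v : E3} (hw : ‖VV s t x v‖ ≤ Vmin / 4) :
    ∃ σ, IsPassing T Vmin X V s t (fun r => XX r t x v) σ ∧
      3 * (σ - s) ≤ a / 2 * ‖XX s t x v - X s‖ ∧ ‖VV s t x v - v‖ ≤ 1 / 2 ∧
      ‖x - (t - s) • v - X s‖ ≤ 2 * ‖XX s t x v - X s‖ + 1 := by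
  have ht' : t ∈ Icc 0 T := ⟨hs.trans hst, ht⟩
  have htr := fl.isTrajectory hs hst ht x v
  obtain ⟨σ, hσ⟩ := H.exists_isPassing htr hw
  have h1 := H.norm_velocity_sub_le htr hσ
  have h2 := H.norm_position_sub_le htr hσ
  have h3 := hσ.delay_le
  simp only [fl.position_self t ht', fl.velocity_self t ht'] at h1 h2 h3
  have hε := H.moment_small
  have hV := H.Vmin_large
  have hL : 0 ≤ σ - s := sub_nonneg.2 hσ.mem.1
  set d := ‖XX s t x v - X s‖ with hd
  have hd0 : 0 ≤ d := norm_nonneg _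
  refine ⟨σ, hσ, ?_, h1.trans hε, ?_⟩
  -- The distance at time s is at least Vmin(σ-s)/2, so 12 ≤ a Vmin gives 6(σ-s) ≤ a d. The
  -- linearized flow will lose exp(3(σ-s)).
  · have h4 := mul_le_mul_of_nonneg_left h3 H.a_pos.le
    nlinarith [mul_le_mul_of_nonneg_right ha hL]
  · have h5 : x - (t - s) • v - X s
        = (XX s t x v - X s) - (XX s t x v - (x - (t - s) • v)) := by abel
    rw [h5]
    refine (norm_sub_le _ _).trans ?_
    have h6 : σ - s ≤ d / 4 := by nlinarith
    have h7 : momentBound c A a Vmin * (1 + (σ - s)) ≤ 1 / 2 * (1 + (σ - s)) := by gcongr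
    linarith

lemma norm_fderiv_inner_le {f g : E3 → E3} {f' g' : E3 →L[ℝ] E3} {y : E3}
    (hf : HasFDerivAt f f' y) (hg : HasFDerivAt g g' y) :
    ∃ D : E3 →L[ℝ] ℝ, HasFDerivAt (fun z => ⟪f z, g z⟫) D y ∧
      ‖D‖ ≤ ‖f y‖ * ‖g'‖ + ‖f'‖ * ‖g y‖ := by
  refine ⟨_, hf.inner ℝ hg, ContinuousLinearMap.opNorm_le_bound _ (by positivity) fun z => ?_⟩
  simp only [ContinuousLinearMap.comp_apply, ContinuousLinearMap.prod_apply,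
    fderivInnerCLM_apply]
  refine (norm_add_le _ _).trans ?_
  rw [add_mul]
  refine add_le_add ?_ ?_
  · refine (norm_inner_le_norm _ _).trans ?_
    rw [mul_assoc]
    exact mul_le_mul_of_nonneg_left (g'.le_opNorm z) (norm_nonneg _)
  · refine (norm_inner_le_norm _ _).trans ?_
    rw [mul_right_comm]
    exact mul_le_mul_of_nonneg_right (f'.le_opNorm z) (norm_nonneg _)

/-- Bounds of the integrand of the source and of its derivative in the direction in which the free
flow focuses. -/
theorem ForceSetting.exists_integrand_deriv (H : ForceSetting T Vmin c A a X V F DF)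
    (fl : IsCharacteristicFlow F T XX VV) (hμ : ExpDecay A a μ) (hΦ : ExpDecay A a Φ)
    (hsupp : ∀ v, Vmin / 4 ≤ ‖v‖ → μ v = 0) (ha : 12 ≤ a * Vmin)
    (hN0 : 0 ≤ N) (hN : secondMomentBound c A a Vmin T ≤ N) {s t : ℝ} (hs : 0 ≤ s)
    (hst : s ≤ t) (ht : t ≤ T) (x v : E3) :
    ∃ D : E3 →L[ℝ] ℝ,
      HasFDerivAt (fun y => sourceIntegrand μ Φ X XX VV t (x + y) s (v + (1 + (t - s))⁻¹ • y)) D 0 ∧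
      ‖sourceIntegrand μ Φ X XX VV t x s v‖
        ≤ integrandConst A a N * Real.exp (-(a / 4 * (‖v‖ + ‖x - (t - s) • v - X s‖))) ∧
      ‖D‖ * (1 + (t - s))
        ≤ integrandConst A a N * Real.exp (-(a / 4 * (‖v‖ + ‖x - (t - s) • v - X s‖))) ∧
      (Vmin / 4 + 1 / 2 < |v 0| → sourceIntegrand μ Φ X XX VV t x s v = 0 ∧ D = 0) := by
  obtain ⟨q, u, hq, hu, hqu⟩ := H.exists_flow_derivative fl hs hst ht x v
  set η := (1 + (t - s))⁻¹ with hη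
  have hθ : 0 < 1 + (t - s) := by linarith
  have hB : 0 ≤ integrandConst A a N := by unfold integrandConst; positivity
  rcases lt_or_ge (Vmin / 4) ‖VV s t x v‖ with hw | hw
  -- A particle that is fast at time s, and its neighbours in phase space, do not see ∇μ.
  · have h0 := gradient_eventuallyEq_zero hsupp hw
    have hG : sourceIntegrand μ Φ X XX VV t x s v = 0 := by
      rw [sourceIntegrand, h0.self_of_nhds, inner_zero_right]
    refine ⟨0, ?_, ?_, ?_, fun _ => ⟨hG, rfl⟩⟩
    · have hc : Filter.Tendsto (fun y => VV s t (x + y) (v + η • y)) (nhds 0)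
          (nhds (VV s t x v)) := by simpa using hu.continuousAt.tendsto
      refine (hasFDerivAt_const (0 : ℝ) (0 : E3)).congr_of_eventuallyEq ?_
      filter_upwards [hc.eventually h0] with y hy
      rw [sourceIntegrand, hy, inner_zero_right]
    · rw [hG, norm_zero]; positivity
    · rw [norm_zero, zero_mul]; positivity
  · obtain ⟨σ, hσ, h3L, hwv, hd0⟩ := H.exists_delay fl ha hs hst ht hw
    have hP : HasFDerivAt (fun y => ∇ Φ (XX s t (x + y) (v + η • y) - X s))
        ((fderiv ℝ (∇ Φ) (XX s t x v - X s)).comp q) 0 := by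
      have h1 : HasFDerivAt (∇ Φ) (fderiv ℝ (∇ Φ) (XX s t x v - X s))
          ((fun y => XX s t (x + y) (v + η • y) - X s) 0) := by
        simpa using hΦ.hasFDerivAt_gradient (XX s t x v - X s)
      exact h1.comp (0 : E3) (hq.sub_const (X s))
    have hW : HasFDerivAt (fun y => ∇ μ (VV s t (x + y) (v + η • y)))
        ((fderiv ℝ (∇ μ) (VV s t x v)).comp u) 0 := by
      have h1 : HasFDerivAt (∇ μ) (fderiv ℝ (∇ μ) (VV s t x v))
          ((fun y => VV s t (x + y) (v + η • y)) 0) := by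
        simpa using hμ.hasFDerivAt_gradient (VV s t x v)
      exact h1.comp (0 : E3) hu
    obtain ⟨D, hD, hDle⟩ := norm_fderiv_inner_le hP hW
    simp only [add_zero, smul_zero] at hDle
    set d := ‖XX s t x v - X s‖ with hd
    set w := VV s t x v with hwdef
    set z := ‖v‖ + ‖x - (t - s) • v - X s‖ with hz
    have hA := H.A_nonneg
    have ha0 := H.a_pos
    have hdn : 0 ≤ d := norm_nonneg _
    have hvw : ‖v‖ ≤ ‖w‖ + 1 / 2 := by
      have := norm_sub_norm_le v w
      rw [norm_sub_rev] at this
      linarith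
    -- Half of the decay in d compensates for the loss of the linearized flow; the other half
    -- survives the passage to free transport, where z ≤ |w| + 2d + 3/2.
    have hexp : Real.exp (a / 2 * d) * (Real.exp (-a * d) * Real.exp (-a * ‖w‖))
        ≤ Real.exp a * Real.exp (-(a / 4 * z)) := by
      rw [← Real.exp_add, ← Real.exp_add, ← Real.exp_add]
      refine Real.exp_le_exp.2 ?_
      have h4 : z ≤ ‖w‖ + 2 * d + 3 / 2 := by linarith
      have h5 := mul_le_mul_of_nonneg_left h4 ha0.le
      have h6 := mul_nonneg ha0.le (norm_nonneg w)
      linarith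
    have e1 : 1 ≤ Real.exp (a / 2 * d) := Real.one_le_exp (by positivity)
    have e2 : 1 ≤ 4 * Real.exp (1 + 2 * N) := by
      have : 1 ≤ Real.exp (1 + 2 * N) := Real.one_le_exp (by positivity)
      linarith
    have hb1 := hΦ.norm_gradient_le (XX s t x v - X s)
    have hb2 := hΦ.norm_fderiv_gradient_le (XX s t x v - X s)
    have hb3 := hμ.norm_gradient_le w
    have hb4 := hμ.norm_fderiv_gradient_le w
    rw [← hd] at hb1 hb2
    set E := Real.exp (-a * d) * Real.exp (-a * ‖w‖) with hE
    have hE0 : 0 < E := by positivity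
    have hconst : ∀ m, m ≤ 4 * Real.exp (1 + 2 * N) * Real.exp (a / 2 * d) →
        A ^ 2 * E * m ≤ integrandConst A a N * Real.exp (-(a / 4 * z)) := by
      intro m hm
      calc A ^ 2 * E * m
          ≤ A ^ 2 * E * (4 * Real.exp (1 + 2 * N) * Real.exp (a / 2 * d)) := by gcongr
        _ = 4 * A ^ 2 * Real.exp (1 + 2 * N) * (Real.exp (a / 2 * d) * E) := by ring
        _ ≤ 4 * A ^ 2 * Real.exp (1 + 2 * N) * (Real.exp a * Real.exp (-(a / 4 * z))) := by
          gcongr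
        _ = _ := by rw [integrandConst, Real.exp_add (1 + 2 * N) a]; ring
    refine ⟨D, hD, ?_, ?_, fun hv0 => ?_⟩
    · rw [sourceIntegrand]
      refine (norm_inner_le_norm _ _).trans ((mul_le_mul hb1 hb3 (norm_nonneg _)
        (by positivity)).trans ?_)
      refine le_trans (le_of_eq ?_) (hconst 1 (by nlinarith))
      rw [hE]; ring
    · have hL : 0 ≤ σ - s := sub_nonneg.2 hσ.mem.1
      have h7 : ‖D‖ ≤ A ^ 2 * E * (‖q‖ + ‖u‖) := by
        refine hDle.trans ?_
        have i1 := ContinuousLinearMap.opNorm_comp_le (fderiv ℝ (∇ Φ) (XX s t x v - X s)) q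
        have i2 := ContinuousLinearMap.opNorm_comp_le (fderiv ℝ (∇ μ) w) u
        calc _ ≤ (A * Real.exp (-a * d)) * (A * Real.exp (-a * ‖w‖) * ‖u‖)
              + (A * Real.exp (-a * d) * ‖q‖) * (A * Real.exp (-a * ‖w‖)) := by
              gcongr
              · exact i2.trans (by gcongr)
              · exact i1.trans (by gcongr)
          _ = _ := by rw [hE]; ring
      have h8 : (‖q‖ + ‖u‖) * (1 + (t - s)) ≤ 4 * (1 + (σ - s)) * Real.exp
          (2 * (momentBound c A a Vmin * (1 + 2 * (σ - s)) + secondMomentBound c A a Vmin T)) := by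
        have := mul_le_mul_of_nonneg_right (hqu σ hσ) hθ.le
        refine this.trans (le_of_eq ?_)
        rw [hη]; field_simp
      -- With the small moments at most 1/2, the exponent is at most 1 + 2N + 2(σ-s), and the
      -- prefactor costs one more σ-s: three in total.
      have h9 : 4 * (1 + (σ - s)) * Real.exp
          (2 * (momentBound c A a Vmin * (1 + 2 * (σ - s)) + secondMomentBound c A a Vmin T))
          ≤ 4 * Real.exp (1 + 2 * N) * Real.exp (a / 2 * d) := by
        have j1 : 1 + (σ - s) ≤ Real.exp (σ - s) := by
          linarith [Real.add_one_le_exp (σ - s)]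
        have j2 : momentBound c A a Vmin * (1 + 2 * (σ - s)) ≤ 1 / 2 * (1 + 2 * (σ - s)) :=
          mul_le_mul_of_nonneg_right H.moment_small (by linarith)
        calc _ ≤ 4 * Real.exp (σ - s) * Real.exp (1 + 2 * N + 2 * (σ - s)) := by
              gcongr
              linarith
          _ = 4 * Real.exp (1 + 2 * N) * Real.exp (3 * (σ - s)) := by
              rw [mul_assoc, mul_assoc, ← Real.exp_add, ← Real.exp_add]; ring_nf
          _ ≤ _ := by gcongr
      calc ‖D‖ * (1 + (t - s)) ≤ A ^ 2 * E * (‖q‖ + ‖u‖) * (1 + (t - s)) := by gcongr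
        _ = A ^ 2 * E * ((‖q‖ + ‖u‖) * (1 + (t - s))) := by ring
        _ ≤ _ := hconst _ (h8.trans h9)
    -- A slow particle satisfies |w| ≤ Vmin/4 and |w-v| ≤ 1/2, so this range of v is excluded.
    · exfalso
      have h10 := abs_coord_le_norm v 0
      linarith

/-- The integrand of the source after a shift of the velocity variable, for the derivative at `x`;
the shift is chosen such that free transport hardly depends on `y`. -/
noncomputable def shiftedIntegrand (μ Φ : E3 → ℝ) (X : ℝ → E3) (XX VV : ℝ → ℝ → E3 → E3 → E3) (t : ℝ)
    (x y : E3) (p : ℝ × E3) : ℝ :=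
  sourceIntegrand μ Φ X XX VV t y p.1 (p.2 + (1 + (t - p.1))⁻¹ • (y - x))

/-- For |y-x| ≤ 1 the shift changes |v| and the free-transport distance by at most 1 each. This
costs the factor exp(a/2) and yields bounds centred at x, as domination uniform in y requires. The
velocity cutoff rises to Vmin/2, with room because Vmin ≥ 8. -/
lemma ForceSetting.exists_shiftedIntegrand_deriv (H : ForceSetting T Vmin c A a X V F DF)
    (fl : IsCharacteristicFlow F T XX VV) (hμ : ExpDecay A a μ) (hΦ : ExpDecay A a Φ)
    (hsupp : ∀ v, Vmin / 4 ≤ ‖v‖ → μ v = 0) (ha : 12 ≤ a * Vmin)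
    (hN0 : 0 ≤ N) (hN : secondMomentBound c A a Vmin T ≤ N) {s t : ℝ} (hs : 0 ≤ s)
    (hst : s ≤ t) (ht : t ≤ T) {x y : E3} (hy : ‖y - x‖ ≤ 1) (v : E3) :
    ∃ D : E3 →L[ℝ] ℝ, HasFDerivAt (fun y => shiftedIntegrand μ Φ X XX VV t x y (s, v)) D y ∧
      ‖shiftedIntegrand μ Φ X XX VV t x y (s, v)‖
        ≤ integrandConst A a N * Real.exp (a / 2)
          * Real.exp (-(a / 4 * (‖v‖ + ‖x - (t - s) • v - X s‖))) ∧
      ‖D‖ * (1 + (t - s)) ≤ integrandConst A a N * Real.exp (a / 2)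
          * Real.exp (-(a / 4 * (‖v‖ + ‖x - (t - s) • v - X s‖))) ∧
      (Vmin / 2 < |v 0| → shiftedIntegrand μ Φ X XX VV t x y (s, v) = 0 ∧ D = 0) := by
  have hθ : 0 ≤ t - s := sub_nonneg.2 hst
  set η := (1 + (t - s))⁻¹ with hη
  have hη0 : 0 ≤ η := by positivity
  have hη1 : η ≤ 1 := inv_le_one_of_one_le₀ (by linarith)
  have hB : 0 ≤ integrandConst A a N := by unfold integrandConst; positivity
  set v' := v + η • (y - x) with hv'
  obtain ⟨D, hD, h1, h2, h3⟩ := H.exists_integrand_deriv fl hμ hΦ hsupp ha hN0 hN hs hst ht y v'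
  have hsm : ‖η • (y - x)‖ ≤ 1 := by
    rw [norm_smul, Real.norm_of_nonneg hη0]
    exact mul_le_one₀ hη1 (norm_nonneg _) hy
  have hexp : integrandConst A a N * Real.exp (-(a / 4 * (‖v'‖ + ‖y - (t - s) • v' - X s‖)))
      ≤ integrandConst A a N * Real.exp (a / 2)
          * Real.exp (-(a / 4 * (‖v‖ + ‖x - (t - s) • v - X s‖))) := by
    rw [mul_assoc, ← Real.exp_add]
    refine mul_le_mul_of_nonneg_left (Real.exp_le_exp.2 ?_) hB
    have i1 : ‖v‖ ≤ ‖v'‖ + 1 := by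
      have := norm_sub_le v' (η • (y - x))
      rw [hv', add_sub_cancel_right, ← hv'] at this
      linarith
    have i2 : ‖x - (t - s) • v - X s‖ ≤ ‖y - (t - s) • v' - X s‖ + 1 := by
      -- The identity (t-s)η = 1-η shows that the velocity shift cancels all but the fraction η of
      -- the displacement.
      have e : x - (t - s) • v - X s = (y - (t - s) • v' - X s) - η • (y - x) := by
        have hη' : (t - s) * η = 1 - η := by rw [hη]; field_simp; ring
        rw [hv', smul_add, smul_smul, hη', sub_smul (1 : ℝ), one_smul]
        abel
      rw [e]
      exact (norm_sub_le _ _).trans (by linarith)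
    have := mul_le_mul_of_nonneg_left (add_le_add i1 i2) H.a_pos.le
    linarith
  refine ⟨D, ?_, h1.trans hexp, h2.trans hexp, fun hv => h3 ?_⟩
  · have h4 : HasFDerivAt (fun z : E3 => z - y) (ContinuousLinearMap.id ℝ E3) y :=
      (hasFDerivAt_id y).sub_const y
    have h5 : HasFDerivAt (fun z => sourceIntegrand μ Φ X XX VV t (y + z) s (v' + η • z)) D
        ((fun z : E3 => z - y) y) := by simpa using hD
    refine (HasFDerivAt.comp (f := fun z : E3 => z - y) y h5 h4).congr_of_eventuallyEq (Filter.Eventually.of_forall fun z => ?_)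
    simp only [shiftedIntegrand, Function.comp_apply, add_sub_cancel, hv', ← hη]
    congr 1
    rw [add_assoc, ← smul_add]
    congr 2
    abel
  · have h6 := abs_coord_le_norm (η • (y - x)) 0
    have h7 : v 0 = v' 0 - (η • (y - x)) 0 := by simp [hv']
    have h8 := abs_sub (v' 0) ((η • (y - x)) 0)
    rw [← h7] at h8
    linarith [H.Vmin_large]

end Integrand

end FastCharge

namespace FastCharge

/-! ### The source along the true characteristics, and its gradient. -/

section Source

variable {T Vmin c A a N K : ℝ} {X V : ℝ → E3} {F : ℝ → E3 → E3} {DF : ℝ → E3 → E3 →L[ℝ] E3}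
  {XX VV : ℝ → ℝ → E3 → E3 → E3} {μ Φ : E3 → ℝ}

/-- Clamping the time to [0, t] extends the integrand continuously to all times, which yields the
measurability of the integrand and of its derivative in y. -/
lemma ForceSetting.continuous_shiftedIntegrand (H : ForceSetting T Vmin c A a X V F DF)
    (fl : IsCharacteristicFlow F T XX VV) (hμ : ExpDecay A a μ) (hΦ : ExpDecay A a Φ) {t : ℝ}
    (ht : t ∈ Icc 0 T) (x : E3) :
    Continuous (Function.uncurry fun (p : ℝ × E3) (y : E3) =>
      shiftedIntegrand μ Φ X XX VV t x y (projIcc 0 t ht.1 p.1, p.2)) := by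
  have hr : Continuous fun p : (ℝ × E3) × E3 => (projIcc 0 t ht.1 p.1.1 : ℝ) := by fun_prop
  have hX : Continuous fun p : (ℝ × E3) × E3 => X (projIcc 0 t ht.1 p.1.1) := by
    have hXc : ContinuousOn X (Icc 0 T) := fun r hr =>
      (H.motion.deriv r hr).continuousWithinAt
    exact hXc.comp_continuous hr fun p =>
      ⟨(projIcc 0 t ht.1 p.1.1).2.1, (projIcc 0 t ht.1 p.1.1).2.2.trans ht.2⟩
  have hη : Continuous fun p : (ℝ × E3) × E3 =>
      (1 + (t - (projIcc 0 t ht.1 p.1.1 : ℝ)))⁻¹ := by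
    refine (continuous_const.add (continuous_const.sub hr)).inv₀ fun p => ?_
    have := (projIcc 0 t ht.1 p.1.1).2.2
    have h1 : 0 < 1 + (t - (projIcc 0 t ht.1 p.1.1 : ℝ)) := by linarith
    exact h1.ne'
  have hv : Continuous fun p : (ℝ × E3) × E3 =>
      p.1.2 + (1 + (t - (projIcc 0 t ht.1 p.1.1 : ℝ)))⁻¹ • (p.2 - x) :=
    (by fun_prop : Continuous fun p : (ℝ × E3) × E3 => p.1.2).add
      (hη.smul (by fun_prop))
  have hflow := (H.continuous_flow fl ht).comp
    ((by fun_prop : Continuous fun p : (ℝ × E3) × E3 => p.1.1).prodMk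
      ((by fun_prop : Continuous fun p : (ℝ × E3) × E3 => p.2).prodMk hv))
  have h1 := continuous_fst.comp hflow
  have h2 := continuous_snd.comp hflow
  simp only [Function.comp_def, reversedFlow, sub_sub_cancel] at h1 h2
  exact (hΦ.continuous_gradient.comp (h1.sub hX)).inner (hμ.continuous_gradient.comp h2)

lemma aestronglyMeasurable_of_clamped {G : Type*} [TopologicalSpace G] {t : ℝ} (ht : 0 ≤ t)
    {f : ℝ × E3 → G}
    (hf : AEStronglyMeasurable (fun p : ℝ × E3 => f (projIcc 0 t ht p.1, p.2)) volume) :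
    AEStronglyMeasurable f (volume.restrict (Ioc 0 t ×ˢ univ)) := by
  refine (hf.mono_measure Measure.restrict_le_self).congr
    ((ae_restrict_mem (measurableSet_Ioc.prod MeasurableSet.univ)).mono fun p hp => ?_)
  have h : (projIcc 0 t ht p.1 : ℝ) = p.1 := by
    rw [projIcc_of_mem ht ⟨hp.1.1.le, hp.1.2⟩]
  simp only [h]

theorem ForceSetting.source_bound (H : ForceSetting T Vmin c A a X V F DF)
    (fl : IsCharacteristicFlow F T XX VV) (hμ : ExpDecay A a μ) (hΦ : ExpDecay A a Φ)
    (hch : BootstrapCharge K T Vmin μ X V) (hK : 1 ≤ K) (ha : 12 ≤ a * Vmin)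
    (hN0 : 0 ≤ N) (hN : secondMomentBound c A a Vmin T ≤ N) {t : ℝ} (ht : t ∈ Icc 0 T) (x : E3) :
    IntegrableOn (fun p : ℝ × E3 => sourceIntegrand μ Φ X XX VV t x p.1 p.2)
        (Ioc 0 t ×ˢ univ) ∧
      |source μ Φ X XX VV t x| ≤ integrandConst A a N * Real.exp (a / 2) * weightConst (a / 4) K 2
        * dispersionConst (a / 4 / 2) / (Vmin * weight 2 T X V t x) ∧
      DifferentiableAt ℝ (source μ Φ X XX VV t) x ∧
      ‖∇ (source μ Φ X XX VV t) x‖ ≤ integrandConst A a N * Real.exp (a / 2)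
        * weightConst (a / 4) K 3 * dispersionConst (a / 4 / 2)
        / (Vmin * weight 3 T X V t x) := by
  set B := integrandConst A a N * Real.exp (a / 2) with hB
  have hB0 : 0 ≤ B := by rw [hB, integrandConst]; positivity
  set S : Set ℝ := Ioc 0 t with hS
  have hSm : MeasurableSet (S ×ˢ (univ : Set E3)) := measurableSet_Ioc.prod MeasurableSet.univ
  have hm := H.motion
  have hSt : ∀ s ∈ S, s ≤ t := fun s hs => hs.2
  have hST : ∀ s ∈ S, s ∈ Icc 0 T := fun s hs => ⟨hs.1.le, hs.2.trans ht.2⟩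
  have hXy : ∀ s ∈ S, X s 0 = extendedFirst T X V s := fun s hs =>
    (extendedFirst_of_mem (hST s hs)).symm
  have hgrow : ∀ r s, r ≤ s →
      Vmin * (s - r) ≤ extendedFirst T X V s - extendedFirst T X V r := fun r s h => hm.growth h
  have hWk : ∀ k, ∀ s ∈ S, ∀ v : E3, |v 0| ≤ Vmin / 2 → weight k T X V t x
      ≤ 4 * (2 * (1 + K) * (1 + (t - s)) * (1 + (‖v‖ + ‖x - (t - s) • v - X s‖))) ^ k :=
    fun k s hs v hv => hm.weight_le H.one_le_Vmin hK hs.1.le hs.2 ht.2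
      (hch.perp_position s (hST s hs)) k hv
  obtain ⟨g, hg⟩ : ∃ g, g = shiftedIntegrand μ Φ X XX VV t x := ⟨_, rfl⟩
  obtain ⟨D, hD⟩ : ∃ D : E3 → ℝ × E3 → E3 →L[ℝ] ℝ,
    D = fun y p => fderiv ℝ (fun z => g z p) y := ⟨_, rfl⟩
  have hpt : ∀ s ∈ S, ∀ v : E3, ∀ y, ‖y - x‖ ≤ 1 →
      HasFDerivAt (fun z => g z (s, v)) (D y (s, v)) y ∧
      ‖g y (s, v)‖ ≤ B * Real.exp (-(a / 4 * (‖v‖ + ‖x - (t - s) • v - X s‖))) ∧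
      ‖D y (s, v)‖ * (1 + (t - s))
        ≤ B * Real.exp (-(a / 4 * (‖v‖ + ‖x - (t - s) • v - X s‖))) ∧
      (Vmin / 2 < |v 0| → g y (s, v) = 0 ∧ D y (s, v) = 0) := by
    intro s hs v y hy
    obtain ⟨D', h1, h2, h3, h4⟩ := H.exists_shiftedIntegrand_deriv fl hμ hΦ hch.support ha hN0 hN
      hs.1.le hs.2 ht.2 hy v
    rw [← hg] at h1 h2 h4
    have e : D y (s, v) = D' := by rw [hD]; exact h1.fderiv
    rw [e]
    exact ⟨h1, h2, h3, h4⟩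
  have hcont := H.continuous_shiftedIntegrand fl hμ hΦ ht x
  rw [← hg] at hcont
  have hgm : ∀ y, AEStronglyMeasurable (g y) (volume.restrict (S ×ˢ univ)) := fun y =>
    aestronglyMeasurable_of_clamped ht.1 (hcont.comp
      (continuous_id.prodMk continuous_const)).aestronglyMeasurable
  have hDm : AEStronglyMeasurable (D x) (volume.restrict (S ×ˢ univ)) := by
    have : ProperSpace (E3 →L[ℝ] ℝ) := FiniteDimensional.proper ℝ _
    have h1 := (measurable_fderiv_with_param ℝ hcont).comp
      (measurable_id.prodMk (measurable_const (a := x)))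
    rw [hD]
    exact aestronglyMeasurable_of_clamped ht.1 h1.aestronglyMeasurable
  have hint : ∀ y, ‖y - x‖ ≤ 1 → IntegrableOn (g y) (S ×ˢ univ) ∧
      ∫ p in S ×ˢ univ, ‖g y p‖ ≤ B * weightConst (a / 4) K 2 * dispersionConst (a / 4 / 2)
        / (Vmin * weight 2 T X V t x) := fun y hy =>
    integrableOn_of_decay (c := a / 4) (B := B) (K := K) (j := 0) (by linarith [H.a_pos]) hm.pos hB0 (by linarith)
      (weight_pos 2 t x) measurableSet_Ioc hSt hXy hgrow x (hgm y) (hWk 2)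
      (fun s hs v _ => by rw [pow_zero, mul_one]; exact (hpt s hs v y hy).2.1)
      (fun s hs v hv => ((hpt s hs v y hy).2.2.2 hv).1)
  have hDint : IntegrableOn (D x) (S ×ˢ univ) ∧
      ∫ p in S ×ˢ univ, ‖D x p‖ ≤ B * weightConst (a / 4) K 3 * dispersionConst (a / 4 / 2)
        / (Vmin * weight 3 T X V t x) :=
    integrableOn_of_decay (c := a / 4) (B := B) (K := K) (j := 1) (by linarith [H.a_pos]) hm.pos hB0 (by linarith)
      (weight_pos 3 t x) measurableSet_Ioc hSt hXy hgrow x hDm (hWk 3)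
      (fun s hs v _ => by rw [pow_one]; exact (hpt s hs v x (by simp)).2.2.1)
      (fun s hs v hv => ((hpt s hs v x (by simp)).2.2.2 hv).2)
  -- Translation invariance in v: the shift depends on s and y but leaves each velocity integral
  -- unchanged.
  have hsrc : ∀ y, ‖y - x‖ ≤ 1 →
      source μ Φ X XX VV t y = -∫ p in S ×ˢ univ, g y p := by
    intro y hy
    have h1 := (hint y hy).1
    unfold IntegrableOn at h1
    rw [source, intervalIntegral.integral_of_le ht.1]
    congr 1
    rw [Measure.volume_eq_prod, ← Measure.prod_restrict, Measure.restrict_univ] at h1 ⊢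
    rw [integral_prod _ h1]
    refine integral_congr_ae (Filter.Eventually.of_forall fun s => ?_)
    rw [hg]
    exact (integral_add_right_eq_self
      (fun v => sourceIntegrand μ Φ X XX VV t y s v) ((1 + (t - s))⁻¹ • (y - x))).symm
  -- A majorant of the derivative independent of y; it satisfies the decay theorem with j = 1 and is
  -- therefore integrable.
  set bound : ℝ × E3 → ℝ := {p : ℝ × E3 | |p.2 0| ≤ Vmin / 2}.indicator fun p =>
    B * Real.exp (-(a / 4 * (‖p.2‖ + ‖x - (t - p.1) • p.2 - X p.1‖))) * (1 + (t - p.1))⁻¹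
    with hbound
  have hbm : AEStronglyMeasurable bound (volume.restrict (S ×ˢ univ)) := by
    refine AEStronglyMeasurable.indicator ?_
      (isClosed_le (by fun_prop) continuous_const).measurableSet
    refine ContinuousOn.aestronglyMeasurable ?_ hSm
    have hXc : ContinuousOn (fun p : ℝ × E3 => X p.1) (S ×ˢ univ) :=
      ContinuousOn.comp (t := Icc 0 T) (fun r hr => (hm.deriv r hr).continuousWithinAt)
        continuousOn_fst fun p hp => hST p.1 hp.1
    have hη : ContinuousOn (fun p : ℝ × E3 => (1 + (t - p.1))⁻¹) (S ×ˢ univ) :=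
      ContinuousOn.inv₀ (by fun_prop) fun p hp => by
        have := hp.1.2
        have h1 : 0 < 1 + (t - p.1) := by linarith
        exact h1.ne'
    have hd : ContinuousOn (fun p : ℝ × E3 => x - (t - p.1) • p.2 - X p.1) (S ×ˢ univ) :=
      ContinuousOn.sub (by fun_prop) hXc
    exact (continuousOn_const.mul (continuousOn_const.mul
      (continuous_snd.norm.continuousOn.add hd.norm)).neg.rexp).mul hη
  have hbi : IntegrableOn bound (S ×ˢ univ) :=
    (integrableOn_of_decay (c := a / 4) (B := B) (K := K) (j := 1) (by linarith [H.a_pos]) hm.pos hB0 (by linarith)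
      (weight_pos 3 t x) measurableSet_Ioc hSt hXy hgrow x hbm (hWk 3)
      (fun s hs v hv => by
        have h1 : 0 < 1 + (t - s) := by linarith [hSt s hs]
        have h2 : (s, v) ∈ {p : ℝ × E3 | |p.2 0| ≤ Vmin / 2} := hv
        rw [hbound, indicator_of_mem h2, pow_one, Real.norm_of_nonneg (by positivity),
          inv_mul_cancel_right₀ h1.ne'])
      (fun s hs v hv => by
        have h2 : (s, v) ∉ {p : ℝ × E3 | |p.2 0| ≤ Vmin / 2} := not_le.2 hv
        rw [hbound, indicator_of_notMem h2])).1
  have hball : ∀ y ∈ Metric.ball x 1, ‖y - x‖ ≤ 1 := fun y hy => by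
    rw [← dist_eq_norm]; exact (Metric.mem_ball.1 hy).le
  have hderiv : HasFDerivAt (fun y => ∫ p in S ×ˢ univ, g y p) (∫ p in S ×ˢ univ, D x p) x := by
    refine hasFDerivAt_integral_of_dominated_of_fderiv_le (bound := bound)
      (Metric.ball_mem_nhds x one_pos) (Filter.Eventually.of_forall hgm)
      (hint x (by simp)).1 hDm ((ae_restrict_mem hSm).mono fun p hp y hy => ?_) hbi
      ((ae_restrict_mem hSm).mono fun p hp y hy => (hpt p.1 hp.1 p.2 y (hball y hy)).1)
    have h1 : 0 < 1 + (t - p.1) := by linarith [hSt p.1 hp.1]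
    have h2 := (hpt p.1 hp.1 p.2 y (hball y hy)).2.2
    rcases le_or_gt |p.2 0| (Vmin / 2) with hv | hv
    · rw [hbound, indicator_of_mem (by exact hv), ← div_eq_mul_inv, le_div_iff₀ h1]
      exact h2.1
    · rw [hbound, indicator_of_notMem (by exact not_le.2 hv)]
      exact (norm_eq_zero.2 (h2.2 hv).2).le
  have hd : HasFDerivAt (source μ Φ X XX VV t) (-∫ p in S ×ˢ univ, D x p) x :=
    hderiv.neg.congr_of_eventuallyEq (Filter.eventuallyEq_of_mem (Metric.ball_mem_nhds x one_pos)
      fun y hy => hsrc y (hball y hy))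
  have hx := hint x (by simp)
  refine ⟨hx.1.congr_fun (fun p _ => by simp [hg, shiftedIntegrand]) hSm, ?_,
    hd.differentiableAt, ?_⟩
  · rw [hsrc x (by simp), abs_neg]
    exact (norm_integral_le_integral_norm _).trans hx.2
  · rw [norm_gradient, hd.fderiv, norm_neg]
    exact (norm_integral_le_integral_norm _).trans hDint.2

end Source

end FastCharge

namespace FastCharge

/-! ### Consequences of the parameter relations. -/

section Parameters

variable {T Vmin A a δ δ₀ K κ : ℝ} {n : ℕ} {X V : ℝ → E3} {μ Φ : E3 → ℝ}
  {f : ℝ → E3 → E3 → ℝ}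

lemma fieldConst_nonneg : 0 ≤ fieldConst :=
  mul_nonneg (by norm_num) (integral_nonneg fun z => by unfold kernelMajorant; positivity)

lemma BootstrapParameters.le_Vmin (h : BootstrapParameters δ₀ n δ T Vmin) {b : ℝ} (hb : 0 < b)
    (hδ : δ₀ ≤ b⁻¹) : b ≤ Vmin :=
  (inv_le_inv₀ h.Vmin_pos hb).1 (h.inv_Vmin_le.trans (h.delta_le.trans hδ))

/-- Either the logarithm is at most 1, or it is at most its n-th power and hence at most 1/δ. Any n
≥ 1 suffices. -/
lemma BootstrapParameters.mul_log_le (h : BootstrapParameters δ₀ n δ T Vmin) (hn : n ≠ 0)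
    (hδ : δ₀ ≤ 1) : δ * Real.log (2 + T) ≤ 1 := by
  have h1 := h.delta_pos
  have h2 := h.delta_le.trans hδ
  rcases le_or_gt (Real.log (2 + T)) 1 with hl | hl
  · nlinarith
  · have h3 : Real.log (2 + T) ≤ δ⁻¹ := (le_self_pow₀ hl.le hn).trans h.log_le
    calc δ * Real.log (2 + T) ≤ δ * δ⁻¹ := by gcongr
      _ = 1 := mul_inv_cancel₀ h1.ne'

lemma BootstrapParameters.charge_moment_le (h : BootstrapParameters δ₀ n δ T Vmin) (hA : 0 ≤ A)
    (ha : 0 < a) : 32 * A / (a * Vmin / 2) ≤ 64 * A / a * δ := by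
  have h1 := h.Vmin_pos
  calc 32 * A / (a * Vmin / 2) = 64 * A / a * Vmin⁻¹ := by field_simp; ring
    _ ≤ _ := mul_le_mul_of_nonneg_left h.inv_Vmin_le (by positivity)

lemma BootstrapParameters.forceSetting (h : BootstrapParameters δ₀ n δ T Vmin) (hT : 0 ≤ T)
    (hsol : IsSolution μ Φ κ T f X V) (hden : BootstrapDensity δ T (density μ f) X V)
    (hch : BootstrapCharge K T Vmin μ X V) (hΦ : ExpDecay A a Φ) (ha : 0 < a)
    (h8 : 8 ≤ Vmin) (h12 : 12 ≤ a * Vmin)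
    (hδ : δ * (32 * Real.pi * fieldConst + 64 * A / a) ≤ 1 / 2) :
    ForceSetting T Vmin (fieldConst * δ) A a X V (force Φ (density μ f) X)
      (fun t x => fieldDeriv (density μ f) t x + fderiv ℝ (∇ Φ) (x - X t)) := by
  have hm : FastMotion T Vmin X V := ⟨hT, h.Vmin_pos, hsol.position, hch.Vmin_le⟩
  have hρ : DensityBound δ T (density μ f) X V :=
    ⟨hsol.density_differentiable, hsol.density_gradient_continuousOn, hden⟩
  refine ⟨hm, hρ.regularForce hm (by linarith) hΦ,
    mul_nonneg fieldConst_nonneg h.delta_pos.le, hΦ.nonneg, ha, h8, by linarith, ?_⟩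
  unfold momentBound
  linarith [h.charge_moment_le hΦ.nonneg ha]

lemma BootstrapParameters.secondMomentBound_le (h : BootstrapParameters δ₀ n δ T Vmin)
    (hn : n ≠ 0) (hδ : δ₀ ≤ 1) (hA : 0 ≤ A) (ha : 0 < a) :
    secondMomentBound (fieldConst * δ) A a Vmin T ≤ 64 * fieldConst + 64 * A / a := by
  have h1 := h.charge_moment_le hA ha
  have h2 : 64 * A / a * δ ≤ 64 * A / a :=
    mul_le_of_le_one_right (by positivity) (h.delta_le.trans hδ)
  have h3 := mul_le_mul_of_nonneg_left (h.mul_log_le hn hδ) fieldConst_nonneg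
  unfold secondMomentBound
  linarith

end Parameters

end FastCharge

/-! ### Choice of the constants and conclusion. -/

theorem mainTheorem3 (A a K : ℝ) (ha : 0 < a) :
    ∃ (n₀ : ℕ) (δ₀ C : ℝ), 0 < δ₀ ∧ 0 < C ∧
      ∀ (n : ℕ), n₀ ≤ n →
      ∀ (μ Φ : FastCharge.E3 → ℝ), FastCharge.ExpDecay A a μ → FastCharge.ExpDecay A a Φ →
      ∀ (κ δ T Vmin : ℝ) (f : ℝ → FastCharge.E3 → FastCharge.E3 → ℝ) (X V : ℝ → FastCharge.E3)
        (XX VV : ℝ → ℝ → FastCharge.E3 → FastCharge.E3 → FastCharge.E3),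
        FastCharge.IsSolution μ Φ κ T f X V →
        FastCharge.IsCharacteristicFlow
          (FastCharge.force Φ (FastCharge.density μ f) X) T XX VV →
        FastCharge.BootstrapDensity δ T (FastCharge.density μ f) X V →
        FastCharge.BootstrapParameters δ₀ n δ T Vmin →
        FastCharge.BootstrapCharge K T Vmin μ X V →
        ∀ t ∈ Set.Icc 0 T, ∀ x : FastCharge.E3,
          MeasureTheory.IntegrableOn
            (fun p : ℝ × FastCharge.E3 =>
              FastCharge.sourceIntegrand μ Φ X XX VV t x p.1 p.2) (Set.Ioc 0 t ×ˢ Set.univ) ∧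
          MeasureTheory.IntegrableOn
            (fun p : ℝ × FastCharge.E3 =>
              FastCharge.linearSourceIntegrand μ Φ X V t x p.1 p.2) (Set.Iic t ×ˢ Set.univ) ∧
          |FastCharge.source μ Φ X XX VV t x| + |FastCharge.linearSource μ Φ X V t x|
            ≤ C / (Vmin * FastCharge.weight 2 T X V t x) ∧
          DifferentiableAt ℝ (FastCharge.source μ Φ X XX VV t) x ∧
          ‖gradient (FastCharge.source μ Φ X XX VV t) x‖
            ≤ C / (Vmin * FastCharge.weight 3 T X V t x) := by
  set Q := FastCharge.fieldConst with hQ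
  have hQ0 : 0 ≤ Q := FastCharge.fieldConst_nonneg
  set M := 32 * Real.pi * Q + 64 * |A| / a with hM
  have hM0 : 0 ≤ M := by positivity
  set B := FastCharge.integrandConst A a (64 * Q + 64 * A / a) * Real.exp (a / 2)
  set C₁ := B * FastCharge.weightConst (a / 4) K 2 * FastCharge.dispersionConst (a / 4 / 2)
  set C₂ := B * FastCharge.weightConst (a / 4) K 3 * FastCharge.dispersionConst (a / 4 / 2)
  set C₃ := A ^ 2 * FastCharge.weightConst a K 2 * FastCharge.dispersionConst (a / 2)
  -- The three entries of δ₀ enforce Vmin ≥ 8, a Vmin ≥ 12 and small moments at most 1/2. Absolute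
  -- values appear because the sign of A is known only once Φ is given, after the constants have
  -- been chosen.
  refine ⟨1, min 8⁻¹ (min (12 / a)⁻¹ (2 * (M + 1))⁻¹), |C₁| + |C₂| + |C₃| + 1, by positivity,
    by positivity, ?_⟩
  intro n hn μ Φ hμ hΦ κ δ T Vmin f X V XX VV hsol fl hden hpar hch t ht x
  have hA := hΦ.nonneg
  have h8 : 8 ≤ Vmin := hpar.le_Vmin (by norm_num) (min_le_left _ _)
  have h12 : 12 ≤ a * Vmin := by
    have := hpar.le_Vmin (b := 12 / a) (by positivity)
      ((min_le_right _ _).trans (min_le_left _ _))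
    rwa [div_le_iff₀' ha] at this
  have hδ : δ * (32 * Real.pi * Q + 64 * A / a) ≤ 1 / 2 := by
    have h1 : δ ≤ (2 * (M + 1))⁻¹ :=
      hpar.delta_le.trans ((min_le_right _ _).trans (min_le_right _ _))
    have h2 : 32 * Real.pi * Q + 64 * A / a = M := by rw [hM, abs_of_nonneg hA]
    rw [h2]
    calc δ * M ≤ (2 * (M + 1))⁻¹ * (M + 1) := by gcongr; linarith
      _ = 1 / 2 := by field_simp
  have hT : 0 ≤ T := ht.1.trans ht.2
  -- Comparing the positive initial speed with itself in (B3) forces K ≥ 1.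
  have hK : 1 ≤ K := by
    have h0 : (0 : ℝ) ∈ Set.Icc 0 T := ⟨le_rfl, hT⟩
    have h1 := hch.almost_decreasing 0 h0 0 ⟨le_rfl, le_rfl⟩
    have h2 := hch.Vmin_le 0 h0
    by_contra! hlt
    nlinarith
  have H := hpar.forceSetting hT hsol hden hch hΦ ha h8 h12 hδ
  have hδ₀ : min 8⁻¹ (min (12 / a)⁻¹ (2 * (M + 1))⁻¹) ≤ (1 : ℝ) :=
    (min_le_left _ _).trans (by norm_num)
  have hN := hpar.secondMomentBound_le (by lia) hδ₀ hA ha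
  obtain ⟨hi, hb, hd, hg⟩ := H.source_bound fl hμ hΦ hch hK h12 (by positivity) hN ht x
  obtain ⟨hli, hlb⟩ := FastCharge.linearSource_bound H.motion H.one_le_Vmin hK ha hμ hΦ hch ht x
  change _ ≤ C₁ / _ at hb
  change _ ≤ C₂ / _ at hg
  change _ ≤ C₃ / _ at hlb
  have hV0 := hpar.Vmin_pos
  have hw2 := FastCharge.weight_pos (T := T) (X := X) (V := V) 2 t x
  have hw3 := FastCharge.weight_pos (T := T) (X := X) (V := V) 3 t x
  refine ⟨hi, hli, (add_le_add hb hlb).trans ?_, hd, hg.trans ?_⟩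
  · rw [← add_div]
    refine div_le_div_of_nonneg_right ?_ (by positivity)
    linarith [le_abs_self C₁, abs_nonneg C₂, le_abs_self C₃]
  · refine div_le_div_of_nonneg_right ?_ (by positivity)
    linarith [abs_nonneg C₁, le_abs_self C₂, abs_nonneg C₃]
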